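/- Let $k$ be a field and let $T$ be a $k$-linear category with a $k$-linear shift $[m]$, $m\in\mathbb Z$; for example $T=D^b(X)$, the bounded derived category of coherent sheaves on a variety $X$ over $k=\mathbb C$, or the derived category of any $k$-linear abelian category. For objects $F,G$ of $T$ put $\mathrm{Ext}^m(F,G)=\mathrm{Hom}_T(F,G[m])$. Let $N\ge 2$ and let $F_1,\dots,F_n$ be an $A_n$-chain of $N$-spherical objects of $T$. That is, for each $i$, $\mathrm{Ext}^m(F_i,F_i)$ is one-dimensional for $m=0,N$ and zero for all other $m$, and $$\sum_{m}\dim_k \mathrm{Ext}^m(F_i,F_j)=\begin{cases}1 & |i-j|=1,\\ 0 & |i-j|>1.\end{cases}$$ Assume moreover that the objects satisfy duality with respect to each other: for all $i,j$ and all $m\in\mathbb Z$ the composition pairing $$\mathrm{Ext}^m(F_i,F_j)\otimes \mathrm{Ext}^{N-m}(F_j,F_i)\longrightarrow \mathrm{Ext}^N(F_i,F_i)\cong k$$ is perfect. Then the graded algebra $$A=\bigoplus_{m\in\mathbb Z}\ \bigoplus_{i,j=1}^n \mathrm{Ext}^m(F_i,F_j),$$ with composition as product, is intrinsically formal: every (unital,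 $\mathbb Z$-graded) differential graded algebra $B$ over $k$ whose cohomology algebra $H^*(B)$ is isomorphic to $A$ as a graded algebra is quasi-isomorphic to $A$, where $A$ carries the zero differential; that is, there are a differential graded algebra $D$ and quasi-isomorphisms of differential graded algebras $B\leftarrow D\to A$. -/

import Mathlib

open CategoryTheory DirectSum

universe u v w a b

/-! ### Differential graded algebras over a field -/

/-- A (unital, associative, cohomologically `ℤ`-graded) differential graded algebra over `k`:
a `ℤ`-graded `k`-algebra with a differential of degree `+1` which squares to zero and satisfies
the graded Leibniz rule. -/
structure DGAlgebra (k : Type u) [Field k] where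
  carrier : Type a
  [ring : Ring carrier]
  [algebra : Algebra k carrier]
  gr : ℤ → Submodule k carrier
  [graded : GradedAlgebra gr]
  d : carrier →ₗ[k] carrier
  d_mem : ∀ (m : ℤ) (x : carrier), x ∈ gr m → d x ∈ gr (m + 1)
  d_d : ∀ x : carrier, d (d x) = 0
  leibniz : ∀ (m : ℤ) (x y : carrier), x ∈ gr m →
    d (x * y) = d x * y + m.negOnePow • (x * d y)

namespace DGAlgebra

attribute [instance] DGAlgebra.ring DGAlgebra.algebra DGAlgebra.graded

variable {k : Type u} [Field k]

/-- The homogeneous component of degree `m` of an element. -/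
noncomputable def comp (B : DGAlgebra.{u, a} k) (x : B.carrier) (m : ℤ) : B.carrier :=
  (decompose B.gr x m : B.carrier)

theorem comp_mem (B : DGAlgebra.{u, a} k) (x : B.carrier) (m : ℤ) : B.comp x m ∈ B.gr m :=
  (decompose B.gr x m).2

theorem d_one (B : DGAlgebra.{u, a} k) : B.d 1 = 0 := by
  have h := B.leibniz 0 1 1 SetLike.GradedOne.one_mem
  simpa using h

/-- The homogeneous components of a cocycle are cocycles. -/
theorem d_comp (B : DGAlgebra.{u, a} k) (x : B.carrier) (hx : B.d x = 0) (m : ℤ) :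
    B.d (B.comp x m) = 0 := by
  classical
  have key : ∀ y : B.carrier,
      (decompose B.gr (B.d y) (m + 1) : B.carrier) = B.d (B.comp y m) := by
    intro y
    induction y using DirectSum.Decomposition.inductionOn B.gr with
    | zero => simp [comp]
    | @homogeneous i z =>
      by_cases h : i = m
      · subst h
        rw [comp, decompose_of_mem_same _ (B.d_mem i _ z.2), decompose_of_mem_same _ z.2]
      · rw [comp, decompose_of_mem_ne _ (B.d_mem i _ z.2) (by omega),
          decompose_of_mem_ne _ z.2 h, map_zero]
    | add y z hy hz =>
      simp only [comp, map_add, decompose_add, DirectSum.add_apply, Submodule.coe_add] at *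
      rw [hy, hz]
  rw [← key, hx]
  simp

/-- The graded Leibniz rule for a homogeneous cocycle on the left. -/
theorem d_comp_mul (B : DGAlgebra.{u, a} k) (x y : B.carrier) (hx : B.d x = 0) (m : ℤ) :
    B.d (B.comp x m * y) = m.negOnePow • (B.comp x m * B.d y) := by
  rw [B.leibniz m _ _ (B.comp_mem x m), B.d_comp x hx m, zero_mul, zero_add]

theorem sum_comp (B : DGAlgebra.{u, a} k) (x : B.carrier) :
    ∃ s : Finset ℤ, ∑ m ∈ s, B.comp x m = x := by
  classical
  exact ⟨_, sum_support_decompose B.gr x⟩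

/-- The subalgebra `ker d` of cocycles. -/
def cocycles (B : DGAlgebra.{u, a} k) : Subalgebra k B.carrier where
  carrier := {x | B.d x = 0}
  mul_mem' := by
    intro x y hx hy
    change B.d x = 0 at hx
    change B.d y = 0 at hy
    obtain ⟨s, hs⟩ := B.sum_comp x
    change B.d (x * y) = 0
    rw [← hs, Finset.sum_mul, map_sum]
    refine Finset.sum_eq_zero fun m _ => ?_
    rw [B.d_comp_mul x y hx m, hy, mul_zero, smul_zero]
  add_mem' := by
    intro x y hx hy
    change B.d x = 0 at hx
    change B.d y = 0 at hy
    change B.d (x + y) = 0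
    rw [map_add, hx, hy, add_zero]
  algebraMap_mem' := by
    intro r
    change B.d (algebraMap k B.carrier r) = 0
    rw [Algebra.algebraMap_eq_smul_one, map_smul, B.d_one, smul_zero]

theorem d_coe (B : DGAlgebra.{u, a} k) (z : B.cocycles) : B.d (z : B.carrier) = 0 := z.2

/-- The ideal `im d` of coboundaries in the algebra of cocycles. -/
def coboundaries (B : DGAlgebra.{u, a} k) : Ideal B.cocycles where
  carrier := {z | ∃ y : B.carrier, B.d y = (z : B.carrier)}
  zero_mem' := ⟨0, by simp⟩
  add_mem' := by
    rintro z z' ⟨y, hy⟩ ⟨y', hy'⟩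
    exact ⟨y + y', by simp [hy, hy']⟩
  smul_mem' := by
    rintro c z ⟨y, hy⟩
    obtain ⟨s, hs⟩ := B.sum_comp (c : B.carrier)
    refine ⟨∑ m ∈ s, m.negOnePow • (B.comp (c : B.carrier) m * y), ?_⟩
    have e : ∀ m : ℤ, B.d (m.negOnePow • (B.comp (c : B.carrier) m * y)) =
        B.comp (c : B.carrier) m * (z : B.carrier) := by
      intro m
      have h := B.d_comp_mul (c : B.carrier) y (B.d_coe c) m
      rcases Int.units_eq_one_or m.negOnePow with h1 | h1
      · rw [h1, one_smul] at h ⊢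
        rw [h, hy]
      · rw [h1] at h ⊢
        simp only [Units.neg_smul, one_smul, map_neg] at h ⊢
        rw [h, neg_neg, hy]
    rw [map_sum, Finset.sum_congr rfl fun m _ => e m, ← Finset.sum_mul, hs]
    rfl

instance (B : DGAlgebra.{u, a} k) : B.coboundaries.IsTwoSided where
  mul_mem_of_left := by
    rintro z c ⟨y, hy⟩
    refine ⟨y * (c : B.carrier), ?_⟩
    obtain ⟨s, hs⟩ := B.sum_comp y
    have e : ∀ m : ℤ, B.d (B.comp y m * (c : B.carrier)) =
        B.d (B.comp y m) * (c : B.carrier) := by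
      intro m
      rw [B.leibniz m _ _ (B.comp_mem y m), B.d_coe c, mul_zero, smul_zero, add_zero]
    have e2 : B.d (y * (c : B.carrier)) = B.d y * (c : B.carrier) := by
      conv_lhs => rw [← hs, Finset.sum_mul, map_sum]
      rw [Finset.sum_congr rfl fun m _ => e m, ← Finset.sum_mul, ← map_sum, hs]
    rw [e2, hy]
    rfl

/-- The cohomology algebra `H(B) = ker d / im d`. -/
abbrev Cohomology (B : DGAlgebra.{u, a} k) : Type a := B.cocycles ⧸ B.coboundaries

/-- The degree `m` part `H^m(B)` of the cohomology: classes of cocycles of degree `m`. -/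
def cohomologyGr (B : DGAlgebra.{u, a} k) (m : ℤ) : Submodule k B.Cohomology :=
  ((B.gr m).comap B.cocycles.val.toLinearMap).map
    (Ideal.Quotient.mkₐ k B.coboundaries).toLinearMap

/-- A morphism of dg algebras: a unital algebra homomorphism of degree zero which commutes with
the differentials. -/
structure Hom (B : DGAlgebra.{u, a} k) (C : DGAlgebra.{u, b} k) where
  toAlgHom : B.carrier →ₐ[k] C.carrier
  map_gr : ∀ (m : ℤ) (x : B.carrier), x ∈ B.gr m → toAlgHom x ∈ C.gr m
  map_d : ∀ x : B.carrier, toAlgHom (B.d x) = C.d (toAlgHom x)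

/-- The map induced by a morphism of dg algebras on cocycles. -/
def Hom.cocyclesMap {B : DGAlgebra.{u, a} k} {C : DGAlgebra.{u, b} k} (f : Hom B C) :
    B.cocycles →ₐ[k] C.cocycles :=
  (f.toAlgHom.comp B.cocycles.val).codRestrict C.cocycles fun z => by
    change C.d (f.toAlgHom (z : B.carrier)) = 0
    rw [← f.map_d, B.d_coe, map_zero]

/-- The map induced by a morphism of dg algebras on cohomology. -/
def Hom.cohomologyMap {B : DGAlgebra.{u, a} k} {C : DGAlgebra.{u, b} k} (f : Hom B C) :
    B.Cohomology →ₐ[k] C.Cohomology :=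
  Ideal.quotientMapₐ C.coboundaries f.cocyclesMap (by
    rintro z ⟨y, hy⟩
    refine ⟨f.toAlgHom y, ?_⟩
    rw [← f.map_d, hy]
    rfl)

/-- A quasi-isomorphism is a morphism of dg algebras inducing an isomorphism on cohomology. -/
def Hom.IsQuasiIso {B : DGAlgebra.{u, a} k} {C : DGAlgebra.{u, b} k} (f : Hom B C) : Prop :=
  Function.Bijective f.cohomologyMap

/-- Two dg algebras `B`, `C` are quasi-isomorphic if there are a dg algebra `D` and
quasi-isomorphisms `B ← D → C`. -/
def QuasiIsomorphic (B : DGAlgebra.{u, a} k) (C : DGAlgebra.{u, b} k) : Prop :=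
  ∃ (D : DGAlgebra.{u, max u a b} k) (f : Hom D B) (g : Hom D C), f.IsQuasiIso ∧ g.IsQuasiIso

/-- A graded algebra, regarded as a dg algebra with zero differential. -/
def ofGraded {A : Type a} [Ring A] [Algebra k A] (𝒜 : ℤ → Submodule k A) [GradedAlgebra 𝒜] :
    DGAlgebra.{u, a} k where
  carrier := A
  gr := 𝒜
  d := 0
  d_mem := fun _ _ _ => Submodule.zero_mem _
  d_d := fun _ => rfl
  leibniz := by simp

/-- The cohomology algebra of `B` is isomorphic to `A` as a graded algebra. -/
def HasCohomology (B : DGAlgebra.{u, b} k) {A : Type a} [Ring A] [Algebra k A]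
    (𝒜 : ℤ → Submodule k A) : Prop :=
  ∃ e : B.Cohomology ≃ₐ[k] A, ∀ m : ℤ, (B.cohomologyGr m).map e.toLinearMap = 𝒜 m

end DGAlgebra

/-- A graded algebra `A` is intrinsically formal if every dg algebra (in the universe `b`) whose
cohomology is isomorphic to `A` as a graded algebra is quasi-isomorphic to `A` with zero
differential. -/
def IsIntrinsicallyFormal (k : Type u) [Field k] {A : Type a} [Ring A] [Algebra k A]
    (𝒜 : ℤ → Submodule k A) [GradedAlgebra 𝒜] : Prop :=
  ∀ B : DGAlgebra.{u, b} k, B.HasCohomology 𝒜 →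
    DGAlgebra.QuasiIsomorphic B (DGAlgebra.ofGraded 𝒜)

/-! ### Graded algebras given by their homogeneous pieces -/

namespace DirectSum

variable (k : Type u) [Field k] (E : ℤ → Type v) [∀ m, AddCommGroup (E m)] [∀ m, Module k (E m)]

/-- The piece of degree `m` inside `⨁ m, E m`. -/
def piece (m : ℤ) : Submodule k (⨁ m, E m) := LinearMap.range (lof k ℤ E m)

/-- The projection of `⨁ m, E m` to its pieces. -/
noncomputable def pieceDecompose : (⨁ m, E m) →ₗ[k] ⨁ m, piece k E m :=
  toModule k ℤ _ fun m =>
    (lof k ℤ (fun m => piece k E m) m).comp (LinearMap.rangeRestrict (lof k ℤ E m))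

noncomputable instance pieceGradedAlgebra [GRing E] [GAlgebra k E] :
    GradedAlgebra (piece k E) where
  one_mem := ⟨GradedMonoid.GOne.one, rfl⟩
  mul_mem := by
    rintro i j _ _ ⟨x, rfl⟩ ⟨y, rfl⟩
    exact ⟨GradedMonoid.GMul.mul x y, (of_mul_of x y).symm⟩
  toDecomposition := Decomposition.ofLinearMap (piece k E) (pieceDecompose k E)
    (by
      ext m x : 2
      simp only [LinearMap.comp_apply, LinearMap.id_apply, pieceDecompose, toModule_lof]
      exact coeLinearMap_lof (piece k E) m _)
    (by
      ext m x : 2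
      obtain ⟨_, x, rfl⟩ := x
      simp only [LinearMap.comp_apply, LinearMap.id_apply, coeLinearMap_lof, pieceDecompose,
        toModule_lof]
      rfl)

end DirectSum

/-! ### The Ext-algebra of a finite family of objects

For objects `X`, `Y` of a `k`-linear category `T` with a shift (such as the bounded derived category
of coherent sheaves on a variety over `k`, or the derived category of any `k`-linear abelian
category), `Ext^m(X, Y) = Hom(X, Y[m])` is Mathlib's `ShiftedHom X Y m`. -/

section Ext

variable (k : Type u) [Field k] {T : Type w} [Category.{v} T] [Preadditive T] [Linear k T]
  [HasShift T ℤ]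

/-- `⨁_{i,j} Ext^m(F i, F j)`; the entry `x i j` of an element `x` lies in `Ext^m(F i, F j)`. -/
def ExtPiece {T : Type w} [Category.{v} T] [HasShift T ℤ] {n : ℕ} (F : Fin n → T) (m : ℤ) :
    Type v :=
  ∀ i j : Fin n, ShiftedHom (F i) (F j) m

namespace ExtPiece

variable {n : ℕ} (F : Fin n → T)

noncomputable instance (m : ℤ) : AddCommGroup (ExtPiece F m) :=
  inferInstanceAs (AddCommGroup (∀ i j : Fin n, ShiftedHom (F i) (F j) m))

noncomputable instance (m : ℤ) : Module k (ExtPiece F m) :=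
  inferInstanceAs (Module k (∀ i j : Fin n, ShiftedHom (F i) (F j) m))

variable {F}

/-- The product of matrices of shifted morphisms, `(x * y) i l = ∑ j, x j l ∘ y i j`. -/
noncomputable def mul {p q r : ℤ} (h : p + q = r) (x : ExtPiece F p) (y : ExtPiece F q) :
    ExtPiece F r :=
  fun i l => ∑ j : Fin n, (y i j).comp (x j l) h

/-- The matrix with the identities on the diagonal and zeros elsewhere. -/
noncomputable def one : ExtPiece F 0 :=
  fun i j => if h : i = j then ShiftedHom.mk₀ 0 rfl (eqToHom (congrArg F h)) else 0

theorem mk_mul {p q r s : ℤ} (h : p + q = r) (h' : p + q = s) (x : ExtPiece F p)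
    (y : ExtPiece F q) : GradedMonoid.mk r (mul h x y) = GradedMonoid.mk s (mul h' x y) := by
  subst h
  subst h'
  rfl

theorem one_mul [∀ m : ℤ, (shiftFunctor T m).Additive]
    {p : ℤ} (x : ExtPiece F p) : mul (zero_add p) one x = x := by
  funext i l
  change ∑ j : Fin n, (x i j).comp (one j l) (zero_add p) = x i l
  rw [Finset.sum_eq_single l]
  · simp [one]
  · intro j _ hj
    simp [one, hj]
  · simp

theorem mul_one {p : ℤ} (x : ExtPiece F p) : mul (add_zero p) x one = x := by
  funext i l
  change ∑ j : Fin n, (one i j).comp (x j l) (add_zero p) = x i l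
  rw [Finset.sum_eq_single i]
  · simp [one]
  · intro j _ hj
    simp [one, Ne.symm hj]
  · simp

theorem mul_assoc [∀ m : ℤ, (shiftFunctor T m).Additive]
    {p q r pq qr s : ℤ} (hpq : p + q = pq) (hqr : q + r = qr) (h : p + q + r = s)
    (x : ExtPiece F p) (y : ExtPiece F q) (z : ExtPiece F r) :
    mul (by rw [← hpq, h]) (mul hpq x y) z =
      mul (by rw [← hqr, ← add_assoc, h]) x (mul hqr y z) := by
  funext i l
  have hadd : ∀ {X Y Z : T} {a b c : ℤ} (f : ShiftedHom X Y a) (s : Finset (Fin n))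
      (g : Fin n → ShiftedHom Y Z b) (e : b + a = c),
      f.comp (∑ j ∈ s, g j) e = ∑ j ∈ s, f.comp (g j) e := by
    intro X Y Z a b c f s g e
    exact map_sum (⟨⟨fun t => f.comp t e, by simp⟩, by simp⟩ :
      ShiftedHom Y Z b →+ ShiftedHom X Z c) g s
  have hadd' : ∀ {X Y Z : T} {a b c : ℤ} (s : Finset (Fin n))
      (f : Fin n → ShiftedHom X Y a) (g : ShiftedHom Y Z b) (e : b + a = c),
      (∑ j ∈ s, f j).comp g e = ∑ j ∈ s, (f j).comp g e := by
    intro X Y Z a b c s f g e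
    exact map_sum (⟨⟨fun t => t.comp g e, by simp⟩, by simp⟩ :
      ShiftedHom X Y a →+ ShiftedHom X Z c) f s
  simp only [mul, hadd, hadd']
  rw [Finset.sum_comm]
  refine Finset.sum_congr rfl fun j _ => Finset.sum_congr rfl fun j' _ => ?_
  rw [ShiftedHom.comp_assoc _ _ _ hqr hpq h]

theorem mul_add {p q r : ℤ} (h : p + q = r) (x : ExtPiece F p) (y z : ExtPiece F q) :
    mul h x (y + z) = mul h x y + mul h x z := by
  funext i l
  change ∑ j : Fin n, (y i j + z i j).comp (x j l) h =
    (∑ j : Fin n, (y i j).comp (x j l) h) + ∑ j : Fin n, (z i j).comp (x j l) h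
  simp [Finset.sum_add_distrib]

theorem add_mul [∀ m : ℤ, (shiftFunctor T m).Additive]
    {p q r : ℤ} (h : p + q = r) (x y : ExtPiece F p) (z : ExtPiece F q) :
    mul h (x + y) z = mul h x z + mul h y z := by
  funext i l
  change ∑ j : Fin n, (z i j).comp (x j l + y j l) h =
    (∑ j : Fin n, (z i j).comp (x j l) h) + ∑ j : Fin n, (z i j).comp (y j l) h
  simp [Finset.sum_add_distrib]

theorem mul_zero {p q r : ℤ} (h : p + q = r) (x : ExtPiece F p) :
    mul h x (0 : ExtPiece F q) = 0 := by
  have e := mul_add h x 0 0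
  rwa [add_zero, left_eq_add] at e

theorem zero_mul [∀ m : ℤ, (shiftFunctor T m).Additive]
    {p q r : ℤ} (h : p + q = r) (y : ExtPiece F q) :
    mul h (0 : ExtPiece F p) y = 0 := by
  have e := add_mul h 0 0 y
  rwa [add_zero, left_eq_add] at e

theorem mul_smul {p q r : ℤ} (h : p + q = r) (c : k) (x : ExtPiece F p) (y : ExtPiece F q) :
    mul h x (c • y) = c • mul h x y := by
  funext i l
  change ∑ j : Fin n, (c • y i j).comp (x j l) h = c • ∑ j : Fin n, (y i j).comp (x j l) h
  simp [Finset.smul_sum]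

theorem smul_mul [∀ m : ℤ, (shiftFunctor T m).Linear k]
    {p q r : ℤ} (h : p + q = r) (c : k) (x : ExtPiece F p) (y : ExtPiece F q) :
    mul h (c • x) y = c • mul h x y := by
  funext i l
  change ∑ j : Fin n, (y i j).comp (c • x j l) h = c • ∑ j : Fin n, (y i j).comp (x j l) h
  simp [Finset.smul_sum]

variable (F)

noncomputable instance : GradedMonoid.GOne (ExtPiece F) where
  one := one

noncomputable instance : GradedMonoid.GMul (ExtPiece F) where
  mul := mul rfl

noncomputable instance [∀ m : ℤ, (shiftFunctor T m).Additive] :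
    GRing (ExtPiece F) where
  one_mul := fun ⟨p, x⟩ => (mk_mul rfl (zero_add p) one x).trans
    (congrArg (GradedMonoid.mk p) (one_mul x))
  mul_one := fun ⟨p, x⟩ => (mk_mul rfl (add_zero p) x one).trans
    (congrArg (GradedMonoid.mk p) (mul_one x))
  mul_assoc := fun ⟨p, x⟩ ⟨q, y⟩ ⟨r, z⟩ =>
    (congrArg (GradedMonoid.mk (p + q + r)) (mul_assoc rfl rfl rfl x y z)).trans
      (mk_mul _ rfl x (mul rfl y z))
  mul_zero := fun x => mul_zero rfl x
  zero_mul := fun y => zero_mul rfl y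
  mul_add := fun x y z => mul_add rfl x y z
  add_mul := fun x y z => add_mul rfl x y z
  natCast := fun c => c • one
  natCast_zero := zero_smul _ _
  natCast_succ := fun c => succ_nsmul _ _
  intCast := fun c => c • one
  intCast_ofNat := fun c => natCast_zsmul _ _
  intCast_negSucc_ofNat := fun c => negSucc_zsmul _ _

noncomputable instance [∀ m : ℤ, (shiftFunctor T m).Additive]
    [∀ m : ℤ, (shiftFunctor T m).Linear k] : GAlgebra k (ExtPiece F) where
  toFun := (LinearMap.toSpanSingleton k (ExtPiece F 0) one).toAddMonoidHom
  map_one := one_smul k (one : ExtPiece F 0)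
  map_mul := fun c d => by
    refine Eq.trans ?_ (mk_mul (add_zero 0) rfl (c • (one : ExtPiece F 0))
      (d • (one : ExtPiece F 0)))
    refine congrArg (GradedMonoid.mk 0) ?_
    rw [mul_smul, mul_one, smul_smul, mul_comm]
    rfl
  commutes := fun c ⟨p, x⟩ => by
    refine (mk_mul rfl (zero_add p) (c • (one : ExtPiece F 0)) x).trans ?_
    refine Eq.trans ?_ (mk_mul (add_zero p) rfl x (c • (one : ExtPiece F 0)))
    rw [smul_mul, mul_smul, one_mul, mul_one]
  smul_def := fun c ⟨p, x⟩ => by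
    refine Eq.trans ?_ (mk_mul (zero_add p) rfl (c • (one : ExtPiece F 0)) x)
    rw [smul_mul, one_mul]
    rfl

end ExtPiece

/-- The graded algebra `⨁_{i,j,m} Ext^m(F i, F j)`, with the composition product. Its grading is
`DirectSum.piece k (ExtPiece F)`. -/
abbrev ExtAlgebra {T : Type w} [Category.{v} T] [Preadditive T] [HasShift T ℤ]
    {n : ℕ} (F : Fin n → T) : Type v :=
  ⨁ m : ℤ, ExtPiece F m

/-- `X` is `N`-spherical: `Ext^m(X, X)` is one-dimensional for `m = 0, N` and zero otherwise. -/
def IsSpherical (N : ℕ) (X : T) : Prop :=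
  ∀ m : ℤ, Module.rank k (ShiftedHom X X m) = if m = 0 ∨ m = (N : ℤ) then 1 else 0

/-- An `A_n`-chain of `N`-spherical objects: the total dimension of `Ext^*(F i, F j)` is `1` if
`|i - j| = 1` and `0` if `|i - j| > 1`. -/
structure IsAChain (N : ℕ) {n : ℕ} (F : Fin n → T) : Prop where
  spherical : ∀ i : Fin n, IsSpherical k N (F i)
  adjacent : ∀ i j : Fin n, |(i : ℤ) - (j : ℤ)| = 1 →
    Cardinal.sum (fun m : ℤ => Module.rank k (ShiftedHom (F i) (F j) m)) = 1
  distant : ∀ i j : Fin n, 1 < |(i : ℤ) - (j : ℤ)| →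
    Cardinal.sum (fun m : ℤ => Module.rank k (ShiftedHom (F i) (F j) m)) = 0

/-- The composition pairing `Ext^m(X, Y) × Ext^(N-m)(Y, X) → Ext^N(X, X)`. -/
noncomputable def extPairing [∀ m : ℤ, (shiftFunctor T m).Additive]
    [∀ m : ℤ, (shiftFunctor T m).Linear k] (N : ℕ) (X Y : T) (m : ℤ) :
    ShiftedHom X Y m →ₗ[k] ShiftedHom Y X ((N : ℤ) - m) →ₗ[k] ShiftedHom X X (N : ℤ) :=
  LinearMap.mk₂ k (fun f g => f.comp g (sub_add_cancel (N : ℤ) m))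
    (by simp) (by simp) (by simp) (by simp)

/-- The duality between `Ext^*(X, Y)` and `Ext^(N-*)(Y, X)`: for an identification of the
one-dimensional space `Ext^N(X, X)` with `k`, the pairings
`Ext^m(X, Y) × Ext^(N-m)(Y, X) → Ext^N(X, X) ≃ k` are perfect. -/
def HasDuality [∀ m : ℤ, (shiftFunctor T m).Additive]
    [∀ m : ℤ, (shiftFunctor T m).Linear k] (N : ℕ) (X Y : T) : Prop :=
  ∃ e : ShiftedHom X X (N : ℤ) ≃ₗ[k] k,
    ∀ m : ℤ, ((extPairing k N X Y m).compr₂ e.toLinearMap).IsPerfPair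

end Ext

/-!
The Ext-algebra `A` of an `A_n`-chain is a zigzag algebra: besides the identities of the objects, it
is spanned by one generator for each orientation of each edge of the linear graph, and by one
element of degree `N` at each vertex, the socle element. Duality says precisely that going along an
edge and back is a nonzero multiple of the socle element (`IsAChain.nonempty_chainGenerators`,
`ChainGenerators.zigzagBasis`). All further products of edges vanish for reasons of degree or
because the target `Ext` group is zero.

Let `T` be the multiplication table of the elements of this basis other than one of the
idempotents, so that together with `1` they form a basis of `A`. The words in these letters generate
a free dg algebra, the cobar construction of the bar construction of `A` (`MulTable.cobar`). Its
cohomology is spanned by the classes of `1` and of the words of length one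
(`MulTable.cocycle_normal_form`). A morphism from it to a dg algebra `C` with cohomology `A` is the
same as a twisting cochain, and it is a quasi-isomorphism as soon as the words of length one are
sent to cocycles representing the basis (`MulTable.isQuasiIso_of_classes`). If such a morphism
exists for every `C`, then it exists both for `C = B` and for `C = A`, and `A` is intrinsically
formal (`ZigzagBasis.isIntrinsicallyFormal`). For the empty chain, `A` is the zero algebra
and `B` is acyclic, so that `B` itself maps quasi-isomorphically to `A`.

A twisting cochain is constructed by induction on the length of words. By the Bianchi identity, the
obstruction to extending it from words of length less than `q` to words of length `q` is a
Hochschild cocycle of `A` of arity `q ≥ 3` and internal degree `2 - q`, and the extension is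
possible if it is a coboundary (`MulTable.PartialTwisting.extend`). It therefore remains to be shown
that the Hochschild cohomology of `A` vanishes in these bidegrees
(`ZigzagBasis.hochschildVanishing`).

Every Hochschild cocycle is cohomologous to one which is relative to the span of the idempotents of
the vertices (`MulTable.Vertices.exists_normalization`, `MulTable.Vertices.IsRelative.of_hoch`), so
that it lives on the paths in the graph. Up to a potential on the vertices, the degree of a basis
element is `N / 2` times its path length. Hence if the value of the cocycle on a path of length `s`
has a component of path length `s'`, then `N (s - s') = 2 (q - 2)`. Since `q ≤ s`, `s' ≤ 2` and
`2 ≤ N`, this is only possible if `N = 2`, `s = q` and `s' = 2`: the path is a closed walk along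
edges and the value is a multiple of the socle element (`ZigzagBasis.support_of_isRelative`). The
indicator functions of closed walks are coboundaries, because modulo coboundaries and up to nonzero
factors a closed walk may be rotated (`ZigzagBasis.closed_append_mem`), and a peak `v, v + 1, v` may
be replaced by `v, v - 1, v`, where for the end vertex `v = 0` of the graph nothing is left
(`ZigzagBasis.closed_up_dn_mem`). A closed walk has a peak, and pushing it down decreases the sum of
the heights, so that the process ends (`ZigzagBasis.closed_mem_coboundaries`).
-/

/-! ### Signs -/

/-- The sign `(-1) ^ m` as an element of the ground field. -/
def sgn (k : Type u) [Field k] (m : ℤ) : k := ((m.negOnePow : ℤˣ) : ℤ)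

section Signs

variable {k : Type u} [Field k]

theorem sgn_zero : sgn k 0 = 1 := by simp [sgn]

theorem sgn_add (m p : ℤ) : sgn k (m + p) = sgn k m * sgn k p := by
  simp [sgn, Int.negOnePow_add]

theorem sgn_one : sgn k 1 = -1 := by simp [sgn]

theorem sgn_mul_self (m : ℤ) : sgn k m * sgn k m = 1 := by
  rw [← sgn_add]
  have : (m + m).negOnePow = 1 := Int.negOnePow_even _ ⟨m, rfl⟩
  simp [sgn, this]

theorem sgn_sub (m p : ℤ) : sgn k (m - p) = sgn k m * sgn k p := by
  have h : sgn k m = sgn k (m - p) * sgn k p := by rw [← sgn_add, sub_add_cancel]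
  rw [h, mul_assoc, sgn_mul_self, mul_one]

theorem negOnePow_smul_eq {M : Type*} [AddCommGroup M] [Module k M] (m : ℤ) (x : M) :
    m.negOnePow • x = sgn k m • x := by
  rcases Int.units_eq_one_or m.negOnePow with h | h <;> simp [sgn, h]

theorem DGAlgebra.leibniz_sgn (B : DGAlgebra.{u, a} k) {m : ℤ} {x : B.carrier} (hx : x ∈ B.gr m)
    (y : B.carrier) : B.d (x * y) = B.d x * y + sgn k m • (x * B.d y) := by
  rw [B.leibniz m x y hx, negOnePow_smul_eq (k := k)]

end Signs

/-! ### The bar-cobar construction of an algebra given by structure constants -/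

/-- Structure constants of a non-unital associative `ℤ`-graded algebra with a finite homogeneous
basis `X`: the product of the basis elements `x` and `y` is `∑ z, c x y z • z`. -/
structure MulTable (k : Type u) [Field k] (X : Type) [Fintype X] where
  deg : X → ℤ
  c : X → X → X → k
  deg_eq : ∀ x y z, c x y z ≠ 0 → deg z = deg x + deg y
  assoc : ∀ x y t s, ∑ z, c x y z * c z t s = ∑ z, c y t z * c x z s

/-- A nonempty word in the letters `X`, placed in an arbitrary universe. -/
structure BarWord (X : Type) : Type w where
  head : X
  tail : List X

/-- The free algebra on the nonempty words in `X`. -/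
abbrev Cobar (k : Type u) [Field k] (X : Type) : Type (max u w) :=
  AddMonoidAlgebra k (FreeAddMonoid (BarWord.{w} X))

namespace Cobar

variable {k : Type u} [Field k] {X : Type}

/-- The product of a list of generators. -/
noncomputable def word (l : List (BarWord.{w} X)) : Cobar.{u, w} k X :=
  AddMonoidAlgebra.single (FreeAddMonoid.ofList l) 1

theorem word_nil : (word [] : Cobar.{u, w} k X) = 1 := rfl

theorem word_append (l l' : List (BarWord.{w} X)) :
    (word (l ++ l') : Cobar.{u, w} k X) = word l * word l' := by
  simp [word, AddMonoidAlgebra.single_mul_single, FreeAddMonoid.ofList_append]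

theorem word_cons (g : BarWord.{w} X) (l : List (BarWord.{w} X)) :
    (word (g :: l) : Cobar.{u, w} k X) = word [g] * word l :=
  word_append [g] l

@[elab_as_elim]
theorem induction_words {p : Cobar.{u, w} k X → Prop} (x : Cobar.{u, w} k X)
    (word : ∀ l, p (word l)) (add : ∀ x y, p x → p y → p (x + y))
    (smul : ∀ (r : k) x, p x → p (r • x)) : p x := by
  refine AddMonoidAlgebra.induction_linear (motive := p) x ?_ add fun m r => ?_
  · simpa using smul 0 _ (word [])
  · have : (AddMonoidAlgebra.single m r : Cobar.{u, w} k X) =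
        r • Cobar.word (FreeAddMonoid.toList m) := by
      simp [Cobar.word]
    rw [this]
    exact smul _ _ (word _)

/-- The linear map with prescribed values on words. -/
noncomputable def onWords {M : Type*} [AddCommGroup M] [Module k M]
    (φ : List (BarWord.{w} X) → M) : Cobar.{u, w} k X →ₗ[k] M :=
  (Finsupp.lsum k fun m => LinearMap.toSpanSingleton k M (φ (FreeAddMonoid.toList m))).comp
    (AddMonoidAlgebra.coeffLinearEquiv k).toLinearMap

@[simp]
theorem onWords_word {M : Type*} [AddCommGroup M] [Module k M]
    (φ : List (BarWord.{w} X) → M) (l : List (BarWord.{w} X)) :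
    onWords φ (word l : Cobar.{u, w} k X) = φ l := by
  simp [onWords, word]

/-- The algebra homomorphism with prescribed values on the generators. -/
noncomputable def lift {B : Type*} [Ring B] [Algebra k B] (f : BarWord.{w} X → B) :
    Cobar.{u, w} k X →ₐ[k] B :=
  AddMonoidAlgebra.lift k B _
    { toFun := fun l => ((FreeAddMonoid.toList l.toAdd).map f).prod
      map_one' := by simp
      map_mul' := fun l l' => by simp }

theorem lift_word {B : Type*} [Ring B] [Algebra k B] (f : BarWord.{w} X → B)
    (l : List (BarWord.{w} X)) : lift f (word l : Cobar.{u, w} k X) = (l.map f).prod := by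
  simp [lift, word, AddMonoidAlgebra.lift_single]

theorem lift_word_cons {B : Type*} [Ring B] [Algebra k B] (f : BarWord.{w} X → B)
    (g : BarWord.{w} X) (l : List (BarWord.{w} X)) :
    lift f (word (g :: l) : Cobar.{u, w} k X) = f g * lift f (word l : Cobar.{u, w} k X) := by
  simp [lift_word]

/-- Left multiplication by the generator `[x]`. -/
noncomputable def opP (x : X) : Cobar.{u, w} k X →ₗ[k] Cobar.{u, w} k X :=
  onWords fun l => word (⟨x, []⟩ :: l)

/-- Prepending the letter `x` to the first generator: `[y₁|…|yₚ]⋯ ↦ [x|y₁|…|yₚ]⋯`. -/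
noncomputable def opL (x : X) : Cobar.{u, w} k X →ₗ[k] Cobar.{u, w} k X :=
  onWords fun l => match l with
    | [] => 0
    | g :: l => word (⟨x, g.head :: g.tail⟩ :: l)

@[simp] theorem opP_word (x : X) (l : List (BarWord.{w} X)) :
    opP x (word l : Cobar.{u, w} k X) = word (⟨x, []⟩ :: l) := by simp [opP]

@[simp] theorem opL_nil (x : X) : opL x (word [] : Cobar.{u, w} k X) = 0 := by simp [opL]

@[simp] theorem opL_cons (x : X) (g : BarWord.{w} X) (l : List (BarWord.{w} X)) :
    opL x (word (g :: l) : Cobar.{u, w} k X) = word (⟨x, g.head :: g.tail⟩ :: l) := by simp [opL]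

/-- Induction on words by prepending letters. -/
theorem word_induction {p : List (BarWord.{w} X) → Prop} (nil : p [])
    (single : ∀ x l, p l → p (⟨x, []⟩ :: l))
    (cons : ∀ x g l, p (g :: l) → p (⟨x, g.head :: g.tail⟩ :: l)) (l : List (BarWord.{w} X)) :
    p l := by
  induction l with
  | nil => exact nil
  | cons g l ih =>
    obtain ⟨x, t⟩ := g
    induction t generalizing x with
    | nil => exact single x l ih
    | cons y t iht => exact cons x ⟨y, t⟩ l (iht y)

theorem word_single (x : X) (l : List (BarWord.{w} X)) :
    (word (⟨x, []⟩ :: l) : Cobar.{u, w} k X) = opP x (word l) := by simp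

theorem word_long (x : X) (g : BarWord.{w} X) (l : List (BarWord.{w} X)) :
    (word (⟨x, g.head :: g.tail⟩ :: l) : Cobar.{u, w} k X) = opL x (word (g :: l)) := by simp

/-- The augmentation of the cobar construction. -/
noncomputable def aug : Cobar.{u, w} k X →ₐ[k] k := lift fun _ => 0

@[simp] theorem aug_nil : aug (word [] : Cobar.{u, w} k X) = 1 := by simp [aug, lift_word]

@[simp] theorem aug_cons (g : BarWord.{w} X) (l) : aug (word (g :: l) : Cobar.{u, w} k X) = 0 := by
  simp [aug, lift_word]

theorem aug_opP (x : X) (W : Cobar.{u, w} k X) : aug (opP x W) = 0 := by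
  induction W using induction_words with
  | word l => simp
  | add U V hU hV => simp only [map_add, hU, hV, add_zero]
  | smul r U hU => simp only [map_smul, hU, smul_zero]

theorem aug_opL (x : X) (W : Cobar.{u, w} k X) : aug (opL x W) = 0 := by
  induction W using induction_words with
  | word l => cases l <;> simp
  | add U V hU hV => simp only [map_add, hU, hV, add_zero]
  | smul r U hU => simp only [map_smul, hU, smul_zero]

theorem opP_eq_mul (x : X) (W : Cobar.{u, w} k X) : opP x W = word [⟨x, []⟩] * W := by
  induction W using induction_words with
  | word l => rw [opP_word, word_cons]
  | add U V hU hV => rw [map_add, hU, hV, mul_add]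
  | smul r U hU => rw [map_smul, hU, mul_smul_comm]

theorem opP_mul (x : X) (U V : Cobar.{u, w} k X) : opP x (U * V) = opP x U * V := by
  rw [opP_eq_mul, opP_eq_mul, mul_assoc]

theorem opL_mul (x : X) (U V : Cobar.{u, w} k X) :
    opL x (U * V) = opL x U * V + aug U • opL x V := by
  induction U using induction_words with
  | word l =>
    cases l with
    | nil => rw [opL_nil, aug_nil, word_nil, one_mul, zero_mul, one_smul, zero_add]
    | cons g l =>
      rw [aug_cons, opL_cons, zero_smul, add_zero]
      induction V using induction_words with
      | word l' => rw [← word_append, ← word_append, List.cons_append, opL_cons, List.cons_append]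
      | add V V' hV hV' => rw [mul_add, map_add, hV, hV', mul_add]
      | smul r V hV => rw [mul_smul_comm, map_smul, hV, mul_smul_comm]
  | add U U' hU hV => simp only [add_mul, map_add, hU, hV]; module
  | smul r U hU => simp only [smul_mul_assoc, map_smul, hU, smul_eq_mul]; module

/-- The total number of letters in a product of words. -/
def letters (l : List (BarWord.{w} X)) : ℕ := (l.map fun g => g.tail.length + 1).sum

/-- The span of the products of words with at most `m` letters in total. -/
noncomputable def fil (k : Type u) [Field k] (X : Type) (m : ℕ) : Submodule k (Cobar.{u, w} k X) :=
  Submodule.span k (word '' {l | letters l ≤ m})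

theorem word_mem_fil {l : List (BarWord.{w} X)} {m : ℕ} (h : letters l ≤ m) :
    word l ∈ fil.{u, w} k X m := Submodule.subset_span ⟨l, h, rfl⟩

theorem fil_map {m m' : ℕ} (φ : Cobar.{u, w} k X →ₗ[k] Cobar.{u, w} k X)
    (h : ∀ l, letters l ≤ m → φ (word l) ∈ fil.{u, w} k X m') {W : Cobar.{u, w} k X}
    (hW : W ∈ fil.{u, w} k X m) : φ W ∈ fil.{u, w} k X m' := by
  have : fil.{u, w} k X m ≤ (fil.{u, w} k X m').comap φ := by
    refine Submodule.span_le.2 ?_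
    rintro _ ⟨l, hl, rfl⟩
    exact h l hl
  exact this hW

theorem exists_mem_fil (W : Cobar.{u, w} k X) : ∃ m, W ∈ fil.{u, w} k X m := by
  induction W using induction_words with
  | word l => exact ⟨_, word_mem_fil le_rfl⟩
  | add U V hU hV =>
    obtain ⟨m, hm⟩ := hU
    obtain ⟨p, hp⟩ := hV
    have mono : ∀ {a b : ℕ}, a ≤ b → fil.{u, w} k X a ≤ fil.{u, w} k X b := fun h =>
      Submodule.span_mono (Set.image_mono fun _ hl => le_trans hl h)
    exact ⟨max m p, Submodule.add_mem _ (mono (le_max_left _ _) hm) (mono (le_max_right _ _) hp)⟩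
  | smul r U hU =>
    obtain ⟨m, hm⟩ := hU
    exact ⟨m, Submodule.smul_mem _ _ hm⟩

end Cobar

namespace MulTable

open Cobar

variable {k : Type u} [Field k] {X : Type} [Fintype X] (T : MulTable k X)

/-- The cohomological degree of a word in the bar construction, as a generator of the cobar
construction; it is `1 + ∑ (deg x - 1)`, the sum being over the letters of the word. -/
def wdeg : List X → ℤ
  | [] => 1
  | x :: l => T.deg x - 1 + wdeg l

/-- The degree of a generator. -/
def gdeg (g : BarWord.{w} X) : ℤ := T.wdeg (g.head :: g.tail)

/-- The degree of a product of generators. -/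
def ldeg (l : List (BarWord.{w} X)) : ℤ := (l.map T.gdeg).sum

theorem ldeg_cons (g : BarWord.{w} X) (l) : T.ldeg (g :: l) = T.gdeg g + T.ldeg l := by
  simp [ldeg]

/-- The grading of the cobar construction. -/
noncomputable abbrev cobarGr (m : ℤ) : Submodule k (Cobar.{u, w} k X) :=
  AddMonoidAlgebra.gradeBy k (FreeAddMonoid.lift (T.gdeg : BarWord.{w} X → ℤ)) m

theorem word_mem (l : List (BarWord.{w} X)) :
    (word l : Cobar.{u, w} k X) ∈ T.cobarGr (T.ldeg l) := by
  have h := AddMonoidAlgebra.single_mem_gradeBy (R := k)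
    (FreeAddMonoid.lift (T.gdeg : BarWord.{w} X → ℤ)) (FreeAddMonoid.ofList l) 1
  rwa [FreeAddMonoid.lift_apply] at h

theorem word_mem' {l : List (BarWord.{w} X)} {m : ℤ} (h : T.ldeg l = m) :
    (word l : Cobar.{u, w} k X) ∈ T.cobarGr m := h ▸ T.word_mem l

/-- A linear map whose values on words are homogeneous of the right degree is homogeneous. -/
theorem map_mem_of_words {M : Type*} [AddCommGroup M] [Module k M] (S : ℤ → Submodule k M)
    (φ : Cobar.{u, w} k X →ₗ[k] M) (h : ∀ l, φ (word l) ∈ S (T.ldeg l)) {m : ℤ}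
    {x : Cobar.{u, w} k X} (hx : x ∈ T.cobarGr m) : φ x ∈ S m := by
  have e : x = ∑ l ∈ x.coeff.support, x.coeff l • word (FreeAddMonoid.toList l) := by
    have h0 := AddMonoidAlgebra.sum_coeff_single x
    conv_lhs => rw [← h0]
    refine Finset.sum_congr rfl fun l _ => ?_
    simp [word]
  rw [e, map_sum]
  refine Submodule.sum_mem _ fun l hl => ?_
  rw [map_smul]
  refine Submodule.smul_mem _ _ ?_
  have h1 : FreeAddMonoid.lift (T.gdeg : BarWord.{w} X → ℤ) l = m := hx l hl
  rw [FreeAddMonoid.lift_apply] at h1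
  rw [← h1]
  exact h _

/-- The sign `(-1) ^ deg x`. -/
noncomputable def eps (x : X) : k := sgn k (T.deg x)

theorem eps_mul_self (x : X) : T.eps x * T.eps x = 1 := sgn_mul_self _

theorem c_mul_eps (x y z : X) : T.c x y z * T.eps z = T.c x y z * (T.eps x * T.eps y) := by
  by_cases h : T.c x y z = 0
  · simp [h]
  · rw [eps, T.deg_eq x y z h, sgn_add]; rfl

/-- Multiplying `x` into the first letter: `[y₁|…|yₚ]⋯ ↦ [x y₁|…|yₚ]⋯`. The value `[x]` on the
empty product makes the formulas for the differential uniform. -/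
noncomputable def opM (x : X) : Cobar.{u, w} k X →ₗ[k] Cobar.{u, w} k X :=
  onWords fun l => match l with
    | [] => word [⟨x, []⟩]
    | g :: l => ∑ z, T.c x g.head z • word (⟨z, g.tail⟩ :: l)

@[simp] theorem opM_nil (x : X) :
    T.opM x (word [] : Cobar.{u, w} k X) = word [⟨x, []⟩] := by simp [opM]

@[simp] theorem opM_cons (x : X) (g : BarWord.{w} X) (l : List (BarWord.{w} X)) :
    T.opM x (word (g :: l) : Cobar.{u, w} k X) =
      ∑ z, T.c x g.head z • word (⟨z, g.tail⟩ :: l) := by simp [opM]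

theorem opM_opP (x y : X) (W : Cobar.{u, w} k X) :
    T.opM x (opP y W) = ∑ z, T.c x y z • opP z W := by
  induction W using induction_words with
  | word l => simp
  | add U V hU hV => simp [hU, hV, Finset.sum_add_distrib]
  | smul r U hU => simp [hU, Finset.smul_sum, smul_comm r]

theorem opM_opL (x y : X) (W : Cobar.{u, w} k X) :
    T.opM x (opL y W) = ∑ z, T.c x y z • opL z W := by
  induction W using induction_words with
  | word l => cases l <;> simp
  | add U V hU hV => simp [hU, hV, Finset.sum_add_distrib]
  | smul r U hU => simp [hU, Finset.smul_sum, smul_comm r]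

theorem opM_opM (x y : X) (W : Cobar.{u, w} k X) :
    T.opM x (T.opM y W) = ∑ z, T.c x y z • T.opM z W := by
  induction W using induction_words with
  | word l =>
    cases l with
    | nil => simp
    | cons g l =>
      simp only [opM_cons, map_sum, map_smul, Finset.smul_sum, smul_smul]
      rw [Finset.sum_comm, Finset.sum_comm (s := Finset.univ) (t := Finset.univ)
        (f := fun z s => (T.c x y z * T.c z g.head s) • word (⟨s, g.tail⟩ :: l))]
      refine Finset.sum_congr rfl fun s _ => ?_
      rw [← Finset.sum_smul, ← Finset.sum_smul, T.assoc]
  | add U V hU hV => simp [hU, hV, Finset.sum_add_distrib]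
  | smul r U hU => simp [hU, Finset.smul_sum, smul_comm r]

/-- The differential on words. On generators it is
`d [x₁|…|x_q] = ∑ ± ([x₁|…|xᵢ] * [xᵢ₊₁|…|x_q] - [x₁|…|xᵢ xᵢ₊₁|…|x_q])`. -/
noncomputable def dWord : List (BarWord.{w} X) → Cobar.{u, w} k X
  | [] => 0
  | ⟨x, []⟩ :: l => T.eps x • opP x (dWord l)
  | ⟨x, y :: t⟩ :: l => T.eps x • (opP x (word (⟨y, t⟩ :: l)) - T.opM x (word (⟨y, t⟩ :: l)) -
      opL x (dWord (⟨y, t⟩ :: l)))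
termination_by l => (l.map fun g => g.tail.length + 1).sum
decreasing_by all_goals simp

/-- The differential of the cobar construction. -/
noncomputable def cobarD : Cobar.{u, w} k X →ₗ[k] Cobar.{u, w} k X := onWords T.dWord

theorem d_nil : T.cobarD (word [] : Cobar.{u, w} k X) = 0 := by simp [cobarD, dWord]

theorem d_opP (x : X) (W : Cobar.{u, w} k X) :
    T.cobarD (opP x W) = T.eps x • opP x (T.cobarD W) := by
  induction W using induction_words with
  | word l => simp [cobarD, dWord]
  | add U V hU hV => simp [hU, hV]
  | smul r U hU => simp [hU, smul_comm r]

theorem d_opL (x : X) (W : Cobar.{u, w} k X) :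
    T.cobarD (opL x W) = T.eps x • (opP x W - T.opM x W - opL x (T.cobarD W)) := by
  induction W using induction_words with
  | word l =>
    cases l with
    | nil => simp [d_nil]
    | cons g l =>
      obtain ⟨y, t⟩ := g
      simp [cobarD, dWord]
  | add U V hU hV => simp only [map_add, hU, hV]; module
  | smul r U hU => simp only [map_smul, hU]; module

theorem d_opM (x : X) (W : Cobar.{u, w} k X) :
    T.cobarD (T.opM x W) = T.eps x • T.opM x (T.cobarD W) := by
  induction W using induction_words with
  | word l =>
    induction l using word_induction generalizing x with
    | nil =>
      rw [opM_nil, word_single, d_opP, d_nil]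
      simp
    | single y l ih =>
      rw [word_single, opM_opP, d_opP, map_smul, opM_opP]
      simp only [map_sum, map_smul, d_opP, Finset.smul_sum, smul_smul, c_mul_eps]
      refine Finset.sum_congr rfl fun z _ => ?_
      congr 1
      ring
    | cons y g l ih =>
      rw [word_long, opM_opL, d_opL]
      simp only [map_sum, map_smul, map_sub, d_opL, opM_opP, opM_opL, opM_opM, Finset.smul_sum,
        ← Finset.sum_sub_distrib, smul_smul, c_mul_eps]
      refine Finset.sum_congr rfl fun z _ => ?_
      module
  | add U V hU hV => simp only [map_add, hU, hV]; module
  | smul r U hU => simp only [map_smul, hU]; module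

theorem d_comp_d (W : Cobar.{u, w} k X) : T.cobarD (T.cobarD W) = 0 := by
  induction W using induction_words with
  | word l =>
    induction l using word_induction with
    | nil => simp [d_nil]
    | single y l ih => rw [word_single, d_opP, map_smul, d_opP, ih]; simp
    | cons y g l ih =>
      rw [word_long, d_opL]
      simp only [map_smul, map_sub, d_opP, d_opM, d_opL, ih, map_zero]
      module
  | add U V hU hV => simp [hU, hV]
  | smul r U hU => simp [hU]

/-! #### The Leibniz rule -/

theorem aug_opM (x : X) (W : Cobar.{u, w} k X) : aug (T.opM x W) = 0 := by
  induction W using induction_words with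
  | word l => cases l <;> simp
  | add U V hU hV => simp only [map_add, hU, hV, add_zero]
  | smul r U hU => simp only [map_smul, hU, smul_zero]

theorem aug_d (W : Cobar.{u, w} k X) : aug (T.cobarD W) = 0 := by
  induction W using induction_words with
  | word l =>
    induction l using word_induction with
    | nil => simp [d_nil]
    | single y l ih => rw [word_single, d_opP, map_smul, aug_opP, smul_zero]
    | cons y g l ih =>
      rw [word_long, d_opL]
      simp only [map_smul, map_sub, aug_opP, aug_opL, aug_opM, sub_zero, smul_zero]
  | add U V hU hV => simp only [map_add, hU, hV, add_zero]
  | smul r U hU => simp only [map_smul, hU, smul_zero]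

theorem opM_mul (x : X) (U V : Cobar.{u, w} k X) :
    T.opM x (U * V) = T.opM x U * V + aug U • (T.opM x V - opP x V) := by
  induction U using induction_words with
  | word l =>
    cases l with
    | nil =>
      rw [opM_nil, aug_nil, word_nil, one_mul, one_smul, opP_eq_mul, add_sub_cancel]
    | cons g l =>
      rw [aug_cons, opM_cons, zero_smul, add_zero]
      induction V using induction_words with
      | word l' =>
        simp only [← word_append, List.cons_append, opM_cons, Finset.sum_mul, smul_mul_assoc]
      | add V V' hV hV' => rw [mul_add, map_add, hV, hV', mul_add]
      | smul r V hV => rw [mul_smul_comm, map_smul, hV, mul_smul_comm]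
  | add U U' hU hV => simp only [add_mul, map_add, hU, hV]; module
  | smul r U hU => simp only [smul_mul_assoc, map_smul, hU, smul_eq_mul]; module

theorem ldeg_single (x : X) (l : List (BarWord.{w} X)) :
    T.ldeg (⟨x, []⟩ :: l) = T.deg x + T.ldeg l := by
  simp [ldeg_cons, gdeg, wdeg]

theorem ldeg_long (x : X) (g : BarWord.{w} X) (l : List (BarWord.{w} X)) :
    T.ldeg (⟨x, g.head :: g.tail⟩ :: l) = T.deg x - 1 + T.ldeg (g :: l) := by
  simp [ldeg_cons, gdeg, wdeg]; ring

theorem d_word_mul (l : List (BarWord.{w} X)) (V : Cobar.{u, w} k X) :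
    T.cobarD (word l * V) =
      T.cobarD (word l) * V + sgn k (T.ldeg l) • (word l * T.cobarD V) := by
  induction l using word_induction with
  | nil =>
    rw [d_nil, word_nil, one_mul, one_mul, zero_mul, zero_add]
    simp [ldeg, sgn_zero]
  | single x l ih =>
    rw [word_single, ← opP_mul, d_opP, ih, d_opP, ldeg_single, sgn_add]
    simp only [map_add, map_smul, opP_mul, smul_mul_assoc, eps]
    module
  | cons x g l ih =>
    have h1 : opL x (word (g :: l) * V) = opL x (word (g :: l)) * V := by
      rw [opL_mul, aug_cons, zero_smul, add_zero]
    have h2 : opL x (T.cobarD (word (g :: l)) * V) = opL x (T.cobarD (word (g :: l))) * V := by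
      rw [opL_mul, aug_d, zero_smul, add_zero]
    have h3 : T.opM x (word (g :: l) * V) = T.opM x (word (g :: l)) * V := by
      rw [opM_mul, aug_cons, zero_smul, add_zero]
    have h4 : opL x (word (g :: l) * T.cobarD V) = opL x (word (g :: l)) * T.cobarD V := by
      rw [opL_mul, aug_cons, zero_smul, add_zero]
    rw [word_long, ← h1, d_opL, ih, d_opL, ldeg_long, sgn_add, sgn_sub, sgn_one]
    simp only [map_add, map_smul, opP_mul, smul_mul_assoc, h2, h3, h4, sub_mul, eps]
    module

/-- The Leibniz rule. -/
theorem d_mul {m : ℤ} {U : Cobar.{u, w} k X} (hU : U ∈ T.cobarGr m) (V : Cobar.{u, w} k X) :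
    T.cobarD (U * V) = T.cobarD U * V + sgn k m • (U * T.cobarD V) := by
  -- With this family of submodules, the degree `m` part is required to go to `0` and nothing is
  -- required of the other degrees.
  have h := T.map_mem_of_words (fun m' => if m' = m then ⊥ else ⊤)
    (T.cobarD ∘ₗ LinearMap.mulRight k V - LinearMap.mulRight k V ∘ₗ T.cobarD -
      sgn k m • LinearMap.mulRight k (T.cobarD V)) (fun l => by
      by_cases hl : T.ldeg l = m
      · rw [if_pos hl, Submodule.mem_bot]
        simp [d_word_mul, hl]
      · rw [if_neg hl]
        exact Submodule.mem_top) hU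
  rw [if_pos rfl, Submodule.mem_bot] at h
  simp only [LinearMap.sub_apply, LinearMap.comp_apply, LinearMap.mulRight_apply,
    LinearMap.smul_apply] at h
  rw [sub_sub, sub_eq_zero] at h
  exact h

theorem opP_mem (x : X) {m m' : ℤ} {W : Cobar.{u, w} k X} (hW : W ∈ T.cobarGr m)
    (h : m' = T.deg x + m) : opP x W ∈ T.cobarGr m' := by
  subst h
  refine T.map_mem_of_words (fun m => T.cobarGr (T.deg x + m)) (opP x) (fun l => ?_) hW
  rw [opP_word]
  exact T.word_mem' (T.ldeg_single x l)

theorem opL_mem (x : X) {m m' : ℤ} {W : Cobar.{u, w} k X} (hW : W ∈ T.cobarGr m)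
    (h : m' = T.deg x - 1 + m) : opL x W ∈ T.cobarGr m' := by
  subst h
  refine T.map_mem_of_words (fun m => T.cobarGr (T.deg x - 1 + m)) (opL x) (fun l => ?_) hW
  cases l with
  | nil => rw [opL_nil]; exact Submodule.zero_mem _
  | cons g l =>
    rw [opL_cons]
    exact T.word_mem' (T.ldeg_long x g l)

theorem opM_mem (x : X) {m m' : ℤ} {W : Cobar.{u, w} k X} (hW : W ∈ T.cobarGr m)
    (h : m' = T.deg x + m) : T.opM x W ∈ T.cobarGr m' := by
  subst h
  refine T.map_mem_of_words (fun m => T.cobarGr (T.deg x + m)) (T.opM x) (fun l => ?_) hW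
  cases l with
  | nil => rw [opM_nil]; exact T.word_mem' (T.ldeg_single x [])
  | cons g l =>
    rw [opM_cons]
    refine Submodule.sum_mem _ fun z _ => ?_
    by_cases hz : T.c x g.head z = 0
    · rw [hz, zero_smul]; exact Submodule.zero_mem _
    · refine Submodule.smul_mem _ _ (T.word_mem' ?_)
      simp only [ldeg_cons, gdeg, wdeg, T.deg_eq _ _ _ hz]
      ring

theorem d_mem {m m' : ℤ} {W : Cobar.{u, w} k X} (hW : W ∈ T.cobarGr m) (h : m' = m + 1) :
    T.cobarD W ∈ T.cobarGr m' := by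
  subst h
  refine T.map_mem_of_words (fun m => T.cobarGr (m + 1)) T.cobarD (fun l => ?_) hW
  induction l using word_induction with
  | nil => rw [d_nil]; exact Submodule.zero_mem _
  | single x l ih =>
    rw [word_single, d_opP]
    exact Submodule.smul_mem _ _ (T.opP_mem x ih (by rw [ldeg_single]; ring))
  | cons x g l ih =>
    rw [word_long, d_opL]
    refine Submodule.smul_mem _ _ (Submodule.sub_mem _ (Submodule.sub_mem _ ?_ ?_) ?_)
    · exact T.opP_mem x (T.word_mem _) (by rw [ldeg_long]; ring)
    · exact T.opM_mem x (T.word_mem _) (by rw [ldeg_long]; ring)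
    · exact T.opL_mem x ih (by rw [ldeg_long]; ring)

/-- The cobar construction as a dg algebra. -/
noncomputable def cobar : DGAlgebra.{u, max u w} k where
  carrier := Cobar.{u, w} k X
  gr := T.cobarGr
  d := T.cobarD
  d_mem := fun _ _ hx => T.d_mem hx rfl
  d_d := T.d_comp_d
  leibniz := fun m x y hx => by rw [T.d_mul hx, negOnePow_smul_eq (k := k)]

/-! #### The contraction -/

/-- The contracting homotopy, which removes the first separator between generators. -/
noncomputable def homotopy : Cobar.{u, w} k X →ₗ[k] Cobar.{u, w} k X :=
  onWords fun l => match l with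
    | [] => 0
    | ⟨x, []⟩ :: l => T.eps x • opL x (word l)
    | ⟨_, _ :: _⟩ :: _ => 0

theorem homotopy_opP (x : X) (W : Cobar.{u, w} k X) :
    T.homotopy (opP x W) = T.eps x • opL x W := by
  induction W using induction_words with
  | word l => simp [homotopy]
  | add U V hU hV => simp [hU, hV]
  | smul r U hU => simp [hU, smul_comm r]

theorem homotopy_opL (x : X) (W : Cobar.{u, w} k X) : T.homotopy (opL x W) = 0 := by
  induction W using induction_words with
  | word l => cases l <;> simp [homotopy]
  | add U V hU hV => simp [hU, hV]
  | smul r U hU => simp [hU]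

theorem homotopy_nil : T.homotopy (word [] : Cobar.{u, w} k X) = 0 := by
  simp [homotopy]

/-- The endomorphism `1 - dh - hd`, homotopic to the identity, shortens words. -/
theorem contract_mem {m : ℕ} {W : Cobar.{u, w} k X} (hW : W ∈ fil.{u, w} k X (m + 2)) :
    W - T.cobarD (T.homotopy W) - T.homotopy (T.cobarD W) ∈ fil.{u, w} k X (m + 1) := by
  refine fil_map (m := m + 2)
    (LinearMap.id - T.cobarD ∘ₗ T.homotopy - T.homotopy ∘ₗ T.cobarD) (fun l hl => ?_) hW
  simp only [LinearMap.sub_apply, LinearMap.comp_apply, LinearMap.id_apply]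
  have hM : ∀ (x : X) (l : List (BarWord.{w} X)), letters l ≤ m + 1 →
      T.opM x (word l) ∈ fil.{u, w} k X (m + 1) := by
    intro x l hl
    cases l with
    | nil => rw [opM_nil]; exact word_mem_fil (by simp [letters])
    | cons g l =>
      rw [opM_cons]
      exact Submodule.sum_mem _ fun z _ => Submodule.smul_mem _ _ (word_mem_fil hl)
  rcases l with _ | ⟨⟨x, _ | ⟨y, t⟩⟩, l⟩
  · rw [homotopy_nil, d_nil, map_zero, map_zero, sub_zero, sub_zero]
    exact word_mem_fil (by simp [letters])
  · rw [word_single, homotopy_opP, d_opP, map_smul, map_smul, d_opL, homotopy_opP, smul_smul,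
      smul_smul, eps_mul_self, one_smul, one_smul]
    have : opP x (word l) - (opP x (word l) - T.opM x (word l) - opL x (T.cobarD (word l))) -
        opL x (T.cobarD (word l)) = T.opM x (word l) := by abel
    rw [this]
    refine hM x l ?_
    simp only [letters, List.map_cons, List.sum_cons, List.length_nil] at hl ⊢
    omega
  · have e := word_long (k := k) x ⟨y, t⟩ l
    simp only at e
    rw [e, homotopy_opL, map_zero, d_opL, map_smul, map_sub, map_sub, homotopy_opP, homotopy_opL]
    have : opL x (word (⟨y, t⟩ :: l)) - 0 - T.eps x • (T.eps x • opL x (word (⟨y, t⟩ :: l)) -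
        T.homotopy (T.opM x (word (⟨y, t⟩ :: l))) - 0) =
        T.eps x • T.homotopy (T.opM x (word (⟨y, t⟩ :: l))) := by
      rw [sub_zero, sub_zero, smul_sub, smul_smul, eps_mul_self, one_smul]; abel
    rw [this]
    refine Submodule.smul_mem _ _ (fil_map (m := m + 1) T.homotopy (fun l' hl' => ?_)
      (hM x (⟨y, t⟩ :: l) ?_))
    · rcases l' with _ | ⟨⟨x', _ | ⟨y', t'⟩⟩, l'⟩
      · rw [homotopy_nil]; exact Submodule.zero_mem _
      · rw [word_single, homotopy_opP]
        refine Submodule.smul_mem _ _ ?_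
        cases l' with
        | nil => rw [opL_nil]; exact Submodule.zero_mem _
        | cons g l' =>
          rw [opL_cons]
          refine word_mem_fil ?_
          simp only [letters, List.map_cons, List.sum_cons, List.length_cons,
            List.length_nil] at hl' ⊢
          omega
      · have e := word_long (k := k) x' ⟨y', t'⟩ l'
        simp only at e
        rw [e, homotopy_opL]
        exact Submodule.zero_mem _
    · simp only [letters, List.map_cons, List.sum_cons, List.length_cons] at hl ⊢
      omega

/-- Every cocycle of the cobar construction is cohomologous to a combination of `1` and words of
length one. -/
theorem cocycle_normal_form {W : Cobar.{u, w} k X} (hW : T.cobarD W = 0) :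
    ∃ (r : k) (μ : X → k) (Z : Cobar.{u, w} k X),
      W = r • 1 + ∑ x, μ x • word [⟨x, []⟩] + T.cobarD Z := by
  obtain ⟨m, hm⟩ := exists_mem_fil W
  induction m generalizing W with
  | zero =>
    have h1 : fil.{u, w} k X 0 ≤ Submodule.span k {1} := by
      refine Submodule.span_mono ?_
      rintro _ ⟨l, hl, rfl⟩
      cases l with
      | nil => rfl
      | cons g l => simp [letters] at hl
    obtain ⟨r, rfl⟩ := Submodule.mem_span_singleton.1 (h1 hm)
    exact ⟨r, 0, 0, by simp⟩
  | succ m ih =>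
    cases m with
    | zero =>
      have h1 : fil.{u, w} k X 1 ≤ Submodule.span k (Set.range fun x : Option X =>
          (x.elim 1 fun x => word [⟨x, []⟩] : Cobar.{u, w} k X)) := by
        refine Submodule.span_mono ?_
        rintro _ ⟨l, hl, rfl⟩
        rcases l with _ | ⟨⟨x, _ | ⟨y, t⟩⟩, _ | ⟨g, l⟩⟩
        · exact ⟨none, rfl⟩
        · exact ⟨some x, rfl⟩
        all_goals simp [letters] at hl
        all_goals omega
      obtain ⟨μ, rfl⟩ := (Submodule.mem_span_range_iff_exists_fun k).1 (h1 hm)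
      refine ⟨μ none, fun x => μ (some x), 0, ?_⟩
      rw [Fintype.sum_option, map_zero, add_zero]
      rfl
    | succ m =>
      have h2 := T.contract_mem hm
      rw [hW, map_zero, sub_zero] at h2
      obtain ⟨r, μ, Z, hZ⟩ := ih (by rw [map_sub, d_comp_d, hW, sub_zero]) h2
      refine ⟨r, μ, Z + T.homotopy W, ?_⟩
      rw [map_add, ← add_assoc, ← hZ, sub_add_cancel]

end MulTable

/-! ### Cohomology classes -/

namespace DGAlgebra

variable {k : Type u} [Field k] (C : DGAlgebra.{u, b} k)

theorem comp_d (x : C.carrier) (m : ℤ) : C.comp (C.d x) (m + 1) = C.d (C.comp x m) := by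
  classical
  induction x using DirectSum.Decomposition.inductionOn C.gr with
  | zero => simp [comp]
  | @homogeneous i z =>
    by_cases h : i = m
    · subst h
      rw [comp, comp, decompose_of_mem_same _ (C.d_mem i _ z.2), decompose_of_mem_same _ z.2]
    · rw [comp, comp, decompose_of_mem_ne _ (C.d_mem i _ z.2) (by omega),
        decompose_of_mem_ne _ z.2 h, map_zero]
  | add y z hy hz =>
    simp only [comp, map_add, decompose_add, DirectSum.add_apply, Submodule.coe_add] at *
    rw [hy, hz]

/-- A homogeneous coboundary bounds a homogeneous element. -/
theorem exists_homogeneous_primitive {x y : C.carrier} {m : ℤ} (hx : x ∈ C.gr (m + 1))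
    (h : C.d y = x) : ∃ z ∈ C.gr m, C.d z = x :=
  ⟨C.comp y m, C.comp_mem y m, by rw [← comp_d, h, comp, decompose_of_mem_same _ hx]⟩

variable {C} {A : Type a} [Ring A] [Algebra k A] (e : C.Cohomology ≃ₐ[k] A)

/-- The pairs `(x, a)` of a cocycle `x` and its cohomology class `a`, the cohomology being
identified with `A`. -/
def classGraph : Subalgebra k (C.carrier × A) :=
  (AlgHom.prod C.cocycles.val
    (e.toAlgHom.comp (Ideal.Quotient.mkₐ k C.coboundaries))).range

theorem mem_classGraph {x : C.carrier} {α : A} :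
    (x, α) ∈ classGraph e ↔
      ∃ h : C.d x = 0, e (Ideal.Quotient.mk C.coboundaries ⟨x, h⟩) = α := by
  constructor
  · rintro ⟨z, hz⟩
    have h1 : (z : C.carrier) = x := congrArg Prod.fst hz
    subst h1
    exact ⟨z.2, congrArg Prod.snd hz⟩
  · rintro ⟨h, rfl⟩
    exact ⟨⟨x, h⟩, rfl⟩

theorem classGraph_closed {x : C.carrier} {α : A} (h : (x, α) ∈ classGraph e) : C.d x = 0 :=
  ((mem_classGraph e).1 h).1

theorem classGraph_unique {x : C.carrier} {α α' : A} (h : (x, α) ∈ classGraph e)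
    (h' : (x, α') ∈ classGraph e) : α = α' := by
  obtain ⟨_, rfl⟩ := (mem_classGraph e).1 h
  obtain ⟨_, rfl⟩ := (mem_classGraph e).1 h'
  rfl

theorem d_mem_classGraph (y : C.carrier) : (C.d y, (0 : A)) ∈ classGraph e := by
  refine (mem_classGraph e).2 ⟨C.d_d y, ?_⟩
  rw [map_eq_zero_iff e e.injective, Ideal.Quotient.eq_zero_iff_mem]
  exact ⟨y, rfl⟩

theorem exists_of_classGraph_zero {x : C.carrier} (h : (x, (0 : A)) ∈ classGraph e) :
    ∃ y, C.d y = x := by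
  obtain ⟨h1, h2⟩ := (mem_classGraph e).1 h
  rw [map_eq_zero_iff e e.injective, Ideal.Quotient.eq_zero_iff_mem] at h2
  exact h2

theorem exists_class {x : C.carrier} (h : C.d x = 0) : ∃ α, (x, α) ∈ classGraph e :=
  ⟨_, (mem_classGraph e).2 ⟨h, rfl⟩⟩

variable {𝒜 : ℤ → Submodule k A} (he : ∀ m : ℤ, (C.cohomologyGr m).map e.toLinearMap = 𝒜 m)
include he

theorem class_mem {x : C.carrier} {α : A} {m : ℤ} (h : (x, α) ∈ classGraph e)
    (hx : x ∈ C.gr m) : α ∈ 𝒜 m := by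
  obtain ⟨h1, rfl⟩ := (mem_classGraph e).1 h
  rw [← he]
  exact ⟨_, ⟨⟨x, h1⟩, hx, rfl⟩, rfl⟩

theorem exists_representative {α : A} {m : ℤ} (hα : α ∈ 𝒜 m) :
    ∃ x ∈ C.gr m, (x, α) ∈ classGraph e := by
  rw [← he] at hα
  obtain ⟨_, ⟨z, hz, rfl⟩, rfl⟩ := hα
  exact ⟨z, hz, (mem_classGraph e).2 ⟨z.2, rfl⟩⟩

end DGAlgebra

/-! ### Morphisms out of the cobar construction -/

namespace MulTable

open Cobar DGAlgebra

section Words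

variable {k : Type u} [Field k] {X : Type} {B : Type*} [Ring B] [Algebra k B]

/-- The unsigned convolution product. -/
def cup₀ (f : List X → B) : List X → (List X → B) → B
  | x :: y :: l, g => g [x] * f (y :: l) + cup₀ f (y :: l) fun t => g (x :: t)
  | _, _ => 0

theorem cup₀_mem (S : Submodule k B) {f : List X → B} {l : List X} {g : List X → B}
    (h : ∀ u v, u ≠ [] → v ≠ [] → u ++ v = l → g u * f v ∈ S) : cup₀ f l g ∈ S := by
  induction l generalizing g with
  | nil => simp [cup₀]
  | cons x l ih =>
    cases l with
    | nil => simp [cup₀]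
    | cons y l =>
      rw [cup₀]
      refine S.add_mem (h [x] (y :: l) (by simp) (by simp) rfl) (ih ?_)
      intro u v _ hv huv
      exact h (x :: u) v (by simp) hv (by simp [huv])

theorem cup₀_add_left (f f' : List X → B) (l : List X) (g : List X → B) :
    cup₀ (f + f') l g = cup₀ f l g + cup₀ f' l g := by
  induction l generalizing g with
  | nil => simp [cup₀]
  | cons x l ih =>
    cases l with
    | nil => simp [cup₀]
    | cons y l =>
      simp only [cup₀, Pi.add_apply, mul_add, ih]
      abel

theorem cup₀_map {B' : Type*} [Ring B'] [Algebra k B'] (φ : B →ₐ[k] B') (f : List X → B)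
    (l : List X) (g : List X → B) :
    φ (cup₀ f l g) = cup₀ (fun t => φ (f t)) l fun t => φ (g t) := by
  induction l generalizing g with
  | nil => simp [cup₀]
  | cons x l ih =>
    cases l with
    | nil => simp [cup₀]
    | cons y l => simp [cup₀, ih]

/-- The algebra homomorphism out of the cobar construction which is `f` on the generators. -/
noncomputable def ofCochain (f : List X → B) : Cobar.{u, w} k X →ₐ[k] B :=
  lift fun g => f (g.head :: g.tail)

theorem ofCochain_cons (f : List X → B) (g : BarWord.{w} X) (l : List (BarWord.{w} X)) :
    ofCochain f (word (g :: l) : Cobar.{u, w} k X) =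
      f (g.head :: g.tail) * ofCochain f (word l : Cobar.{u, w} k X) :=
  lift_word_cons _ g l

/-- An algebra homomorphism with the values on the first generators changed from `f` to `g`. -/
noncomputable def headChange (g f : List X → B) : Cobar.{u, w} k X →ₗ[k] B :=
  onWords fun l => match l with
    | [] => 0
    | h :: l => g (h.head :: h.tail) * ofCochain f (word l : Cobar.{u, w} k X)

theorem headChange_opP (g f : List X → B) (x : X) (W : Cobar.{u, w} k X) :
    headChange g f (opP x W) = g [x] * ofCochain f W := by
  induction W using induction_words with
  | word l => simp [headChange]
  | add U V hU hV => simp [hU, hV, mul_add]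
  | smul r U hU => simp [hU]

theorem headChange_opL (g f : List X → B) (x : X) (W : Cobar.{u, w} k X) :
    headChange g f (opL x W) = headChange (fun t => g (x :: t)) f W := by
  induction W using induction_words with
  | word l => cases l <;> simp [headChange]
  | add U V hU hV => simp [hU, hV]
  | smul r U hU => simp [hU]

end Words

variable {k : Type u} [Field k] {X : Type} [Fintype X] (T : MulTable k X)

section Quasi

variable {A : Type a} [Ring A] [Algebra k A] (β : X → A)

/-- A morphism from the cobar construction which sends the words of length one to cocycles
representing a basis of the augmentation ideal of the cohomology is a quasi-isomorphism. -/
theorem isQuasiIso_of_classes {C : DGAlgebra.{u, b} k} (e : C.Cohomology ≃ₐ[k] A)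
    (hspan : ∀ α : A, ∃ (r : k) (μ : X → k), α = r • 1 + ∑ x, μ x • β x)
    (hind : ∀ (r : k) (μ : X → k), r • (1 : A) + ∑ x, μ x • β x = 0 → r = 0 ∧ μ = 0)
    (Φ : DGAlgebra.Hom (cobar.{u, w} T) C)
    (hΦ : ∀ x, (Φ.toAlgHom (word [⟨x, []⟩]), β x) ∈ classGraph e) : Φ.IsQuasiIso := by
  have hcomb : ∀ (r : k) (μ : X → k) (Z : Cobar.{u, w} k X),
      (Φ.toAlgHom (r • 1 + ∑ x, μ x • word [⟨x, []⟩] + T.cobarD Z : Cobar.{u, w} k X),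
        r • (1 : A) + ∑ x, μ x • β x) ∈ classGraph e := by
    intro r μ Z
    have h1 : ((1 : C.carrier), (1 : A)) ∈ classGraph e := one_mem (classGraph e)
    have h2 := add_mem (Subalgebra.smul_mem _ h1 r)
      (sum_mem (fun x (_ : x ∈ Finset.univ) => Subalgebra.smul_mem _ (hΦ x) (μ x)))
    have h3 := add_mem h2 (d_mem_classGraph e (Φ.toAlgHom Z))
    have h4 : Φ.toAlgHom (T.cobarD Z) = C.d (Φ.toAlgHom Z) := Φ.map_d Z
    convert h3 using 1
    ext
    · let φ : Cobar.{u, w} k X →ₐ[k] C.carrier := Φ.toAlgHom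
      have h5 : φ (r • 1 + ∑ x, μ x • word [⟨x, []⟩] + T.cobarD Z) =
          r • 1 + ∑ x, μ x • φ (word [⟨x, []⟩]) + C.d (φ Z) := by
        rw [map_add, map_add, map_smul, map_one, map_sum]
        simp only [map_smul]
        exact congrArg _ h4
      simp only [Prod.fst_add, Prod.smul_fst, Prod.fst_sum]
      exact h5
    · simp [Prod.snd_sum]
  constructor
  · rw [injective_iff_map_eq_zero]
    intro z hz
    obtain ⟨⟨W, hW⟩, rfl⟩ := Ideal.Quotient.mk_surjective z
    obtain ⟨r, μ, Z, rfl⟩ := T.cocycle_normal_form hW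
    have h1 : (⟨_, (Φ.cocyclesMap ⟨_, hW⟩).2⟩ : C.cocycles) ∈ C.coboundaries :=
      Ideal.Quotient.eq_zero_iff_mem.1 hz
    obtain ⟨y, hy⟩ := h1
    have h2 := d_mem_classGraph e y
    rw [hy] at h2
    obtain ⟨rfl, rfl⟩ := hind r μ (classGraph_unique e (hcomb r μ Z) h2)
    refine Ideal.Quotient.eq_zero_iff_mem.2 ⟨Z, ?_⟩
    simp [cobar]
    rfl
  · intro z
    obtain ⟨r, μ, h⟩ := hspan (e z)
    have hc := hcomb r μ 0
    have hW : T.cobarD (r • 1 + ∑ x, μ x • word [⟨x, []⟩] + T.cobarD 0 : Cobar.{u, w} k X) = 0 := by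
      have hd1 : T.cobarD (1 : Cobar.{u, w} k X) = 0 := T.d_nil
      have hdx : ∀ x : X, T.cobarD (word [⟨x, []⟩] : Cobar.{u, w} k X) = 0 := fun x => by
        rw [word_single, d_opP, d_nil, map_zero, smul_zero]
      simp [hd1, hdx]
    refine ⟨Ideal.Quotient.mk _ ⟨_, hW⟩, ?_⟩
    obtain ⟨h1, h2⟩ := (mem_classGraph e).1 hc
    rw [← h] at h2
    exact e.injective h2

end Quasi

section Twisting

variable {B : Type*} [Ring B] [Algebra k B] {M : Type*} [AddCommGroup M] [Module k M]

/-- The signed convolution product `∑ (-1)^|u| g(u) f(v)` over the decompositions `l = u v` into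
nonempty words. -/
noncomputable def cup (f : List X → B) : List X → (List X → B) → B
  | x :: y :: l, g => T.eps x • (g [x] * f (y :: l) - cup f (y :: l) fun t => g (x :: t))
  | _, _ => 0

/-- The signed sum of the values of `g` on the words obtained from `l` by multiplying two
neighbouring letters. -/
noncomputable def bar : List X → (List X → M) → M
  | x :: y :: l, g => T.eps x • (∑ z, T.c x y z • g (z :: l) - bar (y :: l) fun t => g (x :: t))
  | _, _ => 0

/-- The right-hand side of the equation `d f = curv f` for twisting cochains `f`. -/
noncomputable def curv (f : List X → B) (l : List X) : B := T.cup f l f - T.bar l f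

theorem cup_mem (S : Submodule k B) {f : List X → B} {l : List X} {g : List X → B}
    (h : ∀ u v, u ≠ [] → v ≠ [] → u ++ v = l → g u * f v ∈ S) : T.cup f l g ∈ S := by
  induction l generalizing g with
  | nil => simp [cup]
  | cons x l ih =>
    cases l with
    | nil => simp [cup]
    | cons y l =>
      rw [cup]
      refine S.smul_mem _ (S.sub_mem (h [x] (y :: l) (by simp) (by simp) rfl) (ih ?_))
      intro u v _ hv huv
      exact h (x :: u) v (by simp) hv (by simp [huv])

theorem bar_mem (S : Submodule k M) {l : List X} {g : List X → M}
    (h : ∀ t, t.length + 1 = l.length → g t ∈ S) : T.bar l g ∈ S := by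
  induction l generalizing g with
  | nil => simp [bar]
  | cons x l ih =>
    cases l with
    | nil => simp [bar]
    | cons y l =>
      rw [bar]
      refine S.smul_mem _ (S.sub_mem (S.sum_mem fun z _ => S.smul_mem _ (h _ (by simp))) (ih ?_))
      intro t ht
      exact h _ (by simpa using ht)

theorem cup_add (f : List X → B) (l : List X) (g g' : List X → B) :
    T.cup f l (g + g') = T.cup f l g + T.cup f l g' := by
  induction l generalizing g g' with
  | nil => simp [cup]
  | cons x l ih =>
    cases l with
    | nil => simp [cup]
    | cons y l =>
      have := ih (fun t => g (x :: t)) (fun t => g' (x :: t))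
      simp only [cup, Pi.add_apply, add_mul]
      rw [show (fun t => g (x :: t) + g' (x :: t)) =
        (fun t => g (x :: t)) + fun t => g' (x :: t) from rfl, this]
      module

theorem cup_add_left (f f' : List X → B) (l : List X) (g : List X → B) :
    T.cup (f + f') l g = T.cup f l g + T.cup f' l g := by
  induction l generalizing g with
  | nil => simp [cup]
  | cons x l ih =>
    cases l with
    | nil => simp [cup]
    | cons y l =>
      simp only [cup, Pi.add_apply, mul_add, ih]
      module

theorem bar_add (l : List X) (g g' : List X → M) :
    T.bar l (g + g') = T.bar l g + T.bar l g' := by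
  induction l generalizing g g' with
  | nil => simp [bar]
  | cons x l ih =>
    cases l with
    | nil => simp [bar]
    | cons y l =>
      have := ih (fun t => g (x :: t)) (fun t => g' (x :: t))
      simp only [bar, Pi.add_apply, smul_add, Finset.sum_add_distrib]
      rw [show (fun t => g (x :: t) + g' (x :: t)) =
        (fun t => g (x :: t)) + fun t => g' (x :: t) from rfl, this]
      module

theorem bar_map {M' : Type*} [AddCommGroup M'] [Module k M'] (φ : M →ₗ[k] M') (l : List X)
    (g : List X → M) : φ (T.bar l g) = T.bar l fun t => φ (g t) := by
  induction l generalizing g with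
  | nil => simp [bar]
  | cons x l ih =>
    cases l with
    | nil => simp [bar]
    | cons y l => simp [bar, ih]

theorem cup_map {B' : Type*} [Ring B'] [Algebra k B'] (φ : B →ₐ[k] B') (f : List X → B)
    (l : List X) (g : List X → B) :
    φ (T.cup f l g) = T.cup (fun t => φ (f t)) l fun t => φ (g t) := by
  induction l generalizing g with
  | nil => simp [cup]
  | cons x l ih =>
    cases l with
    | nil => simp [cup]
    | cons y l => simp [cup, ih]

theorem cup_congr {f f' : List X → B} {l : List X} {g g' : List X → B}
    (hf : ∀ t, t.length < l.length → f t = f' t) (hg : ∀ t, t.length < l.length → g t = g' t) :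
    T.cup f l g = T.cup f' l g' := by
  induction l generalizing g g' with
  | nil => simp [cup]
  | cons x l ih =>
    cases l with
    | nil => simp [cup]
    | cons y l =>
      rw [cup, cup, hf _ (by simp), hg _ (by simp), ih (fun t ht => hf t (by simp at *; omega))
        (fun t ht => hg _ (by simp at *; omega))]

theorem bar_congr {l : List X} {g g' : List X → M}
    (h : ∀ t, t.length + 1 = l.length → g t = g' t) : T.bar l g = T.bar l g' := by
  induction l generalizing g g' with
  | nil => simp [bar]
  | cons x l ih =>
    cases l with
    | nil => simp [bar]
    | cons y l =>
      rw [bar, bar, ih (fun t ht => h _ (by simpa using ht))]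
      simp only [h (_ :: l) (by simp)]

theorem curv_congr {f f' : List X → B} {l : List X}
    (h : ∀ t, t.length < l.length → f t = f' t) : T.curv f l = T.curv f' l := by
  rw [curv, curv, T.cup_congr h h, T.bar_congr fun t ht => h t (by omega)]

/-- The differential of a generator, with the values on its first factors changed. Induction on the
length of the word needs `g` to vary independently of `f`. -/
theorem headChange_d (g f : List X → B) (x : X) (t : List X) :
    headChange g f (T.cobarD (word [⟨x, t⟩] : Cobar.{u, w} k X)) =
      T.cup f (x :: t) g - T.bar (x :: t) g := by
  induction t generalizing x g with
  | nil => rw [word_single, d_opP, d_nil]; simp [cup, bar]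
  | cons y t ih =>
    have e := word_long (k := k) x (⟨y, t⟩ : BarWord.{w} X) []
    simp only at e
    rw [e, d_opL, map_smul, map_sub, map_sub, headChange_opP, headChange_opL, ih, cup, bar,
      ofCochain_cons, word_nil, map_one, mul_one, opM_cons]
    simp only [map_sum, map_smul]
    have h : ∀ z : X, headChange g f (word [⟨z, t⟩] : Cobar.{u, w} k X) = g (z :: t) := fun z => by
      simp [headChange, word_nil]
    simp only [h]
    module

/-- An algebra homomorphism out of the cobar construction commutes with the differentials if and
only if it comes from a twisting cochain, since `curv f` is its value on the differentials of the
generators. -/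
theorem ofCochain_d (f : List X → B) (x : X) (t : List X) :
    ofCochain f (T.cobarD (word [⟨x, t⟩] : Cobar.{u, w} k X)) = T.curv f (x :: t) := by
  rw [curv, ← headChange_d.{u, w}]
  have h : ∀ W : Cobar.{u, w} k X, ofCochain f W = headChange f f W + aug W • 1 := by
    intro W
    induction W using induction_words with
    | word l =>
      cases l with
      | nil =>
        have h0 : headChange f f (word [] : Cobar.{u, w} k X) = 0 := by simp [headChange]
        rw [h0, aug_nil, word_nil, map_one, one_smul, zero_add]
      | cons g l => simp [headChange, ofCochain_cons]
    | add U V hU hV => simp only [map_add, hU, hV]; module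
    | smul r U hU => simp only [map_smul, hU]; module
  rw [h, aug_d, zero_smul, add_zero]

theorem d_cup (C : DGAlgebra.{u, b} k) {f : List X → C.carrier}
    (l : List X) (g : List X → C.carrier) (s : ℤ) (hg : ∀ t, g t ∈ C.gr (s + T.wdeg t)) :
    C.d (T.cup f l g) =
      T.cup f l (fun t => C.d (g t)) + sgn k s • cup₀ (fun t => C.d (f t)) l g := by
  induction l generalizing g s with
  | nil => simp [cup, cup₀]
  | cons x l ih =>
    cases l with
    | nil => simp [cup, cup₀]
    | cons y l =>
      have h1 : g [x] ∈ C.gr (s + T.deg x) := by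
        have := hg [x]
        rwa [wdeg, wdeg, sub_add_cancel] at this
      have h2 : ∀ t, g (x :: t) ∈ C.gr (s + (T.deg x - 1) + T.wdeg t) := fun t => by
        have := hg (x :: t)
        rwa [wdeg, ← add_assoc] at this
      have h3 := ih (fun t => g (x :: t)) (s + (T.deg x - 1)) h2
      have h4 := T.eps_mul_self x
      rw [eps] at h4
      simp only [cup, cup₀, map_smul, map_sub, C.leibniz_sgn h1, h3, sgn_add, sgn_sub, sgn_one, eps]
      linear_combination (norm := module) h4 • (sgn k s • (g [x] * C.d (f (y :: l)) +
        cup₀ (fun t => C.d (f t)) (y :: l) fun t => g (x :: t)))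

theorem d_curv (C : DGAlgebra.{u, b} k) {f : List X → C.carrier}
    (hf : ∀ t, f t ∈ C.gr (T.wdeg t)) (l : List X) :
    C.d (T.curv f l) = T.cup f l (fun t => C.d (f t)) + cup₀ (fun t => C.d (f t)) l f -
      T.bar l fun t => C.d (f t) := by
  rw [curv, map_sub, bar_map, T.d_cup C l f 0 (by simpa using hf), sgn_zero, one_smul]

/-- The Bianchi identity. It is the equation `d ∘ d = 0` in the cobar construction. -/
theorem bianchi {f : List X → B} (hf : f [] = 0) (l : List X) :
    T.cup f l (T.curv f) + cup₀ (T.curv f) l f - T.bar l (T.curv f) = 0 := by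
  let ι : List X → (cobar.{u, 0} T).carrier := fun l => match l with
    | [] => (0 : Cobar.{u, 0} k X)
    | x :: t => (word [⟨x, t⟩] : Cobar.{u, 0} k X)
  let φ : (cobar.{u, 0} T).carrier →ₐ[k] B :=
    (ofCochain f : Cobar.{u, 0} k X →ₐ[k] B)
  have hι : ∀ t, ι t ∈ (cobar.{u, 0} T).gr (T.wdeg t) := by
    intro t
    cases t with
    | nil => exact Submodule.zero_mem _
    | cons x t =>
      refine T.word_mem' ?_
      simp [ldeg, gdeg]
  have hφ : ∀ t, φ (ι t) = f t := by
    intro t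
    cases t with
    | nil => exact (map_zero (ofCochain f : Cobar.{u, 0} k X →ₐ[k] B)).trans hf.symm
    | cons x t =>
      have := ofCochain_cons (k := k) f (⟨x, t⟩ : BarWord.{0} X) []
      rw [word_nil, map_one, mul_one] at this
      exact this
  have hcurv : ∀ t, (cobar.{u, 0} T).d (ι t) = T.curv ι t := by
    intro t
    cases t with
    | nil =>
      have h0 : T.curv ι [] = 0 := by simp [curv, cup, bar]
      rw [h0]
      exact map_zero T.cobarD
    | cons x t =>
      rw [← ofCochain_d.{u, 0}]
      have hid : ∀ W : Cobar.{u, 0} k X, ofCochain ι W = W := by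
        intro W
        induction W using induction_words with
        | word l =>
          induction l with
          | nil => exact map_one (ofCochain ι)
          | cons g l ih => rw [ofCochain_cons, ih, word_cons]; rfl
        | add U V hU hV => rw [map_add, hU, hV]; rfl
        | smul r U hU => rw [map_smul, hU]; rfl
      exact (hid _).symm
  have hcurv' : ∀ t, φ (T.curv ι t) = T.curv f t := by
    intro t
    rw [curv, curv, map_sub, cup_map]
    have := T.bar_map φ.toLinearMap t ι
    simp only [AlgHom.toLinearMap_apply] at this
    rw [this]
    simp only [hφ]
  have h := T.d_curv _ hι l
  have h' := congrArg φ h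
  rw [← hcurv, DGAlgebra.d_d, map_zero, map_sub, map_add, cup_map, cup₀_map] at h'
  have hb := T.bar_map φ.toLinearMap l fun t => (cobar.{u, 0} T).d (ι t)
  simp only [AlgHom.toLinearMap_apply] at hb
  rw [hb] at h'
  simp only [hφ, hcurv, hcurv'] at h'
  exact h'.symm

/-- The defect `Δ = curv f - d f` of a cochain `f` satisfies a linear equation up to
coboundaries. -/
theorem defect_equation (C : DGAlgebra.{u, b} k) {f : List X → C.carrier} (hf0 : f [] = 0)
    (hf : ∀ t, f t ∈ C.gr (T.wdeg t)) {Δ : List X → C.carrier}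
    (hΔ : ∀ t, T.curv f t = C.d (f t) + Δ t) (l : List X) :
    T.cup f l Δ + cup₀ Δ l f - T.bar l Δ = - C.d (Δ l) := by
  have h1 : C.d (Δ l) = C.d (T.curv f l) := by rw [hΔ, map_add, C.d_d, zero_add]
  have h2 : T.curv f = (fun t => C.d (f t)) + Δ := funext hΔ
  have h3 := T.bianchi hf0 l
  rw [h2, cup_add, cup₀_add_left, bar_add] at h3
  rw [h1, T.d_curv C hf]
  linear_combination (norm := module) h3

end Twisting

end MulTable

/-! ### Obstruction theory for twisting cochains -/

namespace MulTable

open Cobar DGAlgebra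

section Words

variable {k : Type u} [Field k] {X : Type} {B : Type*} [Ring B] [Algebra k B]
  {A : Type*} [Ring A] [Algebra k A]

theorem cup₀_pair_mem (S : Submodule k (B × A)) {f g : List X → B} {f' g' : List X → A}
    {l : List X} (h : ∀ u v, u ≠ [] → v ≠ [] → u ++ v = l → (g u * f v, g' u * f' v) ∈ S) :
    (cup₀ f l g, cup₀ f' l g') ∈ S := by
  have h1 := cup₀_mem S (f := fun t => (f t, f' t)) (g := fun t => (g t, g' t)) (l := l) h
  convert h1 using 1
  exact Prod.ext (cup₀_map (AlgHom.fst k B A) (fun t => (f t, f' t)) l fun t => (g t, g' t)).symm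
    (cup₀_map (AlgHom.snd k B A) (fun t => (f t, f' t)) l fun t => (g t, g' t)).symm

/-- The cochain which is `β` on words of length one and zero on all others. -/
def letterCochain {B : Type*} [Zero B] (β : X → B) : List X → B
  | [x] => β x
  | _ => 0

theorem letterCochain_of_length {B : Type*} [Zero B] (β : X → B) {l : List X}
    (h : l.length ≠ 1) : letterCochain β l = 0 := by
  rcases l with _ | ⟨x, _ | ⟨y, l⟩⟩ <;> simp_all [letterCochain]

end Words

variable {k : Type u} [Field k] {X : Type} [Fintype X] (T : MulTable k X)

theorem wdeg_append (u v : List X) : T.wdeg (u ++ v) + 1 = T.wdeg u + T.wdeg v := by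
  induction u with
  | nil => simp [wdeg]; ring
  | cons x u ih => rw [List.cons_append, wdeg, wdeg]; linarith

theorem bar_degree {M : Type*} [AddCommGroup M] [Module k M] (S : ℤ → Submodule k M)
    (l : List X) (g : List X → M) (s : ℤ) (hg : ∀ t, g t ∈ S (s + T.wdeg t)) :
    T.bar l g ∈ S (s + T.wdeg l + 1) := by
  induction l generalizing g s with
  | nil => simp [bar]
  | cons x l ih =>
    cases l with
    | nil => simp [bar]
    | cons y l =>
      rw [bar]
      refine Submodule.smul_mem _ _ (Submodule.sub_mem _ (Submodule.sum_mem _ fun z _ => ?_) ?_)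
      · by_cases hz : T.c x y z = 0
        · rw [hz, zero_smul]; exact Submodule.zero_mem _
        · refine Submodule.smul_mem _ _ ?_
          convert hg (z :: l) using 2
          simp only [wdeg, T.deg_eq _ _ _ hz]
          ring
      · convert ih (fun t => g (x :: t)) (s + (T.deg x - 1))
          (fun t => by convert hg (x :: t) using 2; rw [wdeg]; ring) using 2
        simp only [wdeg]
        ring

section Pairs

variable {B : Type*} [Ring B] [Algebra k B] {A : Type*} [Ring A] [Algebra k A]

theorem cup_pair_mem (S : Submodule k (B × A)) {f g : List X → B} {f' g' : List X → A}
    {l : List X} (h : ∀ u v, u ≠ [] → v ≠ [] → u ++ v = l → (g u * f v, g' u * f' v) ∈ S) :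
    (T.cup f l g, T.cup f' l g') ∈ S := by
  have h1 := T.cup_mem S (f := fun t => (f t, f' t)) (g := fun t => (g t, g' t)) (l := l) h
  convert h1 using 1
  exact Prod.ext (T.cup_map (AlgHom.fst k B A) (fun t => (f t, f' t)) l fun t => (g t, g' t)).symm
    (T.cup_map (AlgHom.snd k B A) (fun t => (f t, f' t)) l fun t => (g t, g' t)).symm

theorem bar_pair_mem (S : Submodule k (B × A)) {g : List X → B} {g' : List X → A}
    {l : List X} (h : ∀ t, t.length + 1 = l.length → (g t, g' t) ∈ S) :
    (T.bar l g, T.bar l g') ∈ S := by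
  have h1 := T.bar_mem S (g := fun t => (g t, g' t)) (l := l) h
  convert h1 using 1
  exact Prod.ext (T.bar_map (LinearMap.fst k B A) l fun t => (g t, g' t)).symm
    (T.bar_map (LinearMap.snd k B A) l fun t => (g t, g' t)).symm

end Pairs

section Main

variable {A : Type a} [Ring A] [Algebra k A] (𝒜 : ℤ → Submodule k A) (β : X → A)

/-- Every Hochschild cocycle of arity `q ≥ 3` and internal degree `2 - q` is a coboundary. The
degree `wdeg l + 1` is the sum of the degrees of the letters of `l`, plus `2 - q`. -/
def HochschildVanishing : Prop :=
  ∀ q : ℕ, 3 ≤ q → ∀ o : List X → A, (∀ l, l.length ≠ q → o l = 0) →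
    (∀ l, o l ∈ 𝒜 (T.wdeg l + 1)) →
    (∀ l, T.cup (letterCochain β) l o + cup₀ o l (letterCochain β) - T.bar l o = 0) →
    ∃ ψ : List X → A, (∀ l, l.length + 1 ≠ q → ψ l = 0) ∧ (∀ l, ψ l ∈ 𝒜 (T.wdeg l)) ∧
      ∀ l, l.length = q →
        o l = T.cup (letterCochain β) l ψ + T.cup ψ l (letterCochain β) - T.bar l ψ

variable {β} {C : DGAlgebra.{u, b} k} (e : C.Cohomology ≃ₐ[k] A)

variable (β) in
/-- A cochain lifting `β` which satisfies the equation of a twisting cochain on words of length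
less than `q`. -/
structure PartialTwisting (q : ℕ) (f : List X → C.carrier) : Prop where
  nil : f [] = 0
  mem : ∀ l, f l ∈ C.gr (T.wdeg l)
  letter : ∀ x, (f [x], β x) ∈ classGraph e
  eq : ∀ l, l.length < q → T.curv f l = C.d (f l)

theorem curv_mem {f : List X → C.carrier} (hf : ∀ l, f l ∈ C.gr (T.wdeg l)) (l : List X) :
    T.curv f l ∈ C.gr (T.wdeg l + 1) := by
  refine Submodule.sub_mem _ (T.cup_mem _ fun u v _ _ huv => ?_) ?_
  · rw [← huv, wdeg_append]
    exact SetLike.mul_mem_graded (hf u) (hf v)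
  · have := T.bar_degree C.gr l f 0 (by simpa using hf)
    rwa [zero_add] at this

variable {𝒜} (he : ∀ m : ℤ, (C.cohomologyGr m).map e.toLinearMap = 𝒜 m)
include he

/-- The start of the induction: choose representatives of the basis elements, and for words of
length two choose primitives of the differences between products of representatives and
representatives of products. -/
theorem exists_partialTwisting_three (hβ : ∀ x, β x ∈ 𝒜 (T.deg x))
    (hmul : ∀ x y, β x * β y = ∑ z, T.c x y z • β z) :
    ∃ f, T.PartialTwisting β e 3 f := by
  choose ξ hξ hξc using fun x => exists_representative e he (hβ x)
  have hmem : ∀ l, letterCochain ξ l ∈ C.gr (T.wdeg l) := by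
    intro l
    rcases l with _ | ⟨x, _ | ⟨y, l⟩⟩
    · exact Submodule.zero_mem _
    · simpa [letterCochain, wdeg] using hξ x
    · exact Submodule.zero_mem _
  have hprim : ∀ l : List X, ∃ y ∈ C.gr (T.wdeg l),
      (l.length = 2 → C.d y = T.curv (letterCochain ξ) l) ∧ (l.length ≠ 2 → y = 0) := by
    intro l
    by_cases hl : l.length = 2
    · obtain ⟨x, y, rfl⟩ := List.length_eq_two.1 hl
      have h1 : (T.curv (letterCochain ξ) [x, y], (0 : A)) ∈ classGraph e := by
        have h2 := Subalgebra.smul_mem _ (sub_mem (mul_mem (hξc x) (hξc y))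
          (sum_mem fun z (_ : z ∈ Finset.univ) => Subalgebra.smul_mem _ (hξc z) (T.c x y z)))
          (T.eps x)
        convert h2 using 1
        ext
        · simp [curv, cup, bar, letterCochain, Prod.fst_sum, smul_sub]
        · simp [Prod.snd_sum, hmul]
      obtain ⟨y', hy'⟩ := exists_of_classGraph_zero e h1
      obtain ⟨z, hz, hz'⟩ := C.exists_homogeneous_primitive (T.curv_mem hmem _) hy'
      exact ⟨z, hz, fun _ => hz', fun h => absurd hl h⟩
    · exact ⟨0, Submodule.zero_mem _, fun h => absurd h hl, fun _ => rfl⟩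
  choose η hη hηd hη0 using hprim
  refine ⟨letterCochain ξ + η, ?_, fun l => Submodule.add_mem _ (hmem l) (hη l), fun x => ?_,
    fun l hl => ?_⟩
  · simp [letterCochain, hη0 []]
  · simpa [letterCochain, hη0 [x]] using hξc x
  · by_cases h2 : l.length = 2
    · rw [T.curv_congr (f' := letterCochain ξ) fun t ht => by
        rw [Pi.add_apply, hη0 t (by omega), add_zero], Pi.add_apply, map_add, hηd l h2,
        letterCochain_of_length ξ (by omega), map_zero, zero_add]
    · rcases l with _ | ⟨x, _ | ⟨y, l⟩⟩
      · simp [curv, cup, bar, letterCochain, hη0 []]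
      · simp [curv, cup, bar, letterCochain, hη0 [x], classGraph_closed e (hξc x)]
      · simp only [List.length_cons] at hl h2; omega

/-- A partial twisting cochain can be extended to longer words after changing it on the longest
words on which it was defined, since the obstruction is a Hochschild cocycle and hence a
coboundary. -/
theorem PartialTwisting.extend (hV : T.HochschildVanishing 𝒜 β) {q : ℕ} (hq : 3 ≤ q)
    {f : List X → C.carrier} (hf : T.PartialTwisting β e q f) :
    ∃ f', T.PartialTwisting β e (q + 1) f' ∧ ∀ l, l.length + 1 < q → f' l = f l := by
  set f₁ : List X → A := letterCochain β with hf₁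
  let S : Submodule k (C.carrier × A) := Subalgebra.toSubmodule (classGraph e)
  obtain ⟨Δ, hΔ⟩ : ∃ Δ : List X → C.carrier, ∀ l, Δ l = T.curv f l - C.d (f l) := ⟨_, fun _ => rfl⟩
  have hΔ0 : ∀ l, l.length < q → Δ l = 0 := fun l hl => by rw [hΔ, hf.eq l hl, sub_self]
  have hdef := T.defect_equation C hf.nil hf.mem (Δ := Δ) fun t => by rw [hΔ]; abel
  have hΔc : ∀ l, l.length = q → C.d (Δ l) = 0 := by
    intro l hl
    have h1 : T.cup f l Δ = 0 := (Submodule.mem_bot k).1 <| T.cup_mem ⊥ fun u v hu hv huv => by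
      have := congrArg List.length huv
      have := List.length_pos_iff.2 hv
      rw [List.length_append] at *
      rw [hΔ0 u (by omega), zero_mul]
      exact Submodule.zero_mem _
    have h2 : cup₀ Δ l f = 0 := (Submodule.mem_bot k).1 <| cup₀_mem ⊥ fun u v hu hv huv => by
      have := congrArg List.length huv
      have := List.length_pos_iff.2 hu
      rw [List.length_append] at *
      rw [hΔ0 v (by omega), mul_zero]
      exact Submodule.zero_mem _
    have h3 : T.bar l Δ = 0 := (Submodule.mem_bot k).1 <| T.bar_mem ⊥ fun t ht => by
      rw [hΔ0 t (by omega)]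
      exact Submodule.zero_mem _
    have h4 := hdef l
    rw [h1, h2, h3, add_zero, sub_zero, zero_eq_neg] at h4
    exact h4
  have hΔm : ∀ l, Δ l ∈ C.gr (T.wdeg l + 1) := fun l => by
    rw [hΔ]
    exact Submodule.sub_mem _ (T.curv_mem hf.mem l) (C.d_mem _ _ (hf.mem l))
  -- the obstruction cocycle
  have hex : ∀ l : List X, ∃ α : A, (l.length = q → (Δ l, α) ∈ classGraph e) ∧
      (l.length ≠ q → α = 0) := by
    intro l
    by_cases hl : l.length = q
    · obtain ⟨α, hα⟩ := exists_class e (hΔc l hl)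
      exact ⟨α, fun _ => hα, fun h => absurd hl h⟩
    · exact ⟨0, fun h => absurd h hl, fun _ => rfl⟩
  choose o ho ho0 using hex
  have hof : ∀ u v : List X, v ≠ [] → u.length + v.length ≤ q + 1 →
      (Δ u * f v, o u * f₁ v) ∈ S := by
    intro u v hv huv
    have hv' := List.length_pos_iff.2 hv
    by_cases hu : u.length = q
    · obtain ⟨y, rfl⟩ := List.length_eq_one_iff.1 (show v.length = 1 by omega)
      exact mul_mem (ho u hu) (hf.letter y)
    · rw [hΔ0 u (by omega), ho0 u hu, zero_mul, zero_mul]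
      exact S.zero_mem
  have hfo : ∀ u v : List X, u ≠ [] → u.length + v.length ≤ q + 1 →
      (f u * Δ v, f₁ u * o v) ∈ S := by
    intro u v hu huv
    have hu' := List.length_pos_iff.2 hu
    by_cases hv : v.length = q
    · obtain ⟨y, rfl⟩ := List.length_eq_one_iff.1 (show u.length = 1 by omega)
      exact mul_mem (hf.letter y) (ho v hv)
    · rw [hΔ0 v (by omega), ho0 v hv, mul_zero, mul_zero]
      exact S.zero_mem
  obtain ⟨ψ, hψ0, hψm, hψ⟩ := hV q hq o ho0 (fun l => by
      by_cases hl : l.length = q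
      · exact class_mem e he (ho l hl) (hΔm l)
      · rw [ho0 l hl]; exact Submodule.zero_mem _) (fun l => by
      by_cases hl : l.length = q + 1
      · have h1 : (T.cup f l Δ, T.cup f₁ l o) ∈ S := T.cup_pair_mem S fun u v hu hv huv =>
          hof u v hv (by rw [← List.length_append, huv, hl])
        have h2 : (cup₀ Δ l f, cup₀ o l f₁) ∈ S := cup₀_pair_mem S fun u v hu hv huv =>
          hfo u v hu (by rw [← List.length_append, huv, hl])
        have h3 : (T.bar l Δ, T.bar l o) ∈ S := T.bar_pair_mem S fun t ht =>
          ho t (by omega)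
        have h4 : (-C.d (Δ l), (0 : A)) ∈ classGraph e := by
          have := neg_mem (d_mem_classGraph e (Δ l))
          simpa using this
        have h5 := S.sub_mem (S.add_mem h1 h2) h3
        rw [Prod.mk_add_mk, Prod.mk_sub_mk, hdef] at h5
        exact classGraph_unique e h5 h4
      · have h1 : T.cup f₁ l o = 0 := (Submodule.mem_bot k).1 <| T.cup_mem ⊥ fun u v _ _ huv => by
          rw [Submodule.mem_bot]
          by_cases hu : u.length = q
          · rw [hf₁, letterCochain_of_length, mul_zero]
            intro hv
            rw [← huv, List.length_append] at hl
            omega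
          · rw [ho0 u hu, zero_mul]
        have h2 : cup₀ o l f₁ = 0 := (Submodule.mem_bot k).1 <| cup₀_mem ⊥ fun u v _ _ huv => by
          rw [Submodule.mem_bot]
          by_cases hv : v.length = q
          · rw [hf₁, letterCochain_of_length, zero_mul]
            intro hv
            rw [← huv, List.length_append] at hl
            omega
          · rw [ho0 v hv, mul_zero]
        have h3 : T.bar l o = 0 := (Submodule.mem_bot k).1 <| T.bar_mem ⊥ fun t ht => by
          rw [Submodule.mem_bot, ho0 t (by omega)]
        rw [h1, h2, h3, add_zero, sub_zero])
  -- the correction on words of length `q - 1`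
  have hg : ∀ l : List X, ∃ x ∈ C.gr (T.wdeg l), (x, -ψ l) ∈ classGraph e ∧
      (l.length + 1 ≠ q → x = 0) := by
    intro l
    by_cases hl : l.length + 1 = q
    · obtain ⟨x, hx, hx'⟩ := exists_representative e he (neg_mem (hψm l))
      exact ⟨x, hx, hx', fun h => absurd hl h⟩
    · refine ⟨0, Submodule.zero_mem _, ?_, fun _ => rfl⟩
      rw [hψ0 l hl, neg_zero]
      exact zero_mem (classGraph e)
  choose g hgm hgc hg0 using hg
  have hgf : ∀ u v : List X, v ≠ [] → u.length + v.length ≤ q →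
      (g u * f v, (-ψ) u * f₁ v) ∈ S := by
    intro u v hv huv
    have hv' := List.length_pos_iff.2 hv
    by_cases hu : u.length + 1 = q
    · obtain ⟨y, rfl⟩ := List.length_eq_one_iff.1 (show v.length = 1 by omega)
      exact mul_mem (hgc u) (hf.letter y)
    · rw [hg0 u hu, Pi.neg_apply, hψ0 u hu, neg_zero, zero_mul, zero_mul]
      exact S.zero_mem
  have hfg : ∀ u v : List X, u ≠ [] → u.length + v.length ≤ q →
      (f u * g v, f₁ u * (-ψ) v) ∈ S := by
    intro u v hu huv
    have hu' := List.length_pos_iff.2 hu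
    by_cases hv : v.length + 1 = q
    · obtain ⟨y, rfl⟩ := List.length_eq_one_iff.1 (show u.length = 1 by omega)
      exact mul_mem (hf.letter y) (hgc v)
    · rw [hg0 v hv, Pi.neg_apply, hψ0 v hv, neg_zero, mul_zero, mul_zero]
      exact S.zero_mem
  have hfgm : ∀ l, (f + g) l ∈ C.gr (T.wdeg l) := fun l =>
    Submodule.add_mem _ (hf.mem l) (hgm l)
  have hprim : ∀ l : List X, ∃ y ∈ C.gr (T.wdeg l),
      (l.length = q → C.d y = T.curv (f + g) l - C.d (f l)) ∧ (l.length ≠ q → y = 0) := by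
    intro l
    by_cases hl : l.length = q
    · have h1 : (T.cup f l g, T.cup f₁ l (-ψ)) ∈ S := T.cup_pair_mem S fun u v hu hv huv =>
        hgf u v hv (by rw [← List.length_append, huv, hl])
      have h2 : (T.cup g l f, T.cup (-ψ) l f₁) ∈ S := T.cup_pair_mem S fun u v hu hv huv =>
        hfg u v hu (by rw [← List.length_append, huv, hl])
      have h3 : (T.bar l g, T.bar l (-ψ)) ∈ S := T.bar_pair_mem S fun t _ => hgc t
      have h4 : T.cup g l g = 0 := (Submodule.mem_bot k).1 <| T.cup_mem ⊥ fun u v _ _ huv => by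
        rw [Submodule.mem_bot]
        by_cases hu : u.length + 1 = q
        · rw [hg0 v, mul_zero]
          rw [← huv, List.length_append] at hl
          omega
        · rw [hg0 u hu, zero_mul]
      have h5 := S.sub_mem (S.add_mem (S.add_mem (ho l hl) h1) h2) h3
      have h6 : T.cup f₁ l (-ψ) = -T.cup f₁ l ψ := by
        rw [eq_neg_iff_add_eq_zero, ← cup_add, neg_add_cancel]
        exact (Submodule.mem_bot k).1 <| T.cup_mem ⊥ fun u v _ _ _ => by simp
      have h7 : T.cup (-ψ) l f₁ = -T.cup ψ l f₁ := by
        rw [eq_neg_iff_add_eq_zero, ← cup_add_left, neg_add_cancel]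
        exact (Submodule.mem_bot k).1 <| T.cup_mem ⊥ fun u v _ _ _ => by simp
      have h8 : T.bar l (-ψ) = -T.bar l ψ := by
        rw [eq_neg_iff_add_eq_zero, ← bar_add, neg_add_cancel]
        exact (Submodule.mem_bot k).1 <| T.bar_mem ⊥ fun t _ => by simp
      have h9 : (T.curv (f + g) l - C.d (f l), (0 : A)) ∈ S := by
        convert h5 using 1
        refine Prod.ext ?_ ?_
        · simp only [Prod.fst_add, Prod.fst_sub, hΔ, curv, cup_add, cup_add_left, bar_add, h4]
          abel
        · simp only [Prod.snd_add, Prod.snd_sub, h6, h7, h8]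
          rw [hψ l hl, ← hf₁]
          abel
      obtain ⟨y', hy'⟩ := exists_of_classGraph_zero e h9
      obtain ⟨z, hz, hz'⟩ := C.exists_homogeneous_primitive (Submodule.sub_mem _
        (T.curv_mem hfgm l) (C.d_mem _ _ (hf.mem l))) hy'
      exact ⟨z, hz, fun _ => hz', fun h => absurd hl h⟩
    · exact ⟨0, Submodule.zero_mem _, fun h => absurd h hl, fun _ => rfl⟩
  choose η hη hηd hη0 using hprim
  refine ⟨f + g + η, ⟨?_, fun l => Submodule.add_mem _ (hfgm l) (hη l), fun x => ?_,
    fun l hl => ?_⟩, fun l hl => ?_⟩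
  · simp only [Pi.add_apply, hf.nil, hg0 [] (by simp; omega), hη0 [] (by simp; omega), add_zero]
  · simpa only [Pi.add_apply, hg0 [x] (by simp; omega), hη0 [x] (by simp; omega), add_zero] using
      hf.letter x
  · rw [T.curv_congr (f' := f + g) fun t ht => by
      rw [Pi.add_apply, hη0 t (by omega), add_zero]]
    simp only [Pi.add_apply, map_add, classGraph_closed e (hgc l), add_zero]
    by_cases hlq : l.length = q
    · rw [hηd l hlq]; abel
    · rw [hη0 l hlq, map_zero, add_zero, ← hf.eq l (by omega)]
      exact T.curv_congr fun t ht => by rw [Pi.add_apply, hg0 t (by omega), add_zero]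
  · simp only [Pi.add_apply, hg0 l (by omega), hη0 l (by omega), add_zero]

/-- A twisting cochain, as the limit of the successive extensions: the value on words of length `p`
no longer changes after the step `p`. -/
theorem exists_twisting (hV : T.HochschildVanishing 𝒜 β) (hβ : ∀ x, β x ∈ 𝒜 (T.deg x))
    (hmul : ∀ x y, β x * β y = ∑ z, T.c x y z • β z) :
    ∃ f, ∀ q, T.PartialTwisting β e q f := by
  obtain ⟨f₀, hf₀⟩ := T.exists_partialTwisting_three e he hβ hmul
  have step : ∀ (p : ℕ) (f : {f // T.PartialTwisting β e (p + 3) f}),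
      ∃ f' : {f // T.PartialTwisting β e (p + 1 + 3) f},
        ∀ l : List X, l.length + 1 < p + 3 → f'.1 l = f.1 l := by
    rintro p ⟨f, hf⟩
    obtain ⟨f', hf', h⟩ := hf.extend T e he hV (by omega)
    exact ⟨⟨f', by convert hf' using 1⟩, h⟩
  choose next hnext using step
  let s : ∀ p : ℕ, {f // T.PartialTwisting β e (p + 3) f} := fun p =>
    Nat.rec ⟨f₀, hf₀⟩ next p
  have hs : ∀ (p : ℕ) (l : List X), l.length ≤ p → (s p).1 l = (s l.length).1 l := by
    intro p l hl
    induction p with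
    | zero => rw [Nat.le_zero.1 hl]
    | succ p ih =>
      rcases Nat.lt_or_ge p l.length with h | h
      · rw [show l.length = p + 1 by omega]
      · rw [← ih h]
        exact hnext p (s p) l (by omega)
  refine ⟨fun l => (s l.length).1 l, fun q => ⟨(s 0).2.nil, fun l => (s _).2.mem l,
    fun x => (s 1).2.letter x, fun l _ => ?_⟩⟩
  rw [T.curv_congr (f' := (s l.length).1) fun t ht => (hs _ t ht.le).symm]
  exact (s l.length).2.eq l (by omega)

omit he in
/-- A twisting cochain gives a morphism of dg algebras out of the cobar construction. -/
theorem exists_hom_of_twisting {f : List X → C.carrier}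
    (hf : ∀ q, T.PartialTwisting β e q f) :
    ∃ Φ : DGAlgebra.Hom (cobar.{u, w} T) C,
      ∀ x, (Φ.toAlgHom (word [⟨x, []⟩] : Cobar.{u, w} k X), β x) ∈ classGraph e := by
  have hmem : ∀ l : List (BarWord.{w} X), ofCochain f (word l : Cobar.{u, w} k X) ∈
      C.gr (T.ldeg l) := by
    intro l
    induction l with
    | nil =>
      rw [word_nil, map_one]
      exact SetLike.GradedOne.one_mem
    | cons g l ih =>
      rw [ofCochain_cons, ldeg_cons]
      exact SetLike.mul_mem_graded ((hf 0).mem _) ih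
  have hd : ∀ l : List (BarWord.{w} X), ofCochain f (T.cobarD (word l : Cobar.{u, w} k X)) =
      C.d (ofCochain f (word l : Cobar.{u, w} k X)) := by
    intro l
    induction l with
    | nil => rw [d_nil, word_nil, map_one, map_zero, C.d_one]
    | cons g l ih =>
      have h1 := ofCochain_cons (k := k) f g []
      rw [word_nil, map_one, mul_one] at h1
      rw [word_cons, d_word_mul, map_mul, map_add, map_mul, map_smul, map_mul, ih, h1,
        C.leibniz_sgn ((hf 0).mem _), ← (hf _).eq _ (Nat.lt_succ_self _)]
      obtain ⟨x, t⟩ := g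
      rw [ofCochain_d]
      simp [ldeg, gdeg]
  have hd' : ∀ W : Cobar.{u, w} k X, ofCochain f (T.cobarD W) = C.d (ofCochain f W) := by
    intro W
    induction W using induction_words with
    | word l => exact hd l
    | add U V hU hV => rw [map_add, map_add, map_add, map_add, hU, hV]
    | smul r U hU => rw [map_smul, map_smul, map_smul, map_smul, hU]
  refine ⟨⟨ofCochain f, fun m x hx => T.map_mem_of_words C.gr (ofCochain f).toLinearMap hmem hx,
    fun W => hd' W⟩, fun x => ?_⟩
  have h1 := ofCochain_cons (k := k) f (⟨x, []⟩ : BarWord.{w} X) []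
  rw [word_nil, map_one, mul_one] at h1
  exact h1 ▸ (hf 0).letter x

end Main

end MulTable

/-! ### Hochschild cochains with values in a bimodule -/

namespace MulTable

variable {k : Type u} [Field k] {X : Type} [Fintype X] (T : MulTable k X)

/-- A bimodule over the non-unital algebra with structure constants `T.c`, given by the actions of
the basis elements. -/
structure Bimod (M : Type*) [AddCommGroup M] [Module k M] where
  left : X → M →ₗ[k] M
  right : X → M →ₗ[k] M
  left_mul : ∀ x y m, left x (left y m) = ∑ z, T.c x y z • left z m
  right_mul : ∀ x y m, right y (right x m) = ∑ z, T.c x y z • right z m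
  comm : ∀ x y m, left x (right y m) = right y (left x m)

section Merge

variable {M : Type*} [AddCommGroup M] [Module k M]

/-- The alternating sum of the values of a cochain on the words obtained by multiplying two
neighbouring letters. -/
def merge : List X → (List X → M) → M
  | x :: y :: l, φ => ∑ z, T.c x y z • φ (z :: l) - merge (y :: l) fun t => φ (x :: t)
  | _, _ => 0

theorem merge_map {M' : Type*} [AddCommGroup M'] [Module k M'] (f : M →ₗ[k] M') (l : List X)
    (φ : List X → M) : f (T.merge l φ) = T.merge l fun t => f (φ t) := by
  induction l generalizing φ with
  | nil => simp [merge]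
  | cons x l ih =>
    cases l with
    | nil => simp [merge]
    | cons y l => simp [merge, ih]

theorem merge_congr {l : List X} {φ φ' : List X → M}
    (h : ∀ t, t.length + 1 = l.length → φ t = φ' t) : T.merge l φ = T.merge l φ' := by
  induction l generalizing φ φ' with
  | nil => simp [merge]
  | cons x l ih =>
    cases l with
    | nil => simp [merge]
    | cons y l =>
      rw [merge, merge, ih (fun t ht => h _ (by simpa using ht))]
      simp only [h (_ :: l) (by simp)]

theorem merge_zero (l : List X) : T.merge l (fun _ => (0 : M)) = 0 := by
  have := T.merge_map (0 : M →ₗ[k] M) l fun _ => 0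
  simpa using this.symm

theorem merge_add (l : List X) (φ φ' : List X → M) :
    T.merge l (fun t => φ t + φ' t) = T.merge l φ + T.merge l φ' := by
  induction l generalizing φ φ' with
  | nil => simp [merge]
  | cons x l ih =>
    cases l with
    | nil => simp [merge]
    | cons y l =>
      simp only [merge, smul_add, Finset.sum_add_distrib, ih (fun t => φ (x :: t))]
      abel

end Merge

namespace Bimod

variable {T} {M : Type v} [AddCommGroup M] [Module k M] (P : T.Bimod M)

/-- The last term, up to sign, of the Hochschild differential. -/
def last : List X → (List X → M) → M
  | [x], φ => P.right x (φ [])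
  | x :: y :: l, φ => - last (y :: l) fun t => φ (x :: t)
  | [], _ => 0

/-- The Hochschild differential of a cochain with values in a bimodule. -/
def hoch (φ : List X → M) : List X → M
  | [] => 0
  | x :: l => P.left x (φ l) - T.merge (x :: l) φ - P.last (x :: l) φ

theorem last_map {M' : Type*} [AddCommGroup M'] [Module k M'] (P' : T.Bimod M')
    (f : M →ₗ[k] M') (hf : ∀ x m, f (P.right x m) = P'.right x (f m)) (l : List X)
    (φ : List X → M) : f (P.last l φ) = P'.last l fun t => f (φ t) := by
  induction l generalizing φ with
  | nil => simp [last]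
  | cons x l ih =>
    cases l with
    | nil => simp [last, hf]
    | cons y l => simp [last, ih]

theorem last_congr {l : List X} {φ φ' : List X → M}
    (h : ∀ t, t.length + 1 = l.length → φ t = φ' t) : P.last l φ = P.last l φ' := by
  induction l generalizing φ φ' with
  | nil => simp [last]
  | cons x l ih =>
    cases l with
    | nil => simp [last, h]
    | cons y l => rw [last, last, ih (fun t ht => h _ (by simpa using ht))]

theorem last_zero (l : List X) : P.last l (fun _ => 0) = 0 := by
  have := P.last_map P 0 (by simp) l fun _ => 0
  simpa using this.symm

theorem last_add (l : List X) (φ φ' : List X → M) :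
    P.last l (fun t => φ t + φ' t) = P.last l φ + P.last l φ' := by
  induction l generalizing φ φ' with
  | nil => simp [last]
  | cons x l ih =>
    cases l with
    | nil => simp [last]
    | cons y l =>
      simp only [last, ih (fun t => φ (x :: t))]
      abel

theorem hoch_map {M' : Type*} [AddCommGroup M'] [Module k M'] (P' : T.Bimod M')
    (f : M →ₗ[k] M') (hl : ∀ x m, f (P.left x m) = P'.left x (f m))
    (hr : ∀ x m, f (P.right x m) = P'.right x (f m)) (φ : List X → M) (l : List X) :
    f (P.hoch φ l) = P'.hoch (fun t => f (φ t)) l := by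
  cases l with
  | nil => simp [hoch]
  | cons x l => simp [hoch, hl, T.merge_map f, P.last_map P' f hr]

theorem hoch_congr {l : List X} {φ φ' : List X → M}
    (h : ∀ t, t.length + 1 = l.length → φ t = φ' t) : P.hoch φ l = P.hoch φ' l := by
  cases l with
  | nil => simp [hoch]
  | cons x l => rw [hoch, hoch, h l (by simp), T.merge_congr h, P.last_congr h]

theorem hoch_add (φ φ' : List X → M) (l : List X) :
    P.hoch (fun t => φ t + φ' t) l = P.hoch φ l + P.hoch φ' l := by
  cases l with
  | nil => simp [hoch]
  | cons x l =>
    simp only [hoch, map_add, merge_add, last_add]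
    abel

theorem hoch_zero (l : List X) : P.hoch (fun _ => 0) l = 0 := by
  cases l with
  | nil => rfl
  | cons x l => rw [hoch, map_zero, merge_zero, last_zero, sub_zero, sub_zero]

theorem hoch_neg (φ : List X → M) (l : List X) :
    P.hoch (fun t => - φ t) l = - P.hoch φ l := by
  have := P.hoch_map P (-LinearMap.id) (by simp) (by simp) φ l
  simpa using this.symm

theorem hoch_sub (φ φ' : List X → M) (l : List X) :
    P.hoch (fun t => φ t - φ' t) l = P.hoch φ l - P.hoch φ' l := by
  simp only [sub_eq_add_neg, hoch_add, hoch_neg]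

/-- The bimodule of linear maps from the algebra to `M`, with the left action
`(y g)(x) = g(x y) - x g(y)`. Hochschild cochains of arity `q + 1` with values in `M` are cochains
of arity `q` with values in this bimodule. -/
def shift : T.Bimod (X → M) where
  left y := LinearMap.pi fun x => ∑ z, T.c x y z • LinearMap.proj z - P.left x ∘ₗ LinearMap.proj y
  right y := LinearMap.pi fun x => P.right y ∘ₗ LinearMap.proj x
  left_mul y y' g := by
    funext x
    simp only [LinearMap.pi_apply, LinearMap.sub_apply, LinearMap.sum_apply, LinearMap.smul_apply,
      LinearMap.proj_apply, LinearMap.comp_apply, Finset.sum_apply, Pi.smul_apply, map_sub,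
      map_sum, map_smul, P.left_mul, smul_sub, Finset.sum_sub_distrib, Finset.smul_sum, smul_smul]
    have h : ∑ z, ∑ s, (T.c x y z * T.c z y' s) • g s =
        ∑ z, ∑ s, (T.c y y' z * T.c x z s) • g s := by
      rw [Finset.sum_comm, Finset.sum_comm (f := fun z s => (T.c y y' z * T.c x z s) • g s)]
      refine Finset.sum_congr rfl fun s _ => ?_
      rw [← Finset.sum_smul, ← Finset.sum_smul, T.assoc]
    rw [h]
    abel
  right_mul y y' g := by
    funext x
    simp [P.right_mul]
  comm y y' g := by
    funext x
    simp [P.comm]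

theorem shift_left (y : X) (g : X → M) (x : X) :
    P.shift.left y g x = ∑ z, T.c x y z • g z - P.left x (g y) := by
  simp [shift]

theorem shift_right (y : X) (g : X → M) (x : X) : P.shift.right y g x = P.right y (g x) := by
  simp [shift]

/-- The Hochschild differential in terms of the shifted bimodule. It allows induction on the arity
for all bimodules at once. -/
theorem hoch_cons_cons (φ : List X → M) (x y : X) (l : List X) :
    P.hoch φ (x :: y :: l) = - P.shift.hoch (fun t z => φ (z :: t)) (y :: l) x := by
  have h1 := T.merge_map (LinearMap.proj (R := k) (φ := fun _ : X => M) x) (y :: l)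
    fun t z => φ (z :: t)
  have h2 : ∀ (l : List X) (φ : List X → X → M),
      P.shift.last l φ x = P.last l fun t => φ t x := fun l φ =>
    P.shift.last_map P (LinearMap.proj (R := k) (φ := fun _ : X => M) x)
      (fun y m => by simp [shift_right]) l φ
  simp only [LinearMap.proj_apply] at h1
  simp only [hoch, merge, last, Pi.sub_apply, h1, h2, shift_left]
  abel

theorem shift_hoch_eq_zero {φ : List X → M} (h : ∀ l, P.hoch φ l = 0) (l : List X) :
    P.shift.hoch (fun t z => φ (z :: t)) l = 0 := by
  cases l with
  | nil => rfl
  | cons y l =>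
    funext x
    have := h (x :: y :: l)
    rw [hoch_cons_cons, neg_eq_zero] at this
    exact this

theorem hoch_hoch (φ : List X → M) (l : List X) : P.hoch (P.hoch φ) l = 0 := by
  induction l generalizing M with
  | nil => rfl
  | cons x l ih =>
    rcases l with _ | ⟨y, _ | ⟨z, l⟩⟩
    · simp [hoch, merge, last]
    · simp only [hoch, merge, last, map_sub, P.comm, P.left_mul, P.right_mul, smul_sub,
        Finset.sum_sub_distrib, smul_zero, Finset.sum_const_zero, map_zero]
      abel
    · rw [hoch_cons_cons]
      have h : P.shift.hoch (fun t z => P.hoch φ (z :: t)) (y :: z :: l) =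
          P.shift.hoch (fun t => - P.shift.hoch (fun t z => φ (z :: t)) t) (y :: z :: l) := by
        refine P.shift.hoch_congr fun t ht => ?_
        cases t with
        | nil => simp at ht
        | cons y' t =>
          funext z'
          exact P.hoch_cons_cons φ z' y' t
      rw [h, hoch_neg, ih P.shift (fun t z => φ (z :: t))]
      simp

/-- The restriction of a bimodule to a submodule which is stable under both actions. -/
def restrict (S : Submodule k M) (hl : ∀ x, ∀ m ∈ S, P.left x m ∈ S)
    (hr : ∀ x, ∀ m ∈ S, P.right x m ∈ S) : T.Bimod S where
  left x := (P.left x).restrict (hl x)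
  right x := (P.right x).restrict (hr x)
  left_mul x y m := by ext; simp [P.left_mul]
  right_mul x y m := by ext; simp [P.right_mul]
  comm x y m := by ext; simp [P.comm]

end Bimod

/-! ### Normalization with respect to the vertices -/

/-- Vertices `0, …, m` for the basis of a non-unital algebra: each basis element has a left and a
right vertex, and the vertices `1, …, m` are represented by idempotent basis elements. The
idempotent of the vertex `0` is the complement of all these in the unitization. -/
structure Vertices (m : ℕ) where
  idem : Fin m → X
  l : X → Fin (m + 1)
  r : X → Fin (m + 1)
  l_idem : ∀ t, l (idem t) = t.succ
  c_idem_left : ∀ t x z, T.c (idem t) x z ≠ 0 → l x = t.succ ∧ z = x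
  c_idem_left_self : ∀ t x, l x = t.succ → T.c (idem t) x x = 1
  c_idem_right : ∀ x t z, T.c x (idem t) z ≠ 0 → r x = t.succ ∧ z = x
  c_idem_right_self : ∀ x t, r x = t.succ → T.c x (idem t) x = 1
  l_eq : ∀ x y z, T.c x y z ≠ 0 → l z = l x

namespace Vertices

variable {T} {m : ℕ} (V : T.Vertices m) {M : Type v} [AddCommGroup M] [Module k M]

theorem sum_idem_left (t : Fin m) (x : X) (g : X → M) :
    ∑ z, T.c (V.idem t) x z • g z = if V.l x = t.succ then g x else 0 := by
  rw [Finset.sum_eq_single x]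
  · split_ifs with h
    · rw [V.c_idem_left_self t x h, one_smul]
    · by_cases h0 : T.c (V.idem t) x x = 0
      · rw [h0, zero_smul]
      · exact absurd (V.c_idem_left t x x h0).1 h
  · intro z _ hz
    by_cases h0 : T.c (V.idem t) x z = 0
    · rw [h0, zero_smul]
    · exact absurd (V.c_idem_left t x z h0).2 hz
  · simp

theorem sum_idem_right (x : X) (t : Fin m) (g : X → M) :
    ∑ z, T.c x (V.idem t) z • g z = if V.r x = t.succ then g x else 0 := by
  rw [Finset.sum_eq_single x]
  · split_ifs with h
    · rw [V.c_idem_right_self x t h, one_smul]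
    · by_cases h0 : T.c x (V.idem t) x = 0
      · rw [h0, zero_smul]
      · exact absurd (V.c_idem_right x t x h0).1 h
  · intro z _ hz
    by_cases h0 : T.c x (V.idem t) z = 0
    · rw [h0, zero_smul]
    · exact absurd (V.c_idem_right x t z h0).2 hz
  · simp

theorem left_idem_idem (P : T.Bimod M) (s t : Fin m) (n : M) :
    P.left (V.idem s) (P.left (V.idem t) n) = if t = s then P.left (V.idem s) n else 0 := by
  rw [P.left_mul, V.sum_idem_left s (V.idem t) fun z => P.left z n, V.l_idem]
  simp only [Fin.succ_inj]
  split_ifs with h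
  · rw [h]
  · rfl

/-- The projection `eₜ - e₀`. -/
def proj (P : T.Bimod M) (t : Fin m) : M →ₗ[k] M :=
  P.left (V.idem t) - (LinearMap.id - ∑ s, P.left (V.idem s))

theorem proj_left (P : T.Bimod M) (t : Fin m) (n : M) :
    V.proj P t (P.left (V.idem t) n) = P.left (V.idem t) n := by
  simp [proj, left_idem_idem]

theorem left_proj (P : T.Bimod M) (s t : Fin m) (n : M) :
    P.left (V.idem s) (V.proj P t n) = if t = s then P.left (V.idem s) n else 0 := by
  simp [proj, left_idem_idem]

/-- The cochain which makes the first argument of a cocycle normalized. -/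
def firstSlot (P : T.Bimod M) (φ : List X → M) (l : List X) : M :=
  ∑ t, V.proj P t (φ (V.idem t :: l))

/-- On words starting with an idempotent, a cocycle agrees with the differential of `firstSlot`. -/
theorem hoch_firstSlot (P : T.Bimod M) {φ : List X → M} (h : ∀ l, P.hoch φ l = 0) (s : Fin m)
    (l : List X) : P.hoch (V.firstSlot P φ) (V.idem s :: l) = φ (V.idem s :: l) := by
  have hcomm : ∀ t x n, V.proj P t (P.right x n) = P.right x (V.proj P t n) := by
    intro t x n
    simp [proj, P.comm]
  set R : Fin m → M := fun t => T.merge (V.idem s :: l) (fun w => φ (V.idem t :: w)) +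
    P.last (V.idem s :: l) (fun w => φ (V.idem t :: w)) with hR
  have h1 : ∀ t, R t = (if s = t then φ (V.idem s :: l) else 0) -
      P.left (V.idem t) (φ (V.idem s :: l)) := by
    intro t
    have h2 := h (V.idem t :: V.idem s :: l)
    rw [Bimod.hoch, merge, Bimod.last, V.sum_idem_left t (V.idem s) fun z => φ (z :: l),
      V.l_idem] at h2
    simp only [Fin.succ_inj] at h2
    rw [hR]
    linear_combination (norm := module) h2
  have hsum : ∀ (S : Finset (Fin m)) (w : List X),
      T.merge w (fun x => ∑ t ∈ S, V.proj P t (φ (V.idem t :: x))) +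
        P.last w (fun x => ∑ t ∈ S, V.proj P t (φ (V.idem t :: x))) =
      ∑ t ∈ S, V.proj P t (T.merge w (fun x => φ (V.idem t :: x)) +
        P.last w (fun x => φ (V.idem t :: x))) := by
    intro S w
    induction S using Finset.induction_on with
    | empty => simp [merge_zero, P.last_zero]
    | insert t S ht ih =>
      simp only [Finset.sum_insert ht, merge_add, P.last_add]
      rw [← ih, map_add, T.merge_map (V.proj P t), P.last_map P (V.proj P t) (hcomm t)]
      abel
  have h3 := hsum Finset.univ (V.idem s :: l)
  have h4 : ∑ t, V.proj P t (R t) = P.left (V.idem s) (φ (V.idem s :: l)) - φ (V.idem s :: l) := by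
    simp only [h1, map_sub, proj_left, Finset.sum_sub_distrib]
    rw [Finset.sum_eq_single s (by intro t _ ht; simp [Ne.symm ht]) (by simp), if_pos rfl]
    simp [proj]
    abel
  rw [Bimod.hoch, sub_sub]
  have h5 : P.left (V.idem s) (V.firstSlot P φ l) = P.left (V.idem s) (φ (V.idem s :: l)) := by
    rw [firstSlot, map_sum]
    simp [left_proj]
  rw [h5]
  have h6 : T.merge (V.idem s :: l) (V.firstSlot P φ) + P.last (V.idem s :: l) (V.firstSlot P φ) =
      P.left (V.idem s) (φ (V.idem s :: l)) - φ (V.idem s :: l) := h3.trans h4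
  rw [h6, sub_sub_cancel]

/-- The linear maps which vanish on the idempotents and are compatible with the left action of the
idempotents. -/
def normalized (P : T.Bimod M) : Submodule k (X → M) where
  carrier := {g | (∀ t, g (V.idem t) = 0) ∧
    ∀ t y, P.left (V.idem t) (g y) = if V.l y = t.succ then g y else 0}
  zero_mem' := by simp
  add_mem' := by
    rintro g g' ⟨h1, h2⟩ ⟨h1', h2'⟩
    refine ⟨fun t => by simp [h1, h1'], fun t y => ?_⟩
    rw [Pi.add_apply, map_add, h2, h2']
    split_ifs <;> simp
  smul_mem' := by
    rintro r g ⟨h1, h2⟩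
    refine ⟨fun t => by simp [h1], fun t y => ?_⟩
    rw [Pi.smul_apply, map_smul, h2]
    split_ifs <;> simp

/-- The bimodule structure on the normalized linear maps. -/
def normalizedBimod (P : T.Bimod M) : T.Bimod (V.normalized P) :=
  P.shift.restrict (V.normalized P)
    (by
      rintro y g ⟨h1, h2⟩
      refine ⟨fun t => ?_, fun t x => ?_⟩
      · rw [P.shift_left, V.sum_idem_left t y g, h2, sub_self]
      · rw [P.shift_left, map_sub, map_sum, P.left_mul,
          V.sum_idem_left t x fun z => P.left z (g y)]
        simp only [map_smul, h2, smul_ite, smul_zero]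
        have h3 : ∀ z, (if V.l z = t.succ then T.c x y z • g z else 0) =
            if V.l x = t.succ then T.c x y z • g z else 0 := by
          intro z
          by_cases hz : T.c x y z = 0
          · simp [hz]
          · rw [V.l_eq x y z hz]
        simp only [h3]
        split_ifs <;> simp)
    (by
      rintro y g ⟨h1, h2⟩
      refine ⟨fun t => ?_, fun t x => ?_⟩
      · rw [P.shift_right, h1, map_zero]
      · rw [P.shift_right, P.comm, h2]
        split_ifs <;> simp)

/-- Every Hochschild cocycle is cohomologous to one which vanishes as soon as one of its first `q`
arguments is an idempotent. The proof normalizes the first argument and then applies induction to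
the cochain with one argument less with values in the bimodule of normalized linear maps. -/
theorem exists_normalization (q : ℕ) (P : T.Bimod M) {φ : List X → M}
    (h : ∀ l, P.hoch φ l = 0) :
    ∃ ψ : List X → M, ∀ l, (∃ t, V.idem t ∈ l.take q) → φ l = P.hoch ψ l := by
  induction q generalizing M with
  | zero => exact ⟨0, fun l ⟨t, ht⟩ => by simp at ht⟩
  | succ q ih =>
    set ψ₁ := V.firstSlot P φ
    let φ₁ : List X → M := fun l => φ l - P.hoch ψ₁ l
    have hφ₁ : ∀ l, P.hoch φ₁ l = 0 := fun l => by rw [P.hoch_sub, h, P.hoch_hoch, sub_zero]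
    have hidem : ∀ t l, φ₁ (V.idem t :: l) = 0 := fun t l => by
      simp only [φ₁, ψ₁]
      rw [V.hoch_firstSlot P h, sub_self]
    have hmem : ∀ l, (fun x => φ₁ (x :: l)) ∈ V.normalized P := by
      intro l
      refine ⟨fun t => hidem t l, fun t y => ?_⟩
      have h1 := hφ₁ (V.idem t :: y :: l)
      rw [Bimod.hoch, merge, Bimod.last, V.sum_idem_left t y fun z => φ₁ (z :: l)] at h1
      simp only [hidem, merge_zero, P.last_zero, neg_zero, sub_zero] at h1
      exact sub_eq_zero.1 h1
    have hN : ∀ (χ : List X → V.normalized P) (l : List X),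
        ((V.normalizedBimod P).hoch χ l : X → M) = P.shift.hoch (fun t => (χ t : X → M)) l :=
      fun χ l => (V.normalizedBimod P).hoch_map P.shift (V.normalized P).subtype
        (fun _ _ => rfl) (fun _ _ => rfl) χ l
    obtain ⟨χ, hχ⟩ := ih (V.normalizedBimod P) (φ := fun l => ⟨_, hmem l⟩) (fun l => by
      ext1
      rw [hN]
      exact P.shift_hoch_eq_zero hφ₁ l)
    let ψ₂ : List X → M := fun l => match l with
      | [] => 0
      | x :: l => - (χ l : X → M) x
    refine ⟨fun l => ψ₁ l + ψ₂ l, fun l hl => ?_⟩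
    rw [P.hoch_add]
    suffices h2 : φ₁ l = P.hoch ψ₂ l by
      rw [← h2]
      simp only [φ₁]
      abel
    rcases l with _ | ⟨x, _ | ⟨y, l⟩⟩
    · simp at hl
    · obtain ⟨t, ht⟩ := hl
      have : x = V.idem t := (List.mem_singleton.1 (List.mem_of_mem_take ht)).symm
      rw [this, hidem]
      simp [Bimod.hoch, merge, Bimod.last, ψ₂]
    · have h3 : P.hoch ψ₂ (x :: y :: l) =
          ((V.normalizedBimod P).hoch χ (y :: l) : X → M) x := by
        rw [P.hoch_cons_cons, hN]
        have h4 : P.shift.hoch (fun t z => ψ₂ (z :: t)) (y :: l) =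
            -P.shift.hoch (fun t => (χ t : X → M)) (y :: l) := P.shift.hoch_neg _ _
        rw [h4, Pi.neg_apply, neg_neg]
      rw [h3]
      obtain ⟨t, ht⟩ := hl
      rw [List.take_succ_cons, List.mem_cons] at ht
      rcases ht with rfl | ht
      · rw [hidem, ((V.normalizedBimod P).hoch χ (y :: l)).2.1 t]
      · exact congrFun (congrArg Subtype.val (hχ (y :: l) ⟨t, ht⟩)) x

end Vertices

end MulTable

namespace MulTable

/-! ### Normalized cocycles are relative to the vertices -/

namespace Vertices

variable {k : Type u} [Field k] {X : Type} [Fintype X] {T : MulTable k X} {m : ℕ}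
  (V : T.Vertices m) {M : Type v} [AddCommGroup M] [Module k M]

/-- A cochain relative to the span of the idempotents: it vanishes on words containing an
idempotent, is bilinear over the idempotents, and vanishes on words whose letters do not compose.
The complementary idempotent of the vertex `0` is not a letter, so that these conditions are stated
for the other vertices only. -/
structure IsRelative (P : T.Bimod M) (φ : List X → M) : Prop where
  normal : ∀ l t, V.idem t ∈ l → φ l = 0
  left : ∀ (t : Fin m) y l, P.left (V.idem t) (φ (y :: l)) =
    if V.l y = t.succ then φ (y :: l) else 0
  mid : ∀ u x (t : Fin m) y l, (if V.r x = t.succ then φ (u ++ x :: y :: l) else 0) =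
    if V.l y = t.succ then φ (u ++ x :: y :: l) else 0
  right : ∀ (t : Fin m) l x, P.right (V.idem t) (φ (l ++ [x])) =
    if V.r x = t.succ then φ (l ++ [x]) else 0
  nil : ∀ t, P.left (V.idem t) (φ []) = P.right (V.idem t) (φ [])

section

variable {V}

theorem hoch_idem_cons (P : T.Bimod M) {φ : List X → M} (h : ∀ l t, V.idem t ∈ l → φ l = 0)
    (t : Fin m) (y : X) (l : List X) : P.hoch φ (V.idem t :: y :: l) =
      P.left (V.idem t) (φ (y :: l)) - if V.l y = t.succ then φ (y :: l) else 0 := by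
  rw [Bimod.hoch, merge, Bimod.last, V.sum_idem_left t y fun z => φ (z :: l)]
  simp only [h _ t List.mem_cons_self, merge_zero, P.last_zero, neg_zero, sub_zero]

theorem hoch_idem (P : T.Bimod M) {φ : List X → M} (t : Fin m) :
    P.hoch φ [V.idem t] = P.left (V.idem t) (φ []) - P.right (V.idem t) (φ []) := by
  simp [Bimod.hoch, merge, Bimod.last]

theorem shift_left_idem (P : T.Bimod M) {φ : List X → M} (h : ∀ l t, V.idem t ∈ l → φ l = 0)
    (t : Fin m) (l : List X) (x : X) : P.shift.left (V.idem t) (fun z => φ (z :: l)) x =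
      if V.r x = t.succ then φ (x :: l) else 0 := by
  rw [P.shift_left, V.sum_idem_right x t fun z => φ (z :: l), h _ t List.mem_cons_self, map_zero,
    sub_zero]

/-- Cocycle conditions on words containing an idempotent, for normalized cochains. -/
theorem IsRelative.of_hoch (P : T.Bimod M) {φ : List X → M} (h : ∀ l t, V.idem t ∈ l → φ l = 0)
    (h0 : ∀ l t, V.idem t ∈ l → P.hoch φ l = 0) : V.IsRelative P φ := by
  have hs : ∀ {M : Type v} [AddCommGroup M] [Module k M] (P : T.Bimod M) {φ : List X → M},
      (∀ l t, V.idem t ∈ l → φ l = 0) → (∀ l t, V.idem t ∈ l → P.hoch φ l = 0) →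
      (∀ l t, V.idem t ∈ l → (fun x => φ (x :: l)) = 0) ∧
      ∀ l t, V.idem t ∈ l → P.shift.hoch (fun l x => φ (x :: l)) l = 0 := by
    intro M _ _ P φ h h0
    refine ⟨fun l t ht => funext fun x => h _ t (List.mem_cons_of_mem _ ht), fun l t ht => ?_⟩
    cases l with
    | nil => rfl
    | cons y l =>
      funext x
      have := h0 (x :: y :: l) t (List.mem_cons_of_mem _ ht)
      rw [P.hoch_cons_cons, neg_eq_zero] at this
      exact this
  have hl : ∀ {M : Type v} [AddCommGroup M] [Module k M] (P : T.Bimod M) {φ : List X → M},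
      (∀ l t, V.idem t ∈ l → φ l = 0) → (∀ l t, V.idem t ∈ l → P.hoch φ l = 0) →
      ∀ t y l, P.left (V.idem t) (φ (y :: l)) = if V.l y = t.succ then φ (y :: l) else 0 := by
    intro M _ _ P φ h h0 t y l
    have := h0 (V.idem t :: y :: l) t List.mem_cons_self
    rwa [hoch_idem_cons P h, sub_eq_zero] at this
  refine ⟨h, hl P h h0, fun u => ?_, fun t l => ?_, fun t => ?_⟩
  · induction u generalizing M with
    | nil =>
      intro x t y l
      have h1 := congrFun (hl P.shift (hs P h h0).1 (hs P h h0).2 t y l) x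
      rw [shift_left_idem P h] at h1
      rw [List.nil_append, h1]
      split_ifs <;> rfl
    | cons x' u ih =>
      intro x t y l
      have h1 := congrFun (ih P.shift (hs P h h0).1 (hs P h h0).2 x t y l) x'
      simpa [ite_apply] using h1
  · induction l generalizing M with
    | nil =>
      intro x
      have h1 := (hs P h h0).2 [V.idem t] t List.mem_cons_self
      rw [hoch_idem, sub_eq_zero] at h1
      have h2 := congrFun h1 x
      rw [shift_left_idem P h, P.shift_right] at h2
      exact h2.symm
    | cons x' l ih =>
      intro x
      have h1 := congrFun (ih P.shift (hs P h h0).1 (hs P h h0).2 x) x'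
      rw [P.shift_right] at h1
      rw [List.cons_append, h1]
      split_ifs <;> rfl
  · have h1 := h0 [V.idem t] t List.mem_cons_self
    rwa [hoch_idem, sub_eq_zero] at h1

theorem IsRelative.shift {P : T.Bimod M} {φ : List X → M} (h : V.IsRelative P φ) :
    V.IsRelative P.shift fun l x => φ (x :: l) where
  normal l t ht := funext fun x => h.normal _ t (List.mem_cons_of_mem _ ht)
  left t y l := by
    funext x
    rw [shift_left_idem P h.normal]
    refine (h.mid [] x t y l).trans ?_
    rw [List.nil_append]
    split_ifs <;> rfl
  mid u x t y l := by
    funext x'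
    have := h.mid (x' :: u) x t y l
    simpa [ite_apply] using this
  right t l x := by
    funext x'
    rw [P.shift_right, ← List.cons_append, h.right]
    split_ifs <;> rfl
  nil t := by
    funext x
    rw [shift_left_idem P h.normal, P.shift_right]
    exact (h.right t [] x).symm

theorem IsRelative.hoch_eq_zero {P : T.Bimod M} {φ : List X → M} (h : V.IsRelative P φ)
    {l : List X} {t : Fin m} (ht : V.idem t ∈ l) : P.hoch φ l = 0 := by
  induction l generalizing M with
  | nil => rfl
  | cons x l ih =>
    rcases List.mem_cons.1 ht with rfl | ht
    · cases l with
      | nil => rw [hoch_idem, h.nil, sub_self]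
      | cons y l => rw [hoch_idem_cons P h.normal, h.left, sub_self]
    · cases l with
      | nil => simp at ht
      | cons y l => rw [P.hoch_cons_cons, ih h.shift ht, Pi.zero_apply, neg_zero]

end

end Vertices

/-! ### From ungraded to graded Hochschild cochains -/

section Gauge

variable {k : Type u} [Field k] {X : Type} [Fintype X] (T : MulTable k X)

/-- The signs relating the graded and the ungraded Hochschild differentials. -/
noncomputable def gauge : List X → k
  | [] => 1
  | x :: l => T.eps x ^ l.length * gauge l

theorem gauge_cons (x : X) (l : List X) : T.gauge (x :: l) = T.eps x ^ l.length * T.gauge l := rfl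

theorem eps_pow_mul_self (x : X) (q : ℕ) : T.eps x ^ q * T.eps x ^ q = 1 := by
  rw [← mul_pow, T.eps_mul_self, one_pow]

theorem gauge_mul_self (l : List X) : T.gauge l * T.gauge l = 1 := by
  induction l with
  | nil => simp [gauge]
  | cons x l ih => rw [gauge, mul_mul_mul_comm, ih, T.eps_pow_mul_self, one_mul]

variable {M : Type*} [AddCommGroup M] [Module k M]

theorem gauge_smul_smul (l : List X) (n : M) : T.gauge l • T.gauge l • n = n := by
  rw [smul_smul, gauge_mul_self, one_smul]

theorem merge_smul (r : k) (l : List X) (φ : List X → M) :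
    T.merge l (fun t => r • φ t) = r • T.merge l φ :=
  (T.merge_map (r • LinearMap.id) l φ).symm

/-- The gauge turns the signed sum `bar` of the graded theory into the alternating sum `merge`. -/
theorem merge_gauge (l : List X) (φ : List X → M) :
    T.merge l (fun t => T.gauge t • φ t) = T.gauge l • T.bar l φ := by
  induction l generalizing φ with
  | nil => simp [merge, bar]
  | cons x l ih =>
    cases l with
    | nil => simp [merge, bar]
    | cons y l =>
      have h1 : T.merge (y :: l) (fun t => T.gauge (x :: t) • φ (x :: t)) =
          T.eps x ^ l.length • T.gauge (y :: l) • T.bar (y :: l) fun t => φ (x :: t) := by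
        rw [← ih, ← merge_smul]
        refine T.merge_congr fun t ht => ?_
        rw [gauge, mul_smul, Nat.succ_injective ht]
      have h2 : ∀ z, T.c x y z • T.gauge (z :: l) • φ (z :: l) =
          (T.eps x ^ l.length * T.gauge (y :: l)) • T.c x y z • φ (z :: l) := by
        intro z
        by_cases h0 : T.c x y z = 0
        · simp [h0]
        · have h3 : T.eps z = T.eps x * T.eps y :=
            mul_left_cancel₀ h0 (T.c_mul_eps x y z)
          rw [gauge, gauge, h3, mul_pow, smul_comm, mul_assoc]
      rw [merge, bar, h1]
      simp only [h2]
      rw [← Finset.smul_sum, T.gauge_cons x (y :: l)]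
      simp only [List.length_cons, pow_succ, smul_smul, ← smul_sub]
      congr 1
      linear_combination (-(T.eps x ^ l.length * T.gauge (y :: l))) * T.eps_mul_self x

theorem Bimod.last_smul {M : Type v} [AddCommGroup M] [Module k M] (P : T.Bimod M) (r : k)
    (l : List X) (φ : List X → M) : P.last l (fun t => r • φ t) = r • P.last l φ :=
  (P.last_map P (r • LinearMap.id) (by simp) l φ).symm

variable {A : Type a} [Ring A] [Algebra k A] {β : X → A}
  (hmul : ∀ x y, β x * β y = ∑ z, T.c x y z • β z)

/-- The algebra `A` as a bimodule over its basis elements. The left action is twisted by signs which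
depend on the arity `q` of the cochains under consideration. -/
noncomputable def regular (q : ℕ) : T.Bimod A where
  left x := T.eps x ^ q • LinearMap.mulLeft k (β x)
  right x := LinearMap.mulRight k (β x)
  left_mul x y n := by
    have h : ∀ z, T.c x y z • T.eps z ^ q • (β z * n) =
        (T.eps x ^ q * T.eps y ^ q) • (T.c x y z • β z) * n := by
      intro z
      by_cases h0 : T.c x y z = 0
      · simp [h0]
      · rw [mul_left_cancel₀ h0 (T.c_mul_eps x y z), mul_pow, smul_comm, smul_mul_assoc,
          smul_mul_assoc]
    simp only [LinearMap.smul_apply, LinearMap.mulLeft_apply, h]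
    rw [← Finset.sum_mul, ← Finset.smul_sum, ← hmul, mul_smul_comm, smul_smul, smul_mul_assoc,
      mul_assoc]
  right_mul x y n := by
    simp only [LinearMap.mulRight_apply, mul_assoc, hmul, Finset.mul_sum, mul_smul_comm]
  comm x y n := by simp [mul_assoc]

theorem regular_left (q : ℕ) (x : X) (n : A) :
    (T.regular hmul q).left x n = T.eps x ^ q • (β x * n) := rfl

theorem regular_right (q : ℕ) (x : X) (n : A) : (T.regular hmul q).right x n = n * β x := rfl

theorem last_gauge (q : ℕ) {l : List X} (hl : l.length ≠ 1) (φ : List X → A) :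
    (T.regular hmul q).last l (fun t => T.gauge t • φ t) =
      - T.gauge l • T.cup (letterCochain β) l φ := by
  induction l generalizing φ with
  | nil => simp [Bimod.last, cup]
  | cons x l ih =>
    rcases l with _ | ⟨y, _ | ⟨z, l⟩⟩
    · simp at hl
    · simp [Bimod.last, regular_right, gauge, cup, letterCochain, smul_smul, T.eps_mul_self]
    · have h1 : (T.regular hmul q).last (y :: z :: l) (fun t => T.gauge (x :: t) • φ (x :: t)) =
          T.eps x ^ (l.length + 1) •
            (T.regular hmul q).last (y :: z :: l) (fun t => T.gauge t • φ (x :: t)) := by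
        rw [← Bimod.last_smul]
        refine (T.regular hmul q).last_congr fun t ht => ?_
        rw [gauge, mul_smul, Nat.succ_injective ht, List.length_cons]
      have h2 : T.cup (letterCochain β) (x :: y :: z :: l) φ = T.eps x • (φ [x] * 0 -
          T.cup (letterCochain β) (y :: z :: l) fun t => φ (x :: t)) := rfl
      rw [Bimod.last, h1, ih (by simp), h2, mul_zero, zero_sub, T.gauge_cons x]
      simp only [List.length_cons, pow_succ]
      match_scalars
      linear_combination (-(T.eps x ^ (l.length + 1) * T.gauge (y :: z :: l))) *
        T.eps_mul_self x

omit [Fintype X] in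
theorem cup₀_letterCochain (o : List X → A) (x y : X) (l : List X) :
    cup₀ o (x :: y :: l) (letterCochain β) = β x * o (y :: l) := by
  have h : ∀ (l : List X) (g : List X → A), (∀ t, t ≠ [] → g t = 0) → cup₀ o l g = 0 := by
    intro l
    induction l with
    | nil => simp [cup₀]
    | cons x l ih =>
      intro g hg
      cases l with
      | nil => simp [cup₀]
      | cons y l => rw [cup₀, hg _ (by simp), zero_mul, zero_add, ih _ fun t _ => hg _ (by simp)]
  have h := h (y :: l) (fun t => letterCochain β (x :: t)) fun t ht =>
    letterCochain_of_length β (by simpa using ht)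
  rw [cup₀, h, add_zero, letterCochain]

theorem cup_letterCochain (o : List X → A) (x y : X) (l : List X) :
    T.cup o (x :: y :: l) (letterCochain β) = T.eps x • (β x * o (y :: l)) := by
  have h : T.cup o (y :: l) (fun t => letterCochain β (x :: t)) = 0 :=
    (Submodule.mem_bot k).1 <| T.cup_mem ⊥ fun u v hu hv huv => by
      rw [letterCochain_of_length β (by simpa using hu), zero_mul]
      exact Submodule.zero_mem _
  rw [cup, h, sub_zero, letterCochain]

/-- The cocycle condition for the obstruction is the ungraded one after regauging. -/
theorem hoch_gauge_cocycle (o : List X → A) {l : List X} (hl : 2 ≤ l.length) :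
    (T.regular hmul (l.length - 1)).hoch (fun t => T.gauge t • o t) l = T.gauge l •
      (T.cup (letterCochain β) l o + cup₀ o l (letterCochain β) - T.bar l o) := by
  rcases l with _ | ⟨x, _ | ⟨y, l⟩⟩
  · simp at hl
  · simp at hl
  · rw [Bimod.hoch, merge_gauge, T.last_gauge hmul _ (by simp), cup₀_letterCochain, regular_left,
      mul_smul_comm, smul_smul, smul_sub, smul_add, neg_smul]
    simp only [List.length_cons, Nat.add_sub_cancel]
    rw [T.gauge_cons x (y :: l), List.length_cons]
    abel

/-- The coboundary condition for the obstruction is the ungraded one after regauging. -/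
theorem hoch_gauge_coboundary (ψ : List X → A) {l : List X} (hl : 2 ≤ l.length) :
    (T.regular hmul l.length).hoch (fun t => T.gauge t • ψ t) l = T.gauge l •
      (T.cup (letterCochain β) l ψ + T.cup ψ l (letterCochain β) - T.bar l ψ) := by
  rcases l with _ | ⟨x, _ | ⟨y, l⟩⟩
  · simp at hl
  · simp at hl
  · rw [Bimod.hoch, merge_gauge, T.last_gauge hmul _ (by simp), cup_letterCochain, regular_left,
      mul_smul_comm, smul_smul, smul_sub, smul_add, neg_smul, smul_smul]
    have h : T.gauge (x :: y :: l) * T.eps x =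
        T.eps x ^ (x :: y :: l).length * T.gauge (y :: l) := by
      simp only [T.gauge_cons x (y :: l), List.length_cons, pow_succ]
      ring
    rw [h]
    abel

end Gauge

/-! ### Reduction to relative homogeneous cocycles -/

section Reduction

variable {k : Type u} [Field k] {X : Type} [Fintype X] (T : MulTable k X)
  {A : Type a} [Ring A] [Algebra k A] {β : X → A}
  (hmul : ∀ x y, β x * β y = ∑ z, T.c x y z • β z)
  (𝒜 : ℤ → Submodule k A) [GradedAlgebra 𝒜]

/-- Replace the value of a cochain of arity `q - 1` on each word by its component in the degree of a
cochain of internal degree `2 - q`. -/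
noncomputable def homogenize (q : ℕ) (ψ : List X → A) (l : List X) : A :=
  if l.length + 1 = q then GradedAlgebra.proj 𝒜 (T.wdeg l) (ψ l) else 0

theorem wdeg_cons (x : X) (l : List X) : T.wdeg (x :: l) = T.deg x - 1 + T.wdeg l := rfl

theorem merge_proj (l : List X) (φ : List X → A) (s : ℤ) :
    GradedAlgebra.proj 𝒜 (s + T.wdeg l + 1) (T.merge l φ) =
      T.merge l fun t => GradedAlgebra.proj 𝒜 (s + T.wdeg t) (φ t) := by
  induction l generalizing φ s with
  | nil => simp [merge]
  | cons x l ih =>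
    cases l with
    | nil => simp [merge]
    | cons y l =>
      rw [merge, map_sub, map_sum, merge]
      congr 1
      · refine Finset.sum_congr rfl fun z _ => ?_
        rw [map_smul]
        by_cases h0 : T.c x y z = 0
        · simp [h0]
        · congr 3
          simp only [wdeg, T.deg_eq x y z h0]
          ring
      · have h := ih (fun t => φ (x :: t)) (s + T.deg x - 1)
        rw [show s + T.wdeg (x :: y :: l) + 1 = s + T.deg x - 1 + T.wdeg (y :: l) + 1 by
          rw [T.wdeg_cons x (y :: l)]; ring, h]
        refine T.merge_congr fun t _ => ?_
        congr 2
        rw [T.wdeg_cons x t]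
        ring

variable {𝒜} (hβ : ∀ x, β x ∈ 𝒜 (T.deg x))
include hβ in
theorem last_proj (p : ℕ) (l : List X) (φ : List X → A) (s : ℤ) :
    GradedAlgebra.proj 𝒜 (s + T.wdeg l + 1) ((T.regular hmul p).last l φ) =
      (T.regular hmul p).last l fun t => GradedAlgebra.proj 𝒜 (s + T.wdeg t) (φ t) := by
  induction l generalizing φ s with
  | nil => simp [Bimod.last]
  | cons x l ih =>
    cases l with
    | nil =>
      rw [Bimod.last, Bimod.last, regular_right, regular_right,
        show s + T.wdeg [x] + 1 = s + T.wdeg [] + T.deg x by simp only [wdeg]; ring]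
      exact coe_decompose_mul_add_of_right_mem 𝒜 (hβ x)
    | cons y l =>
      have h := ih (fun t => φ (x :: t)) (s + T.deg x - 1)
      rw [Bimod.last, map_neg, Bimod.last,
        show s + T.wdeg (x :: y :: l) + 1 = s + T.deg x - 1 + T.wdeg (y :: l) + 1 by
          rw [T.wdeg_cons x (y :: l)]; ring, h]
      congr 1
      refine (T.regular hmul p).last_congr fun t _ => ?_
      congr 2
      rw [T.wdeg_cons x t]
      ring

include hβ in
theorem hoch_homogenize (p : ℕ) (ψ : List X → A) (l : List X) :
    (T.regular hmul p).hoch (T.homogenize 𝒜 l.length ψ) l =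
      GradedAlgebra.proj 𝒜 (T.wdeg l + 1) ((T.regular hmul p).hoch ψ l) := by
  have h1 : (T.regular hmul p).hoch (T.homogenize 𝒜 l.length ψ) l =
      (T.regular hmul p).hoch (fun t => GradedAlgebra.proj 𝒜 (0 + T.wdeg t) (ψ t)) l :=
    (T.regular hmul p).hoch_congr fun t ht => by rw [homogenize, if_pos ht, zero_add]
  rw [h1]
  cases l with
  | nil => simp [Bimod.hoch]
  | cons x l =>
    rw [Bimod.hoch, Bimod.hoch, map_sub, map_sub, ← merge_proj, ← T.last_proj hmul hβ, zero_add,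
      regular_left, regular_left, map_smul, zero_add,
      show T.wdeg (x :: l) + 1 = T.deg x + T.wdeg l by rw [wdeg]; ring]
    congr 3
    exact (coe_decompose_mul_add_of_left_mem 𝒜 (hβ x)).symm

include hβ in
/-- It suffices to find primitives of homogeneous cocycles which are relative to the vertices. -/
theorem hochschildVanishing_of_relative {m : ℕ} (V : T.Vertices m)
    (H : ∀ q, 3 ≤ q → ∀ φ : List X → A, (∀ l, l.length ≠ q → φ l = 0) →
      (∀ l, φ l ∈ 𝒜 (T.wdeg l + 1)) → V.IsRelative (T.regular hmul q) φ →
      (∀ l, (T.regular hmul q).hoch φ l = 0) →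
      ∃ ψ, ∀ l, l.length = q → φ l = (T.regular hmul q).hoch ψ l) :
    T.HochschildVanishing 𝒜 β := by
  intro q hq o ho1 ho2 ho3
  set P := T.regular hmul q
  -- Homogenizing a primitive of a homogeneous cochain gives a primitive.
  have hhom : ∀ (φ ψ : List X → A) (l : List X), l.length = q → φ l ∈ 𝒜 (T.wdeg l + 1) →
      φ l = P.hoch ψ l → φ l = P.hoch (T.homogenize 𝒜 q ψ) l := by
    rintro φ ψ l rfl h1 h2
    rw [T.hoch_homogenize hmul hβ, ← h2]
    exact (decompose_of_mem_same 𝒜 h1).symm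
  have hlen : ∀ (ψ : List X → A) (l : List X), l.length ≠ q →
      P.hoch (T.homogenize 𝒜 q ψ) l = 0 := by
    intro ψ l hl
    rw [← P.hoch_zero l]
    exact P.hoch_congr fun t ht => by rw [homogenize, if_neg (by omega)]
  have hdeg : ∀ (ψ : List X → A) (l : List X),
      P.hoch (T.homogenize 𝒜 q ψ) l ∈ 𝒜 (T.wdeg l + 1) := by
    intro ψ l
    by_cases hl : l.length = q
    · subst hl
      rw [T.hoch_homogenize hmul hβ]
      exact SetLike.coe_mem _
    · rw [hlen ψ l hl]
      exact Submodule.zero_mem _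
  let φ : List X → A := fun l => T.gauge l • o l
  have hφ1 : ∀ l, l.length ≠ q → φ l = 0 := fun l hl => by simp [φ, ho1 l hl]
  have hφ2 : ∀ l, φ l ∈ 𝒜 (T.wdeg l + 1) := fun l => Submodule.smul_mem _ _ (ho2 l)
  have hφ3 : ∀ l, P.hoch φ l = 0 := by
    intro l
    by_cases hl : l.length = q + 1
    · have := T.hoch_gauge_cocycle hmul o (l := l) (by omega)
      rw [ho3, smul_zero, hl] at this
      exact this
    · rw [← P.hoch_zero l]
      exact P.hoch_congr fun t ht => hφ1 t (by omega)
  obtain ⟨ψ₀, hψ₀⟩ := V.exists_normalization q P hφ3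
  let φ' : List X → A := fun l => φ l - P.hoch (T.homogenize 𝒜 q ψ₀) l
  have h1 : ∀ l, l.length ≠ q → φ' l = 0 := fun l hl => by
    simp only [φ', hφ1 l hl, hlen ψ₀ l hl, sub_zero]
  have h2 : ∀ l, φ' l ∈ 𝒜 (T.wdeg l + 1) := fun l => Submodule.sub_mem _ (hφ2 l) (hdeg ψ₀ l)
  have h3 : ∀ l, P.hoch φ' l = 0 := fun l => by rw [P.hoch_sub, hφ3, P.hoch_hoch, sub_zero]
  have h4 : ∀ l t, V.idem t ∈ l → φ' l = 0 := by
    intro l t ht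
    by_cases hl : l.length = q
    · exact sub_eq_zero.2 (hhom φ ψ₀ l hl (hφ2 l) (hψ₀ l ⟨t, by rwa [← hl, List.take_length]⟩))
    · exact h1 l hl
  obtain ⟨ψ₁, hψ₁⟩ := H q hq φ' h1 h2 (.of_hoch P h4 fun l _ _ => h3 l) h3
  let χ : List X → A := fun l => T.homogenize 𝒜 q ψ₀ l + T.homogenize 𝒜 q ψ₁ l
  have hχ : ∀ l, l.length = q → φ l = P.hoch χ l := by
    intro l hl
    rw [P.hoch_add, ← hhom φ' ψ₁ l hl (h2 l) (hψ₁ l hl)]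
    simp only [φ']
    abel
  have hmem : ∀ (ψ : List X → A) l, T.homogenize 𝒜 q ψ l ∈ 𝒜 (T.wdeg l) := by
    intro ψ l
    rw [homogenize]
    split_ifs
    · exact SetLike.coe_mem _
    · exact Submodule.zero_mem _
  refine ⟨fun l => T.gauge l • χ l, fun l hl => ?_, fun l => ?_, fun l hl => ?_⟩
  · simp [χ, homogenize, hl]
  · exact Submodule.smul_mem _ _ (Submodule.add_mem _ (hmem ψ₀ l) (hmem ψ₁ l))
  · subst hl
    have h5 := T.hoch_gauge_coboundary hmul (fun l => T.gauge l • χ l) (l := l) (by omega)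
    simp only [gauge_smul_smul] at h5
    rw [← T.gauge_smul_smul l (o l)]
    change T.gauge l • φ l = _
    rw [hχ l rfl, h5, gauge_smul_smul]

end Reduction

end MulTable

/-! ### Zigzag bases -/

/-- The basis elements, other than the idempotent of the vertex `0`, of the zigzag algebra of the
linear graph with vertices `0, …, m`: the idempotents of the vertices `t + 1`, the two orientations
of the edges between `i` and `i + 1`, and the socle elements. -/
inductive Letter (m : ℕ)
  | e (t : Fin m)
  | up (i : Fin m)
  | dn (i : Fin m)
  | s (v : Fin (m + 1))
  deriving DecidableEq, Fintype

namespace Letter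

variable {m : ℕ}

/-- The left vertex: `x` is fixed by multiplication by its idempotent from the left. -/
def l : Letter m → Fin (m + 1)
  | e t => t.succ
  | up i => i.castSucc
  | dn i => i.succ
  | s v => v

/-- The right vertex. -/
def r : Letter m → Fin (m + 1)
  | e t => t.succ
  | up i => i.succ
  | dn i => i.castSucc
  | s v => v

/-- The path length of a basis element. -/
def wt : Letter m → ℕ
  | e _ => 0
  | up _ => 1
  | dn _ => 1
  | s _ => 2

/-- The structure constants of a zigzag algebra. -/
def coeff {k : Type u} [Field k] (a b : Fin m → k) : Letter m → Letter m → Letter m → k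
  | e t, y, z => if y.l = t.succ ∧ z = y then 1 else 0
  | x, e t, z => if x.r = t.succ ∧ z = x then 1 else 0
  | up i, dn j, z => if i = j ∧ z = s i.castSucc then a i else 0
  | dn i, up j, z => if i = j ∧ z = s i.succ then b i else 0
  | _, _, _ => 0

variable {k : Type u} [Field k] {c d : Fin m → k}

theorem coeff_e_right (x : Letter m) (t : Fin m) (z : Letter m) :
    coeff c d x (e t) z = if x.r = t.succ ∧ z = x then 1 else 0 := by
  cases x with
  | e t' =>
    simp only [coeff, l, r]
    by_cases h : t = t'
    · subst h; rfl
    · have h' : t' ≠ t := Ne.symm h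
      simp [h, h']
  | _ => rfl

/-- A product of basis elements is a multiple of a basis element whose path length is the sum of the
path lengths, and the vertices match. -/
theorem coeff_ne_zero {x y z : Letter m} (h : coeff c d x y z ≠ 0) :
    z.wt = x.wt + y.wt ∧ z.l = x.l ∧ z.r = y.r ∧ x.r = y.l := by
  cases x <;> cases y <;> simp only [coeff, ne_eq, not_true_eq_false, ite_eq_right_iff,
    Classical.not_imp] at h <;> obtain ⟨⟨h1, rfl⟩, -⟩ := h <;> simp_all [wt, l, r]

theorem wt_le (x : Letter m) : x.wt ≤ 2 := by cases x <;> simp [wt]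

end Letter

/-- A basis of a graded algebra with the multiplication table of a zigzag algebra, up to nonzero
constants. The degrees are half of `N` times the path length, up to a potential `p` on the
vertices. The unit together with the elements `β x` is a basis. -/
structure ZigzagBasis {k : Type u} [Field k] {A : Type a} [Ring A] [Algebra k A]
    (𝒜 : ℤ → Submodule k A) (N m : ℕ) where
  β : Letter m → A
  up_dn : Fin m → k
  dn_up : Fin m → k
  up_dn_ne : ∀ i, up_dn i ≠ 0
  dn_up_ne : ∀ i, dn_up i ≠ 0
  mul : ∀ x y, β x * β y = ∑ z, Letter.coeff up_dn dn_up x y z • β z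
  span : ∀ α : A, ∃ (r : k) (μ : Letter m → k), α = r • 1 + ∑ x, μ x • β x
  ind : ∀ (r : k) (μ : Letter m → k), r • (1 : A) + ∑ x, μ x • β x = 0 → r = 0 ∧ μ = 0
  deg : Letter m → ℤ
  mem : ∀ x, β x ∈ 𝒜 (deg x)
  p : Fin (m + 1) → ℤ
  deg_eq : ∀ x : Letter m, 2 * deg x = N * x.wt + p x.r - p x.l

namespace ZigzagBasis

open Letter

variable {k : Type u} [Field k] {A : Type a} [Ring A] [Algebra k A]
  {𝒜 : ℤ → Submodule k A} {N m : ℕ} (Z : ZigzagBasis 𝒜 N m)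

/-- The multiplication table of a zigzag basis. -/
def table : MulTable k (Letter m) where
  deg := Z.deg
  c := coeff Z.up_dn Z.dn_up
  deg_eq x y z h := by
    have h1 := Z.deg_eq x
    have h2 := Z.deg_eq y
    have h3 := Z.deg_eq z
    rw [(coeff_ne_zero h).1, (coeff_ne_zero h).2.1, (coeff_ne_zero h).2.2.1] at h3
    rw [(coeff_ne_zero h).2.2.2] at h1
    push_cast at h3
    linarith
  assoc x y t s := by
    have h : ∑ s, (∑ z, coeff Z.up_dn Z.dn_up x y z * coeff Z.up_dn Z.dn_up z t s -
        ∑ z, coeff Z.up_dn Z.dn_up y t z * coeff Z.up_dn Z.dn_up x z s) • Z.β s = 0 := by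
      have h1 := mul_assoc (Z.β x) (Z.β y) (Z.β t)
      rw [Z.mul x y, Z.mul y t, Finset.sum_mul, Finset.mul_sum] at h1
      simp only [smul_mul_assoc, mul_smul_comm, Z.mul, Finset.smul_sum, smul_smul] at h1
      rw [Finset.sum_comm, Finset.sum_comm (f := fun z s => (coeff Z.up_dn Z.dn_up y t z *
        coeff Z.up_dn Z.dn_up x z s) • Z.β s)] at h1
      simp only [sub_smul, Finset.sum_sub_distrib, Finset.sum_smul, h1, sub_self]
    have h2 := (Z.ind 0 _ (by rw [zero_smul, zero_add]; exact h)).2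
    exact sub_eq_zero.1 (congrFun h2 s)

/-- The vertices of a zigzag basis. -/
def vertices : Z.table.Vertices m where
  idem := e
  l := l
  r := r
  l_idem _ := rfl
  c_idem_left t x z h := by
    by_contra h'
    exact h (if_neg h')
  c_idem_left_self t x h := if_pos ⟨h, rfl⟩
  c_idem_right x t z h := by
    by_contra h'
    exact h ((coeff_e_right x t z).trans (if_neg h'))
  c_idem_right_self x t h := (coeff_e_right x t x).trans (if_pos ⟨h, rfl⟩)
  l_eq _ _ _ h := (coeff_ne_zero h).2.1

theorem e_mul (t : Fin m) (x : Letter m) :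
    Z.β (e t) * Z.β x = if x.l = t.succ then Z.β x else 0 := by
  rw [Z.mul]
  exact Z.vertices.sum_idem_left t x Z.β

theorem mul_e (x : Letter m) (t : Fin m) :
    Z.β x * Z.β (e t) = if x.r = t.succ then Z.β x else 0 := by
  rw [Z.mul]
  exact Z.vertices.sum_idem_right x t Z.β

theorem mul_eq_zero {x y : Letter m} (h : 2 < x.wt + y.wt) : Z.β x * Z.β y = 0 := by
  rw [Z.mul]
  refine Finset.sum_eq_zero fun z _ => ?_
  by_cases h0 : coeff Z.up_dn Z.dn_up x y z = 0
  · rw [h0, zero_smul]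
  · have := (coeff_ne_zero h0).1
    have := z.wt_le
    omega

theorem up_mul_dn (i : Fin m) : Z.β (up i) * Z.β (dn i) = Z.up_dn i • Z.β (s i.castSucc) := by
  simp [Z.mul, coeff, ite_smul]

theorem dn_mul_up (i : Fin m) : Z.β (dn i) * Z.β (up i) = Z.dn_up i • Z.β (s i.succ) := by
  simp [Z.mul, coeff, ite_smul]

theorem deg_e (t : Fin m) : Z.deg (e t) = 0 := by
  have := Z.deg_eq (e t)
  simp only [wt, l, r] at this
  push_cast at this
  linarith

theorem eps_e (t : Fin m) : Z.table.eps (e t) = 1 := by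
  have : Z.table.deg (e t) = 0 := Z.deg_e t
  rw [MulTable.eps, this, sgn_zero]

/-- The idempotent of a vertex. -/
def vertex (v : Fin (m + 1)) : A := Fin.cases (1 - ∑ t, Z.β (e t)) (fun t => Z.β (e t)) v

theorem vertex_succ (t : Fin m) : Z.vertex t.succ = Z.β (e t) := rfl

theorem vertex_zero : Z.vertex 0 = 1 - ∑ t, Z.β (e t) := rfl

/-- An element on which the idempotents of the vertices other than `0` act from the left as on
elements with left vertex `i` is fixed by the idempotent of `i`. -/
theorem vertex_mul_eq {i : Fin (m + 1)} {α : A}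
    (h : ∀ t : Fin m, Z.β (e t) * α = if i = t.succ then α else 0) (j : Fin (m + 1)) :
    Z.vertex j * α = if i = j then α else 0 := by
  refine Fin.cases ?_ (fun t => h t) j
  rw [vertex_zero, sub_mul, one_mul, Finset.sum_mul]
  simp only [h]
  refine Fin.cases ?_ (fun t => ?_) i
  · simp [Fin.succ_ne_zero, eq_comm]
  · simp [Fin.succ_ne_zero]

theorem mul_vertex_eq {i : Fin (m + 1)} {α : A}
    (h : ∀ t : Fin m, α * Z.β (e t) = if i = t.succ then α else 0) (j : Fin (m + 1)) :
    α * Z.vertex j = if i = j then α else 0 := by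
  refine Fin.cases ?_ (fun t => h t) j
  rw [vertex_zero, mul_sub, mul_one, Finset.mul_sum]
  simp only [h]
  refine Fin.cases ?_ (fun t => ?_) i
  · simp [Fin.succ_ne_zero, eq_comm]
  · simp [Fin.succ_ne_zero]

end ZigzagBasis

/-! ### Paths -/

namespace Letter

variable {m : ℕ}

/-- The consecutive letters of the word compose, and it runs from the vertex `i` to the vertex
`j`. -/
def IsPath : Fin (m + 1) → List (Letter m) → Fin (m + 1) → Prop
  | i, [], j => i = j
  | i, x :: w, j => x.l = i ∧ IsPath x.r w j

theorem isPath_append {i j : Fin (m + 1)} {w w' : List (Letter m)} :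
    IsPath i (w ++ w') j ↔ ∃ v, IsPath i w v ∧ IsPath v w' j := by
  induction w generalizing i with
  | nil => simp [IsPath]
  | cons x w ih => simp [IsPath, ih, and_assoc]

theorem exists_isPath (x : Letter m) (w : List (Letter m))
    (h : ∀ u y z v, x :: w = u ++ y :: z :: v → y.r = z.l) :
    ∃ u y, x :: w = u ++ [y] ∧ IsPath x.l (x :: w) y.r := by
  induction w generalizing x with
  | nil => exact ⟨[], x, rfl, rfl, rfl⟩
  | cons y w ih =>
    obtain ⟨u, z, h1, h2⟩ := ih y fun u y' z v huv => h (x :: u) y' z v (by rw [huv]; rfl)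
    refine ⟨x :: u, z, by rw [h1]; rfl, rfl, ?_⟩
    rw [h [] x y w rfl]
    exact h2

end Letter

namespace ZigzagBasis

open Letter

variable {k : Type u} [Field k] {A : Type a} [Ring A] [Algebra k A]
  {𝒜 : ℤ → Submodule k A} {N m : ℕ} (Z : ZigzagBasis 𝒜 N m)

theorem two_mul_wdeg {i j : Fin (m + 1)} {w : List (Letter m)} (h : IsPath i w j) :
    2 * Z.table.wdeg w = N * (w.map wt).sum + Z.p j - Z.p i - 2 * w.length + 2 := by
  induction w generalizing i with
  | nil =>
    obtain rfl : i = j := h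
    simp [MulTable.wdeg]
  | cons x w ih =>
    obtain ⟨rfl, h⟩ := h
    have h1 := ih h
    have h2 := Z.deg_eq x
    rw [Z.table.wdeg_cons, List.map_cons, List.sum_cons, List.length_cons]
    change 2 * (Z.deg x - 1 + Z.table.wdeg w) = _
    rw [Nat.cast_add, Nat.cast_succ]
    linear_combination h1 + h2

/-- A homogeneous element from the vertex `i` to the vertex `j` is a combination of basis elements
of its degree from `i` to `j`; here `none` stands for the unit. -/
theorem exists_of_vertex_mul [GradedAlgebra 𝒜] {i j : Fin (m + 1)} {D : ℤ} {α : A} (hα : α ∈ 𝒜 D)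
    (hl : Z.vertex i * α = α) (hr : α * Z.vertex j = α) :
    ∃ (r : k) (μ : Letter m → k), α = r • Z.vertex i + ∑ x, μ x • Z.β x ∧
      (r ≠ 0 → i = j ∧ D = 0) ∧ ∀ x, μ x ≠ 0 → x.l = i ∧ x.r = j ∧ Z.deg x = D := by
  have hβl : ∀ x, Z.vertex i * Z.β x = if x.l = i then Z.β x else 0 := fun x =>
    Z.vertex_mul_eq (fun t => Z.e_mul t x) i
  have hβr : ∀ x, Z.β x * Z.vertex j = if x.r = j then Z.β x else 0 := fun x =>
    Z.mul_vertex_eq (fun t => Z.mul_e x t) j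
  have hv : Z.vertex i * Z.vertex j = if i = j then Z.vertex i else 0 := by
    refine Z.mul_vertex_eq (fun t => ?_) j
    refine Fin.cases ?_ (fun t' => ?_) i
    · rw [vertex_zero, sub_mul, one_mul, Finset.sum_mul]
      simp [Z.e_mul, l, (Fin.succ_ne_zero _).symm]
    · rw [vertex_succ, Z.mul_e]
      rfl
  have hv0 : Z.vertex i ∈ 𝒜 0 := by
    have he : ∀ t, Z.β (e t) ∈ 𝒜 0 := fun t => by
      have := Z.mem (e t)
      rwa [Z.deg_e] at this
    refine Fin.cases ?_ he i
    exact Submodule.sub_mem _ SetLike.GradedOne.one_mem (Submodule.sum_mem _ fun t _ => he t)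
  obtain ⟨r, μ, h⟩ := Z.span α
  have h1 : α = (if i = j then r else 0) • Z.vertex i +
      ∑ x, (if x.l = i ∧ x.r = j then μ x else 0) • Z.β x := by
    conv_lhs => rw [← hr, ← hl, h]
    rw [mul_add, add_mul, mul_smul_comm, smul_mul_assoc, mul_one, hv, Finset.mul_sum,
      Finset.sum_mul]
    congr 1
    · split_ifs <;> simp
    · refine Finset.sum_congr rfl fun x _ => ?_
      rw [mul_smul_comm, smul_mul_assoc, hβl]
      by_cases hx : x.l = i
      · rw [if_pos hx, hβr]
        by_cases hx' : x.r = j <;> simp [hx, hx']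
      · simp [hx]
  refine ⟨if D = 0 then (if i = j then r else 0) else 0,
    fun x => if Z.deg x = D then (if x.l = i ∧ x.r = j then μ x else 0) else 0, ?_, ?_, ?_⟩
  · have hproj : ∀ (d : ℤ) (y : A), y ∈ 𝒜 d →
        GradedAlgebra.proj 𝒜 D y = if d = D then y else 0 := by
      intro d y hy
      rw [GradedAlgebra.proj_apply]
      split_ifs with hd
      · subst hd
        exact decompose_of_mem_same 𝒜 hy
      · exact decompose_of_mem_ne 𝒜 hy hd
    have h2 := congrArg (GradedAlgebra.proj 𝒜 D) h1
    rw [hproj D α hα, if_pos rfl, map_add, map_smul, hproj 0 _ hv0, map_sum] at h2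
    rw [h2]
    congr 1
    · by_cases hD : D = 0
      · simp [hD]
      · simp [hD, Ne.symm hD]
    · refine Finset.sum_congr rfl fun x _ => ?_
      rw [map_smul, hproj _ _ (Z.mem x)]
      dsimp only
      split_ifs <;> simp
  · intro h0
    by_cases hD : D = 0
    · by_cases hij : i = j
      · exact ⟨hij, hD⟩
      · simp [hij] at h0
    · simp [hD] at h0
  · intro x h0
    dsimp only at h0
    by_cases hx : Z.deg x = D
    · rw [if_pos hx] at h0
      by_cases hx' : x.l = i ∧ x.r = j
      · exact ⟨hx'.1, hx'.2, hx⟩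
      · simp [hx'] at h0
    · simp [hx] at h0

end ZigzagBasis

/-! ### Vanishing of Hochschild cohomology for zigzag bases -/

theorem MulTable.Bimod.last_append {k : Type u} [Field k] {X : Type} [Fintype X]
    {T : MulTable k X} {M : Type v} [AddCommGroup M] [Module k M] (P : T.Bimod M)
    (φ : List X → M) (l : List X) (x : X) :
    P.last (l ++ [x]) φ = (-1 : k) ^ l.length • P.right x (φ l) := by
  induction l generalizing φ with
  | nil => simp [last]
  | cons y l ih =>
    have h : P.last (y :: (l ++ [x])) φ = - P.last (l ++ [x]) fun t => φ (y :: t) := by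
      cases l <;> rfl
    rw [List.cons_append, h, ih, List.length_cons, pow_succ]
    simp

namespace Letter

variable {m : ℕ}

theorem forall_wt_eq_one {w : List (Letter m)} (h1 : ∀ x ∈ w, 1 ≤ x.wt)
    (h2 : (w.map wt).sum = w.length) : ∀ x ∈ w, x.wt = 1 := by
  induction w with
  | nil => simp
  | cons x w ih =>
    have h3 : w.length ≤ (w.map wt).sum := by
      simpa using List.length_le_sum_of_one_le (w.map wt) fun i hi => by
        obtain ⟨y, hy, rfl⟩ := List.mem_map.1 hi
        exact h1 y (List.mem_cons_of_mem _ hy)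
    have h4 := h1 x List.mem_cons_self
    rw [List.map_cons, List.sum_cons, List.length_cons] at h2
    intro y hy
    rcases List.mem_cons.1 hy with rfl | hy
    · omega
    · exact ih (fun z hz => h1 z (List.mem_cons_of_mem _ hz)) (by omega) y hy

theorem one_le_wt {x : Letter m} (h : ∀ t, x ≠ e t) : 1 ≤ x.wt := by
  cases x <;> simp_all [wt]

end Letter

namespace ZigzagBasis

open Letter

variable {k : Type u} [Field k] {A : Type a} [Ring A] [Algebra k A]
  {𝒜 : ℤ → Submodule k A} {N m : ℕ} (Z : ZigzagBasis 𝒜 N m)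

/-- The algebra as a bimodule over its basis elements, for cochains of arity `q`. -/
noncomputable abbrev bimod (q : ℕ) : Z.table.Bimod A := Z.table.regular Z.mul q

theorem bimod_left (q : ℕ) (x : Letter m) (α : A) :
    (Z.bimod q).left x α = Z.table.eps x ^ q • (Z.β x * α) := rfl

theorem bimod_right (q : ℕ) (x : Letter m) (α : A) : (Z.bimod q).right x α = α * Z.β x := rfl

theorem bimod_left_e (q : ℕ) (t : Fin m) (α : A) : (Z.bimod q).left (e t) α = Z.β (e t) * α := by
  rw [bimod_left, Z.eps_e, one_pow, one_smul]

/-- The degree argument: a homogeneous relative cochain of arity `q ≥ 3` and internal degree `2 - q`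
can only be nonzero if `N = 2`, and then only on closed walks along edges, where its values are
multiples of a socle element. Indeed, the path length `s` of a word of length `q` without
idempotents is at least `q`, and if the value on it has a component of path length `s'`, then
comparing degrees gives `N (s - s') = 2 (q - 2)`. -/
theorem support_of_isRelative [GradedAlgebra 𝒜] (hN : 2 ≤ N) {q : ℕ} (hq : 3 ≤ q)
    {φ : List (Letter m) → A} (hφ : ∀ l, φ l ∈ 𝒜 (Z.table.wdeg l + 1))
    (hrel : Z.vertices.IsRelative (Z.bimod q) φ) {w : List (Letter m)} (hw : w.length = q)
    (h0 : φ w ≠ 0) :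
    N = 2 ∧ (∀ x ∈ w, x.wt = 1) ∧ ∃ v, IsPath v w v ∧ ∃ μ : k, φ w = μ • Z.β (s v) := by
  have hwt : ∀ x ∈ w, 1 ≤ x.wt := fun x hx => one_le_wt fun t ht =>
    h0 (hrel.normal w t (show e t ∈ w from ht ▸ hx))
  have hmid : ∀ u x y v, w = u ++ x :: y :: v → x.r = y.l := by
    intro u x y v hu
    have h1 : ∀ t : Fin m, x.r = t.succ ↔ y.l = t.succ := by
      intro t
      have := hrel.mid u x t y v
      rw [← hu] at this
      change (if x.r = t.succ then φ w else 0) = if y.l = t.succ then φ w else 0 at this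
      by_cases h2 : x.r = t.succ <;> by_cases h3 : y.l = t.succ <;>
        simp [h2, h3, h0, h0.symm] at this
      · simp [h2, h3]
      · simp [h2, h3]
    rcases Fin.eq_zero_or_eq_succ x.r with h2 | ⟨t, h2⟩
    · rcases Fin.eq_zero_or_eq_succ y.l with h3 | ⟨t, h3⟩
      · rw [h2, h3]
      · rw [(h1 t).2 h3, h3]
    · rw [h2, (h1 t).1 h2]
  obtain ⟨x, w', rfl⟩ : ∃ x w', w = x :: w' := by
    cases w with
    | nil => simp at hw; omega
    | cons x w' => exact ⟨x, w', rfl⟩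
  obtain ⟨u, y, hu, hpath⟩ := exists_isPath x w' hmid
  have hl : Z.vertex x.l * φ (x :: w') = φ (x :: w') := by
    have := Z.vertex_mul_eq (i := x.l) (α := φ (x :: w')) (fun t => by
      rw [← Z.bimod_left_e q]
      exact hrel.left t x w') x.l
    rwa [if_pos rfl] at this
  have hr : φ (x :: w') * Z.vertex y.r = φ (x :: w') := by
    have := Z.mul_vertex_eq (i := y.r) (α := φ (x :: w')) (fun t => by
      rw [hu]
      exact hrel.right t u y) y.r
    rwa [if_pos rfl] at this
  obtain ⟨r, μ, h1, h2, h3⟩ := Z.exists_of_vertex_mul (hφ _) hl hr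
  have hdeg := Z.two_mul_wdeg hpath
  rw [hw] at hdeg
  have hS : q ≤ ((x :: w').map wt).sum := by
    rw [← hw]
    simpa using List.length_le_sum_of_one_le ((x :: w').map wt) fun i hi => by
      obtain ⟨y, hy, rfl⟩ := List.mem_map.1 hi
      exact hwt y hy
  -- A component of path length `s'` forces `N = 2`, `s' = 2` and path length `q` of the word.
  have key : ∀ s' : ℕ, s' ≤ 2 →
      2 * (Z.table.wdeg (x :: w') + 1) = N * s' + Z.p y.r - Z.p x.l →
      N = 2 ∧ s' = 2 ∧ ((x :: w').map wt).sum = q := by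
    intro s' hs' h
    generalize ((x :: w').map wt).sum = S at hdeg hS
    have h4 : (N : ℤ) * (S - s') = 2 * (q - 2) := by linarith
    have h5 : (q : ℤ) - 2 ≤ S - s' := by omega
    have h6 : N = 2 := by
      by_contra hne
      have h7 : (0 : ℤ) ≤ N - 3 := by omega
      have h8 : (0 : ℤ) ≤ S - s' := by omega
      have := mul_nonneg h7 h8
      rw [sub_mul, h4] at this
      omega
    subst h6
    push_cast at h4
    omega
  by_cases hr0 : r = 0
  · obtain ⟨z, hz⟩ : ∃ z, μ z ≠ 0 := by
      by_contra hall
      push Not at hall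
      simp [hr0, hall] at h1
      exact h0 h1
    have hkey : ∀ z, μ z ≠ 0 → N = 2 ∧ z.wt = 2 ∧ ((x :: w').map wt).sum = q := by
      intro z hz
      obtain ⟨hzl, hzr, hzd⟩ := h3 z hz
      refine key z.wt z.wt_le ?_
      rw [← hzd, Z.deg_eq, hzl, hzr]
    have hs : ∀ z, μ z ≠ 0 → z = s x.l ∧ x.l = y.r := by
      intro z hz
      have := (hkey z hz).2.1
      obtain ⟨hzl, hzr, -⟩ := h3 z hz
      cases z <;> simp [wt] at this
      rw [← hzl, ← hzr]
      exact ⟨rfl, rfl⟩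
    refine ⟨(hkey z hz).1, forall_wt_eq_one hwt ((hkey z hz).2.2.trans hw.symm), x.l, ?_,
      μ (s x.l), ?_⟩
    · rw [← (hs z hz).2] at hpath
      exact hpath
    · rw [h1, hr0, zero_smul, zero_add]
      refine Finset.sum_eq_single _ (fun z _ hne => ?_) (by simp)
      by_contra hz
      exact hne (hs z fun h => hz (by rw [h, zero_smul])).1
  · obtain ⟨hxy, hD⟩ := h2 hr0
    have := key 0 (by omega) (by rw [hD, hxy]; simp)
    omega

/-- The cochains which agree with a coboundary on the words of length `q`. -/
noncomputable def coboundaries (q : ℕ) : Submodule k (List (Letter m) → A) where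
  carrier := {φ | ∃ ψ, ∀ l, l.length = q → φ l = (Z.bimod q).hoch ψ l}
  zero_mem' := ⟨fun _ => 0, fun l _ => ((Z.bimod q).hoch_zero l).symm⟩
  add_mem' := by
    rintro φ φ' ⟨ψ, h⟩ ⟨ψ', h'⟩
    refine ⟨fun l => ψ l + ψ' l, fun l hl => ?_⟩
    rw [(Z.bimod q).hoch_add, ← h l hl, ← h' l hl]
    rfl
  smul_mem' := by
    rintro r φ ⟨ψ, h⟩
    refine ⟨fun l => r • ψ l, fun l hl => ?_⟩
    rw [Pi.smul_apply, h l hl]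
    exact (Z.bimod q).hoch_map (Z.bimod q) (r • LinearMap.id) (by simp) (by simp) ψ l

variable {Z} in
/-- For relative cochains, the words containing an idempotent may be ignored. -/
theorem mem_coboundaries_of_hoch {q : ℕ} {ψ φ : List (Letter m) → A}
    (hψ : Z.vertices.IsRelative (Z.bimod q) ψ) (hφ : ∀ l t, e t ∈ l → φ l = 0)
    (h : ∀ l, l.length = q → (∀ x ∈ l, 1 ≤ x.wt) → φ l = (Z.bimod q).hoch ψ l) :
    φ ∈ Z.coboundaries q := by
  refine ⟨ψ, fun l hl => ?_⟩
  by_cases ht : ∃ t, e t ∈ l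
  · obtain ⟨t, ht⟩ := ht
    rw [hφ l t ht]
    exact (hψ.hoch_eq_zero (t := t) ht).symm
  · exact h l hl fun x hx => one_le_wt fun t hxt => ht ⟨t, hxt ▸ hx⟩

/-- The cochain with value `α` on the word `w` and value zero on all other words. -/
def single (w : List (Letter m)) (α : A) (l : List (Letter m)) : A := if l = w then α else 0

theorem single_eq_zero_of_mem {w : List (Letter m)} {α : A} (hw : ∀ x ∈ w, 1 ≤ x.wt)
    (l : List (Letter m)) (t : Fin m) (ht : e t ∈ l) : single w α l = 0 := by
  refine if_neg fun h => ?_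
  subst h
  have := hw _ ht
  simp [wt] at this

theorem isRelative_single {q : ℕ} {w : List (Letter m)} {i j : Fin (m + 1)} {α : A}
    (hw0 : w ≠ []) (hw : ∀ x ∈ w, 1 ≤ x.wt) (hpath : IsPath i w j)
    (hl : ∀ t : Fin m, Z.β (e t) * α = if i = t.succ then α else 0)
    (hr : ∀ t : Fin m, α * Z.β (e t) = if j = t.succ then α else 0) :
    Z.vertices.IsRelative (Z.bimod q) (single w α) where
  normal l t ht := single_eq_zero_of_mem hw l t ht
  left t y l := by
    by_cases h : y :: l = w
    · subst h
      obtain ⟨rfl, -⟩ := hpath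
      rw [single, if_pos rfl]
      exact (Z.bimod_left_e q t α).trans (hl t)
    · rw [single, if_neg h, map_zero, ite_self]
  mid u x t y l := by
    by_cases h : u ++ x :: y :: l = w
    · subst h
      obtain ⟨v, -, -, h2, -⟩ := isPath_append.1 hpath
      have : Z.vertices.r x = Z.vertices.l y := h2.symm
      rw [this]
    · rw [single, if_neg h, ite_self, ite_self]
  right t l x := by
    by_cases h : l ++ [x] = w
    · subst h
      obtain ⟨v, -, -, h2⟩ := isPath_append.1 hpath
      obtain rfl : x.r = j := h2
      rw [single, if_pos rfl]
      exact hr t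
    · rw [single, if_neg h, map_zero, ite_self]
  nil t := by
    rw [single, if_neg hw0.symm, map_zero, map_zero]

theorem merge_single_eq_zero {w : List (Letter m)} {α : A} (hw : ∀ x ∈ w, x.wt = 1)
    {l : List (Letter m)} (hl : ∀ x ∈ l, 1 ≤ x.wt) : Z.table.merge l (single w α) = 0 := by
  induction l generalizing w with
  | nil => rfl
  | cons x l ih =>
    cases l with
    | nil => rfl
    | cons y l =>
      have h1 : ∀ z, Z.table.c x y z • single w α (z :: l) = 0 := by
        intro z
        by_cases h0 : Z.table.c x y z = 0
        · rw [h0, zero_smul]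
        · rw [single, if_neg, smul_zero]
          rintro rfl
          have h2 : z.wt = x.wt + y.wt := (coeff_ne_zero h0).1
          have h3 := hw z (by simp)
          have h4 := hl x (by simp)
          have h5 := hl y (by simp)
          omega
      rw [MulTable.merge, Finset.sum_eq_zero fun z _ => h1 z, zero_sub, neg_eq_zero]
      rcases w with _ | ⟨x', w⟩
      · simp [single, MulTable.merge_zero]
      · by_cases hx : x = x'
        · simp only [single, hx, List.cons.injEq, true_and]
          exact ih (w := w) (fun z hz => hw z (List.mem_cons_of_mem _ hz))
            fun z hz => hl z (List.mem_cons_of_mem _ hz)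
        · simp [single, hx, MulTable.merge_zero]

/-- The differential of the cochain with a socle element on a word starting with the same socle
element. -/
theorem hoch_single_socle {q : ℕ} {w : List (Letter m)} (hw : ∀ x ∈ w, x.wt = 1) (v : Fin (m + 1))
    {x y : Letter m} {l : List (Letter m)} (hl : ∀ z ∈ x :: y :: l, 1 ≤ z.wt) :
    (Z.bimod q).hoch (single (s v :: w) (Z.β (s v))) (x :: y :: l) =
      - Z.table.c x y (s v) • single w (Z.β (s v)) l := by
  have hmul : ∀ z ∈ x :: y :: l, Z.β z * Z.β (s v) = 0 ∧ Z.β (s v) * Z.β z = 0 := by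
    intro z hz
    have := hl z hz
    exact ⟨Z.mul_eq_zero (show 2 < z.wt + 2 by omega), Z.mul_eq_zero (show 2 < 2 + z.wt by omega)⟩
  have h1 : (Z.bimod q).left x (single (s v :: w) (Z.β (s v)) (y :: l)) = 0 := by
    rw [bimod_left, single, mul_ite, (hmul x (by simp)).1, mul_zero, ite_self, smul_zero]
  have h2 : (Z.bimod q).last (x :: y :: l) (single (s v :: w) (Z.β (s v))) = 0 := by
    obtain ⟨t, z, h⟩ : ∃ t z, x :: y :: l = t ++ [z] :=
      ⟨_, _, (List.dropLast_append_getLast (List.cons_ne_nil x (y :: l))).symm⟩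
    rw [h, MulTable.Bimod.last_append, bimod_right, single, ite_mul,
      (hmul z (by simp [h])).2, zero_mul, ite_self, smul_zero]
  have h3 : Z.table.merge (y :: l) (fun t => single (s v :: w) (Z.β (s v)) (x :: t)) = 0 := by
    by_cases hx : x = s v
    · simp only [single, hx, List.cons.injEq, true_and]
      exact Z.merge_single_eq_zero hw fun z hz => hl z (List.mem_cons_of_mem _ hz)
    · simp [single, hx, MulTable.merge_zero]
  rw [MulTable.Bimod.hoch, h1, h2, MulTable.merge, h3, sub_zero, sub_zero, zero_sub, neg_smul]
  congr 1
  rw [Finset.sum_eq_single (s v)]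
  · simp [single]
  · intro z _ hz
    simp [single, hz]
  · simp

/-- Two successive basis elements with product a multiple of the socle element of `v` turn around at
one of the neighbours of `v`. -/
theorem coeff_socle {c d : Fin m → k} {x y : Letter m} (hx : 1 ≤ x.wt) (hy : 1 ≤ y.wt)
    {v : Fin (m + 1)} : coeff c d x y (s v) =
      (∑ i, if x = up i ∧ y = dn i ∧ v = i.castSucc then c i else 0) +
      ∑ i, if x = dn i ∧ y = up i ∧ v = i.succ then d i else 0 := by
  cases x <;> cases y <;> simp [wt] at hx hy <;> simp [coeff]
  · rename_i i j
    rw [Finset.sum_eq_single i (by intro b _ hb; simp [hb.symm]) (by simp)]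
    simp [eq_comm]
  · rename_i i j
    rw [Finset.sum_eq_single i (by intro b _ hb; simp [hb.symm]) (by simp)]
    simp [eq_comm]

/-- The indicator of a walk which starts and ends at `v`, with value the socle element of `v`. -/
def closed (v : Fin (m + 1)) (w : List (Letter m)) : List (Letter m) → A := single w (Z.β (s v))

theorem closed_eq_zero_of_mem {v : Fin (m + 1)} {w : List (Letter m)} (hw : ∀ x ∈ w, 1 ≤ x.wt)
    (l : List (Letter m)) (t : Fin m) (ht : e t ∈ l) : Z.closed v w l = 0 :=
  single_eq_zero_of_mem hw l t ht

/-- At a walk starting with the peak `v, v + 1, v`, the peak may be replaced by `v, v - 1, v`; for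
`v = 0` the indicator of the walk is a coboundary. -/
theorem closed_up_dn_mem {q : ℕ} {i : Fin m} {w : List (Letter m)} (hw : ∀ x ∈ w, x.wt = 1)
    (hpath : IsPath i.castSucc w i.castSucc)
    (h : ∀ j : Fin m, i.castSucc = j.succ →
      Z.closed i.castSucc (dn j :: up j :: w) ∈ Z.coboundaries q) :
    Z.closed i.castSucc (up i :: dn i :: w) ∈ Z.coboundaries q := by
  have hw' : ∀ x ∈ s i.castSucc :: w, 1 ≤ x.wt := by
    intro x hx
    rcases List.mem_cons.1 hx with rfl | hx
    · simp [wt]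
    · exact (hw x hx).ge
  have hrel : Z.vertices.IsRelative (Z.bimod q) (single (s i.castSucc :: w) (Z.β (s i.castSucc))) :=
    Z.isRelative_single (List.cons_ne_nil _ _) hw' ⟨rfl, hpath⟩ (fun t => Z.e_mul t _)
      fun t => Z.mul_e _ t
  -- The sum over the lower neighbour, which is absent for `v = 0`.
  let R : List (Letter m) → A :=
    ∑ j, if i.castSucc = j.succ then Z.dn_up j • Z.closed i.castSucc (dn j :: up j :: w) else 0
  have hR : R ∈ Z.coboundaries q := Submodule.sum_mem _ fun j _ => by
    split_ifs with hj
    · exact Submodule.smul_mem _ _ (h j hj)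
    · exact Submodule.zero_mem _
  have hmain : Z.up_dn i • Z.closed i.castSucc (up i :: dn i :: w) + R ∈ Z.coboundaries q := by
    rw [← Submodule.neg_mem_iff]
    refine mem_coboundaries_of_hoch hrel (fun l t ht => ?_) fun l hl hlw => ?_
    · simp only [R, Pi.neg_apply, Pi.add_apply, Pi.smul_apply, Finset.sum_apply]
      rw [closed_eq_zero_of_mem Z _ l t ht, Finset.sum_eq_zero]
      · simp
      · intro j _
        split_ifs
        · rw [Pi.smul_apply, closed_eq_zero_of_mem Z _ l t ht, smul_zero]
          intro x hx
          simp only [List.mem_cons] at hx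
          rcases hx with rfl | rfl | hx
          · simp [wt]
          · simp [wt]
          · exact (hw x hx).ge
        · rfl
      · intro x hx
        simp only [List.mem_cons] at hx
        rcases hx with rfl | rfl | hx
        · simp [wt]
        · simp [wt]
        · exact (hw x hx).ge
    · rcases l with _ | ⟨x, _ | ⟨y, l⟩⟩
      · simp [R, closed, single, MulTable.Bimod.hoch, ite_apply]
      · have : single (s i.castSucc :: w) (Z.β (s i.castSucc)) [] = 0 := by simp [single]
        simp [R, closed, single, MulTable.Bimod.hoch, MulTable.merge, MulTable.Bimod.last,
          ite_apply]
      · rw [Z.hoch_single_socle hw _ hlw]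
        have hc : Z.table.c x y (s i.castSucc) = _ :=
          coeff_socle (hlw x (by simp)) (hlw y (by simp))
        rw [hc, neg_smul, Pi.neg_apply, neg_inj, add_smul, Finset.sum_smul, Finset.sum_smul,
          Pi.add_apply, Pi.smul_apply]
        congr 1
        · rw [Finset.sum_eq_single i]
          · simp only [closed, single, List.cons.injEq, and_true, smul_ite, smul_zero, ite_smul,
              zero_smul]
            by_cases h1 : x = up i <;> by_cases h2 : y = dn i <;> simp [h1, h2]
          · intro j _ hj
            rw [if_neg, zero_smul]
            rintro ⟨-, -, h3⟩
            exact hj (Fin.castSucc_injective _ h3).symm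
          · simp
        · refine (Finset.sum_apply _ _ _).trans (Finset.sum_congr rfl fun j _ => ?_)
          by_cases h1 : x = dn j <;> by_cases h2 : y = up j <;>
            by_cases h3 : i.castSucc = j.succ <;> simp [h1, h2, h3, closed, single]
  have h4 := (Submodule.add_mem_iff_left _ hR).1 hmain
  have h5 := Submodule.smul_mem _ (Z.up_dn i)⁻¹ h4
  rwa [smul_smul, inv_mul_cancel₀ (Z.up_dn_ne i), one_smul] at h5

/-- The reversed edge. -/
def _root_.Letter.rev : Letter m → Letter m
  | up i => dn i
  | dn i => up i
  | x => x

theorem rev_l {x : Letter m} : x.rev.l = x.r := by cases x <;> rfl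

theorem rev_r {x : Letter m} : x.rev.r = x.l := by cases x <;> rfl

theorem exists_mul_rev {x : Letter m} (hx : x.wt = 1) : ∃ c : k, c ≠ 0 ∧
    ∀ y : Letter m, 1 ≤ y.wt → Z.β y * Z.β x.rev = if y = x then c • Z.β (s x.l) else 0 := by
  cases x with
  | e t => simp [wt] at hx
  | s v => simp [wt] at hx
  | up i =>
    refine ⟨Z.up_dn i, Z.up_dn_ne i, fun y hy => ?_⟩
    split_ifs with h
    · rw [h]
      exact Z.up_mul_dn i
    · rw [Z.mul]
      refine Finset.sum_eq_zero fun z _ => ?_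
      cases y <;> simp_all [rev, coeff, wt]
  | dn i =>
    refine ⟨Z.dn_up i, Z.dn_up_ne i, fun y hy => ?_⟩
    split_ifs with h
    · rw [h]
      exact Z.dn_mul_up i
    · rw [Z.mul]
      refine Finset.sum_eq_zero fun z _ => ?_
      cases y <;> simp_all [rev, coeff, wt]

theorem exists_rev_mul {x : Letter m} (hx : x.wt = 1) : ∃ c : k,
    ∀ y : Letter m, 1 ≤ y.wt → Z.β x.rev * Z.β y = if y = x then c • Z.β (s x.r) else 0 := by
  cases x with
  | e t => simp [wt] at hx
  | s v => simp [wt] at hx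
  | up i =>
    refine ⟨Z.dn_up i, fun y hy => ?_⟩
    split_ifs with h
    · rw [h]
      exact Z.dn_mul_up i
    · rw [Z.mul]
      refine Finset.sum_eq_zero fun z _ => ?_
      cases y <;> simp_all [rev, coeff, wt, eq_comm]
  | dn i =>
    refine ⟨Z.up_dn i, fun y hy => ?_⟩
    split_ifs with h
    · rw [h]
      exact Z.up_mul_dn i
    · rw [Z.mul]
      refine Finset.sum_eq_zero fun z _ => ?_
      cases y <;> simp_all [rev, coeff, wt, eq_comm]

/-- A closed walk may be rotated by one step. The primitive takes the value `x.rev` on the rest of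
the walk. -/
theorem closed_cons_mem {q : ℕ} {x : Letter m} {w : List (Letter m)} (hw0 : w ≠ [])
    (hx : x.wt = 1) (hw : ∀ y ∈ w, y.wt = 1) (hpath : IsPath x.r w x.l)
    (h : Z.closed x.r (w ++ [x]) ∈ Z.coboundaries q) :
    Z.closed x.l (x :: w) ∈ Z.coboundaries q := by
  obtain ⟨c, hc, hc'⟩ := Z.exists_mul_rev hx
  obtain ⟨d, hd⟩ := Z.exists_rev_mul hx
  have hrel : Z.vertices.IsRelative (Z.bimod q) (single w (Z.β x.rev)) :=
    Z.isRelative_single hw0 (fun y hy => (hw y hy).ge) hpath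
      (fun t => by rw [Z.e_mul, rev_l]) fun t => by rw [Z.mul_e, rev_r]
  have hwt : ∀ y ∈ x :: w, 1 ≤ y.wt := by
    intro y hy
    rcases List.mem_cons.1 hy with rfl | hy
    · exact hx.ge
    · exact (hw y hy).ge
  have hmain : (Z.table.eps x ^ q * c) • Z.closed x.l (x :: w) -
      ((-1) ^ w.length * d) • Z.closed x.r (w ++ [x]) ∈ Z.coboundaries q := by
    refine mem_coboundaries_of_hoch hrel (fun l t ht => ?_) fun l hl hlw => ?_
    · simp only [Pi.sub_apply, Pi.smul_apply]
      rw [Z.closed_eq_zero_of_mem hwt l t ht, Z.closed_eq_zero_of_mem _ l t ht, smul_zero,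
        smul_zero, sub_zero]
      intro y hy
      exact hwt y (by simpa [or_comm] using hy)
    · rcases l with _ | ⟨y, l⟩
      · simp [closed, single, MulTable.Bimod.hoch]
      · rw [MulTable.Bimod.hoch, Z.merge_single_eq_zero hw hlw, sub_zero, Pi.sub_apply]
        congr 1
        · rw [bimod_left, Pi.smul_apply, closed, single, single]
          by_cases h1 : l = w
          · rw [if_pos h1, hc' y (hlw y (by simp))]
            by_cases h2 : y = x
            · simp [h1, h2, smul_smul]
            · simp [h2]
          · simp [h1]
        · obtain ⟨t, z, h⟩ : ∃ t z, y :: l = t ++ [z] :=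
            ⟨_, _, (List.dropLast_append_getLast (List.cons_ne_nil y l)).symm⟩
          rw [h, MulTable.Bimod.last_append, bimod_right, Pi.smul_apply, closed, single, single]
          by_cases h1 : t = w
          · rw [if_pos h1, hd z (hlw z (by simp [h]))]
            by_cases h2 : z = x
            · simp [h1, h2, smul_smul]
            · simp [h1, h2]
          · have : ¬ t ++ [z] = w ++ [x] := fun h3 => h1 (List.append_inj_left' h3 rfl)
            simp [h1, this]
  have h4 := (Submodule.sub_mem_iff_left _ (Submodule.smul_mem _ _ h)).1 hmain
  have hne : Z.table.eps x ^ q * c ≠ 0 := by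
    refine mul_ne_zero (pow_ne_zero _ fun h0 => ?_) hc
    have := Z.table.eps_mul_self x
    simp [h0] at this
  have h5 := Submodule.smul_mem _ (Z.table.eps x ^ q * c)⁻¹ h4
  rwa [smul_smul, inv_mul_cancel₀ hne, one_smul] at h5

/-- A closed walk may be rotated by several steps. -/
theorem closed_append_mem {q : ℕ} {u w : List (Letter m)} {v v' : Fin (m + 1)}
    (hlen : 2 ≤ (u ++ w).length) (hw : ∀ y ∈ u ++ w, y.wt = 1) (hu : IsPath v u v')
    (hpath : IsPath v' w v) (h : Z.closed v' (w ++ u) ∈ Z.coboundaries q) :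
    Z.closed v (u ++ w) ∈ Z.coboundaries q := by
  induction u generalizing v w with
  | nil =>
    obtain rfl : v = v' := hu
    simpa using h
  | cons x u ih =>
    obtain ⟨rfl, hu⟩ := hu
    have hne : u ++ w ≠ [] := by
      intro h0
      simp [List.append_eq_nil_iff.1 h0] at hlen
    rw [List.cons_append]
    refine Z.closed_cons_mem hne (hw x (by simp)) (fun y hy => hw y (List.mem_cons_of_mem _ hy))
      (isPath_append.2 ⟨v', hu, hpath⟩) ?_
    rw [List.append_assoc]
    refine ih ?_ (fun y hy => hw y (by simp at hy ⊢; tauto)) hu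
      (isPath_append.2 ⟨x.l, hpath, rfl, rfl⟩) (by simpa using h)
    simp at hlen ⊢
    omega

end ZigzagBasis

namespace Letter

variable {m : ℕ}

/-- A path of edges which starts with a step up and contains a step down has a peak. -/
theorem exists_peak (i : Fin m) {w : List (Letter m)} {v v' : Fin (m + 1)}
    (hw : ∀ y ∈ w, y.wt = 1) (hpath : IsPath v (up i :: w) v') (hdn : ∃ j, dn j ∈ w) :
    ∃ u j t, up i :: w = u ++ up j :: dn j :: t := by
  induction w generalizing i v with
  | nil => simp at hdn
  | cons y w ih =>
    obtain ⟨-, h1, h2⟩ := hpath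
    cases y with
    | e t => simpa [wt] using hw (e t) (by simp)
    | s v => simpa [wt] using hw (s v) (by simp)
    | up j =>
      obtain ⟨u, j', t, h⟩ := ih j (fun y hy => hw y (List.mem_cons_of_mem _ hy))
        (v := j.castSucc) ⟨rfl, h2⟩ (by simpa using hdn)
      exact ⟨up i :: u, j', t, by rw [h]; rfl⟩
    | dn j =>
      obtain rfl : j = i := Fin.succ_injective _ h1
      exact ⟨[], j, w, rfl⟩

theorem exists_dn {w : List (Letter m)} {v v' : Fin (m + 1)} (hw0 : w ≠ [])
    (hw : ∀ y ∈ w, y.wt = 1) (hpath : IsPath v w v') (h : v' ≤ v) : ∃ j, dn j ∈ w := by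
  induction w generalizing v with
  | nil => simp at hw0
  | cons y w ih =>
    obtain ⟨rfl, h2⟩ := hpath
    cases y with
    | e t => simpa [wt] using hw (e t) (by simp)
    | s v => simpa [wt] using hw (s v) (by simp)
    | dn j => exact ⟨j, List.mem_cons_self⟩
    | up j =>
      have hlt : v' < j.succ := lt_of_le_of_lt h (Fin.castSucc_lt_succ)
      obtain ⟨j', hj'⟩ := ih (by rintro rfl; exact hlt.ne' h2)
        (fun y hy => hw y (List.mem_cons_of_mem _ hy)) h2 hlt.le
      exact ⟨j', List.mem_cons_of_mem _ hj'⟩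

theorem exists_up {w : List (Letter m)} {v v' : Fin (m + 1)} (hw0 : w ≠ [])
    (hw : ∀ y ∈ w, y.wt = 1) (hpath : IsPath v w v') (h : v ≤ v') : ∃ j, up j ∈ w := by
  induction w generalizing v with
  | nil => simp at hw0
  | cons y w ih =>
    obtain ⟨rfl, h2⟩ := hpath
    cases y with
    | e t => simpa [wt] using hw (e t) (by simp)
    | s v => simpa [wt] using hw (s v) (by simp)
    | up j => exact ⟨j, List.mem_cons_self⟩
    | dn j =>
      have hlt : j.castSucc < v' := lt_of_lt_of_le (Fin.castSucc_lt_succ) h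
      obtain ⟨j', hj'⟩ := ih (by rintro rfl; exact hlt.ne h2)
        (fun y hy => hw y (List.mem_cons_of_mem _ hy)) h2 hlt.le
      exact ⟨j', List.mem_cons_of_mem _ hj'⟩

end Letter

namespace ZigzagBasis

open Letter

variable {k : Type u} [Field k] {A : Type a} [Ring A] [Algebra k A]
  {𝒜 : ℤ → Submodule k A} {N m : ℕ} (Z : ZigzagBasis 𝒜 N m)

/-- The indicator of a closed walk is a coboundary: rotate the walk so that it starts with a peak,
and push the peak down. This decreases the sum of the heights of the walk. -/
theorem closed_mem_coboundaries {q : ℕ} {w : List (Letter m)} {v : Fin (m + 1)}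
    (hlen : 2 ≤ w.length) (hw : ∀ y ∈ w, y.wt = 1) (hpath : IsPath v w v) :
    Z.closed v w ∈ Z.coboundaries q := by
  obtain ⟨n, hn⟩ : ∃ n, (w.map fun x => (x.l : ℕ)).sum = n := ⟨_, rfl⟩
  induction n using Nat.strong_induction_on generalizing w v with
  | _ n ih =>
    have hw0 : w ≠ [] := by rintro rfl; simp at hlen
    obtain ⟨i₀, h1⟩ := exists_up hw0 hw hpath le_rfl
    obtain ⟨j₀, h2⟩ := exists_dn hw0 hw hpath le_rfl
    obtain ⟨u, t, rfl⟩ := List.append_of_mem h1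
    obtain ⟨v₁, hu, hv₁⟩ := isPath_append.1 hpath
    refine Z.closed_append_mem hlen hw hu hv₁ ?_
    have hpath₁ : IsPath v₁ (up i₀ :: (t ++ u)) v₁ := isPath_append.2 ⟨v, hv₁, hu⟩
    obtain ⟨u', i, t', h3⟩ := exists_peak i₀ (w := t ++ u)
      (fun y hy => hw y (by simp at hy ⊢; tauto)) hpath₁ ⟨j₀, by simp at h2 ⊢; tauto⟩
    have hperm : (u ++ up i₀ :: t).Perm (up i :: dn i :: (t' ++ u')) := by
      refine List.perm_append_comm.trans ?_
      rw [List.cons_append, h3]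
      exact List.perm_append_comm
    have hw' : ∀ y ∈ up i :: dn i :: (t' ++ u'), y.wt = 1 := fun y hy => hw y (hperm.mem_iff.2 hy)
    rw [List.cons_append, h3]
    rw [h3] at hpath₁
    obtain ⟨v₂, hu', hv₂⟩ := isPath_append.1 hpath₁
    refine Z.closed_append_mem (by rw [← h3]; simp at hlen ⊢; omega)
      (fun y hy => hw' y (by simp at hy ⊢; tauto)) hu' hv₂ ?_
    obtain ⟨rfl, -, hv₂⟩ := hv₂
    have hpath₂ : IsPath i.castSucc (t' ++ u') i.castSucc := isPath_append.2 ⟨_, hv₂, hu'⟩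
    refine Z.closed_up_dn_mem (fun y hy => hw' y (by simp at hy ⊢; tauto)) hpath₂ fun j hj => ?_
    have hsum := (hperm.map fun x => (x.l : ℕ)).sum_eq
    rw [hn] at hsum
    refine ih _ ?_ (by simp) (fun y hy => ?_) ⟨hj.symm, rfl, ?_⟩ rfl
    · have hj' := congrArg Fin.val hj
      simp [l] at hsum hj' ⊢
      omega
    · simp only [List.mem_cons] at hy
      rcases hy with rfl | rfl | hy
      · rfl
      · rfl
      · exact hw' y (by simp at hy ⊢; tauto)
    · change IsPath j.succ _ _
      rw [← hj]
      exact hpath₂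

/-- Intrinsic formality at the level of Hochschild cohomology: there is no obstruction to lifting a
zigzag basis. -/
theorem hochschildVanishing [GradedAlgebra 𝒜] (hN : 2 ≤ N) :
    Z.table.HochschildVanishing 𝒜 Z.β := by
  refine Z.table.hochschildVanishing_of_relative Z.mul Z.mem Z.vertices ?_
  intro q hq φ _ hφ hrel _
  have hmem : ∀ w : List.Vector (Letter m) q, single w.1 (φ w.1) ∈ Z.coboundaries q := by
    rintro ⟨w, hw⟩
    by_cases h0 : φ w = 0
    · have : single w (φ w) = 0 := by funext l; simp [single, h0]
      rw [this]
      exact Submodule.zero_mem _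
    · obtain ⟨-, h1, v, h2, μ, h3⟩ := Z.support_of_isRelative hN hq hφ hrel hw h0
      have : single w (φ w) = μ • Z.closed v w := by funext l; simp [single, closed, h3]
      rw [this]
      exact Submodule.smul_mem _ _ (Z.closed_mem_coboundaries (by omega) h1 h2)
  obtain ⟨ψ, hψ⟩ := Submodule.sum_mem _ fun w (_ : w ∈ Finset.univ) => hmem w
  refine ⟨ψ, fun l hl => (Eq.trans ?_ (hψ l hl))⟩
  rw [Finset.sum_apply, Finset.sum_eq_single ⟨l, hl⟩]
  · simp [single]
  · intro w _ hne
    exact if_neg fun h => hne (Subtype.ext h.symm)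
  · exact fun h => absurd (Finset.mem_univ _) h

end ZigzagBasis

/-! ### Algebras with a zigzag basis are intrinsically formal -/

namespace DGAlgebra

variable {k : Type u} [Field k]

/-- A graded algebra is the cohomology of itself, with the zero differential. -/
theorem hasCohomology_ofGraded {A : Type a} [Ring A] [Algebra k A] (𝒜 : ℤ → Submodule k A)
    [GradedAlgebra 𝒜] : (ofGraded 𝒜).HasCohomology 𝒜 := by
  let C := ofGraded 𝒜
  have h0 : ∀ z ∈ C.coboundaries, C.cocycles.val z = 0 := by
    rintro z ⟨y, hy⟩
    exact hy.symm
  let f : C.Cohomology →ₐ[k] C.carrier := Ideal.Quotient.liftₐ C.coboundaries C.cocycles.val h0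
  have hf : ∀ z : C.cocycles, f (Ideal.Quotient.mkₐ k C.coboundaries z) = z := fun z => rfl
  have hbij : Function.Bijective f := by
    refine ⟨(injective_iff_map_eq_zero f).2 fun x hx => ?_, fun y => ?_⟩
    · obtain ⟨z, rfl⟩ := Ideal.Quotient.mkₐ_surjective k _ x
      rw [hf] at hx
      obtain rfl : z = 0 := Subtype.ext hx
      exact map_zero _
    · exact ⟨Ideal.Quotient.mkₐ k C.coboundaries ⟨y, rfl⟩, rfl⟩
  refine ⟨AlgEquiv.ofBijective f hbij, fun m => ?_⟩
  ext y
  constructor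
  · rintro ⟨_, ⟨z, hz, rfl⟩, rfl⟩
    exact hz
  · intro hy
    exact ⟨_, ⟨⟨y, rfl⟩, hy, rfl⟩, rfl⟩

/-- The dg algebra obtained by lifting the underlying type to a larger universe. -/
def ulift (B : DGAlgebra.{u, a} k) : DGAlgebra.{u, max a b} k where
  carrier := ULift.{b} B.carrier
  gr m := (B.gr m).comap (ULift.moduleEquiv (R := k)).toLinearMap
  graded :=
    { one_mem := SetLike.GradedOne.one_mem (A := B.gr)
      mul_mem := fun _ _ _ _ hx hy => SetLike.GradedMul.mul_mem (A := B.gr) hx hy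
      toDecomposition := Decomposition.ofLinearMap _
        (DirectSum.lmap (fun m => (ULift.moduleEquiv (R := k)).symm.toLinearMap.restrict
            (p := B.gr m) (q := (B.gr m).comap (ULift.moduleEquiv (R := k)).toLinearMap)
            fun x hx => hx) ∘ₗ
          (decomposeLinearEquiv B.gr).toLinearMap ∘ₗ (ULift.moduleEquiv (R := k)).toLinearMap)
        (by
          have h : (ULift.moduleEquiv (R := k)).toLinearMap ∘ₗ coeLinearMap (fun m =>
              (B.gr m).comap (ULift.moduleEquiv.{_, _, b} (R := k)).toLinearMap) ∘ₗ
              DirectSum.lmap (fun m => (ULift.moduleEquiv (R := k)).symm.toLinearMap.restrict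
                (p := B.gr m) (q := (B.gr m).comap (ULift.moduleEquiv (R := k)).toLinearMap)
                fun x hx => hx) = coeLinearMap B.gr := by
            ext m x : 2
            simp [lmap_lof, coeLinearMap_lof]
            rfl
          refine LinearMap.ext fun x => ULift.ext _ _ ?_
          exact (LinearMap.congr_fun h (decompose B.gr x.down)).trans
            (Decomposition.left_inv x.down))
        (by
          ext m x : 2
          have h : decompose B.gr (x : ULift.{b} B.carrier).down =
              lof k ℤ (fun m => B.gr m) m ⟨(x : ULift.{b} B.carrier).down, x.2⟩ :=
            decompose_of_mem B.gr x.2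
          simp only [LinearMap.comp_apply, coeLinearMap_lof, LinearMap.id_apply]
          change DirectSum.lmap _ (decompose B.gr (x : ULift.{b} B.carrier).down) = _
          rw [h, lmap_lof]
          rfl) }
  d := (ULift.moduleEquiv (R := k)).symm.toLinearMap ∘ₗ B.d ∘ₗ
    (ULift.moduleEquiv (R := k)).toLinearMap
  d_mem m x hx := B.d_mem m _ hx
  d_d x := ULift.ext _ _ (B.d_d _)
  leibniz m x y hx := ULift.ext _ _ (B.leibniz m x.down y.down hx)

/-- The projection from the lift of a dg algebra to a larger universe. -/
def uliftDown (B : DGAlgebra.{u, a} k) : Hom (ulift.{u, a, b} B) B where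
  toAlgHom := ULift.algEquiv.toAlgHom
  map_gr _ _ hx := hx
  map_d _ := rfl

/-- The unit of an acyclic dg algebra is a coboundary. -/
theorem exists_d_eq_one {B : DGAlgebra.{u, a} k} [Subsingleton B.Cohomology] :
    ∃ y, B.d y = 1 := by
  have h : Ideal.Quotient.mk B.coboundaries 1 = 0 := Subsingleton.elim _ _
  exact Ideal.Quotient.eq_zero_iff_mem.1 h

theorem subsingleton_cohomology {B : DGAlgebra.{u, a} k} {y : B.carrier} (h : B.d y = 1) :
    Subsingleton B.Cohomology :=
  Ideal.Quotient.subsingleton_iff.2 <| (Ideal.eq_top_iff_one _).2 ⟨y, h⟩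

end DGAlgebra

/-- The zero algebra is intrinsically formal. -/
theorem isIntrinsicallyFormal_of_subsingleton {k : Type u} [Field k] {A : Type a} [Ring A]
    [Algebra k A] [Subsingleton A] (𝒜 : ℤ → Submodule k A) [GradedAlgebra 𝒜] :
    IsIntrinsicallyFormal.{u, a, b} k 𝒜 := by
  rintro B ⟨e, -⟩
  have hB : Subsingleton B.Cohomology := e.injective.subsingleton
  obtain ⟨y, hy⟩ := DGAlgebra.exists_d_eq_one (B := B)
  let D : DGAlgebra.{u, max u b a} k := DGAlgebra.ulift.{u, b, max u a} B
  have hD : Subsingleton D.Cohomology :=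
    DGAlgebra.subsingleton_cohomology (y := ULift.up y) (ULift.ext _ _ hy)
  have hA : Subsingleton (DGAlgebra.ofGraded 𝒜).Cohomology :=
    DGAlgebra.subsingleton_cohomology (y := (0 : A)) (Subsingleton.elim (α := A) _ _)
  have hA' : Subsingleton (DGAlgebra.ofGraded 𝒜).carrier := ‹Subsingleton A›
  let g : DGAlgebra.Hom D (DGAlgebra.ofGraded 𝒜) :=
    { toAlgHom := AlgHom.ofLinearMap 0 (Subsingleton.elim _ _) fun _ _ => Subsingleton.elim _ _
      map_gr := fun m _ _ => Submodule.zero_mem ((DGAlgebra.ofGraded 𝒜).gr m)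
      map_d := fun _ => Subsingleton.elim _ _ }
  exact ⟨D, DGAlgebra.uliftDown B, g,
    ⟨fun _ _ _ => Subsingleton.elim _ _, fun _ => ⟨0, Subsingleton.elim _ _⟩⟩,
    ⟨fun _ _ _ => Subsingleton.elim _ _, fun _ => ⟨0, Subsingleton.elim _ _⟩⟩⟩

namespace ZigzagBasis

variable {k : Type u} [Field k] {A : Type a} [Ring A] [Algebra k A]
  {𝒜 : ℤ → Submodule k A} [GradedAlgebra 𝒜] {N m : ℕ} (Z : ZigzagBasis 𝒜 N m)

/-- The cobar construction maps quasi-isomorphically to every dg algebra with the given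
cohomology. -/
theorem exists_quasiIso (hN : 2 ≤ N) {C : DGAlgebra.{u, b} k} (hC : C.HasCohomology 𝒜) :
    ∃ Φ : DGAlgebra.Hom (MulTable.cobar.{u, w} Z.table) C, Φ.IsQuasiIso := by
  obtain ⟨e, he⟩ := hC
  obtain ⟨f, hf⟩ := Z.table.exists_twisting e he (Z.hochschildVanishing hN) Z.mem Z.mul
  obtain ⟨Φ, hΦ⟩ := Z.table.exists_hom_of_twisting e hf
  exact ⟨Φ, Z.table.isQuasiIso_of_classes Z.β e Z.span Z.ind Φ hΦ⟩

include Z in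
/-- A graded algebra with a zigzag basis is intrinsically formal: both legs of the roof start at the
cobar construction. -/
theorem isIntrinsicallyFormal (hN : 2 ≤ N) : IsIntrinsicallyFormal.{u, a, b} k 𝒜 := by
  intro B hB
  obtain ⟨f, hf⟩ := exists_quasiIso.{u, max a b, a, b} Z hN hB
  obtain ⟨g, hg⟩ := exists_quasiIso.{u, max a b, a, a} Z hN (DGAlgebra.hasCohomology_ofGraded 𝒜)
  exact ⟨_, f, g, hf, hg⟩

end ZigzagBasis

/-! ### Elements of the Ext-algebra -/

section LinearAlgebra

variable {k : Type u} [Field k]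

theorem exists_smul_eq_of_rank_eq_one {V : Type v} [AddCommGroup V] [Module k V]
    (h : Module.rank k V = 1) {x : V} (hx : x ≠ 0) (y : V) : ∃ c : k, y = c • x := by
  have h1 : Module.finrank k V = 1 := Module.finrank_eq_of_rank_eq (by simpa using h)
  obtain ⟨c, hc⟩ := (finrank_eq_one_iff_of_nonzero' x hx).1 h1 y
  exact ⟨c, hc.symm⟩

/-- In a family of vector spaces of total dimension one, exactly one member is nonzero. -/
theorem exists_of_sum_rank_eq_one {ι : Type} {V : ι → Type v} [∀ i, AddCommGroup (V i)]
    [∀ i, Module k (V i)] (h : Cardinal.sum (fun i => Module.rank k (V i)) = 1) :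
    ∃ i, Module.rank k (V i) = 1 ∧ ∀ j, j ≠ i → Subsingleton (V j) := by
  have h1 : Cardinal.mk (Σ i, (Module.rank k (V i)).out) = 1 := by
    rw [Cardinal.mk_sigma]
    simpa using h
  obtain ⟨hs, ⟨i, x⟩⟩ := Cardinal.eq_one_iff_unique.1 h1
  refine ⟨i, le_antisymm ((Cardinal.le_sum _ i).trans h.le) ?_, fun j hj => ?_⟩
  · rw [Cardinal.one_le_iff_ne_zero, ← Cardinal.mk_out (Module.rank k (V i)),
      Cardinal.mk_ne_zero_iff]
    exact ⟨x⟩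
  · rw [← rank_zero_iff (R := k), ← Cardinal.mk_out (Module.rank k (V j)),
      Cardinal.mk_eq_zero_iff]
    exact ⟨fun y => hj (congrArg Sigma.fst (hs.elim ⟨j, y⟩ ⟨i, x⟩))⟩

theorem subsingleton_of_sum_rank_eq_zero {ι : Type} {V : ι → Type v} [∀ i, AddCommGroup (V i)]
    [∀ i, Module k (V i)] (h : Cardinal.sum (fun i => Module.rank k (V i)) = 0) (i : ι) :
    Subsingleton (V i) := by
  rw [← rank_zero_iff (R := k)]
  exact le_antisymm ((Cardinal.le_sum _ i).trans h.le) zero_le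

end LinearAlgebra

namespace ExtPiece

variable (k : Type u) [Field k] {T : Type w} [Category.{v} T] [Preadditive T] [Linear k T]
  [HasShift T ℤ] {n : ℕ} (F : Fin n → T)

/-- The matrix with a single entry. -/
noncomputable def single (i j : Fin n) (d : ℤ) : ShiftedHom (F i) (F j) d →ₗ[k] ExtPiece F d :=
  (LinearMap.single k (fun i => ∀ j, ShiftedHom (F i) (F j) d) i ∘ₗ
    LinearMap.single k (fun j => ShiftedHom (F i) (F j) d) j :
    ShiftedHom (F i) (F j) d →ₗ[k] ∀ i j, ShiftedHom (F i) (F j) d)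

theorem single_same (i j : Fin n) (d : ℤ) (x : ShiftedHom (F i) (F j) d) :
    single k F i j d x i j = x := by
  change (Pi.single i (Pi.single j x) : ∀ i j, ShiftedHom (F i) (F j) d) i j = x
  simp

theorem single_ne {i j i' j' : Fin n} {d : ℤ} (x : ShiftedHom (F i) (F j) d)
    (h : i' = i → j' ≠ j) : single k F i j d x i' j' = 0 := by
  change (Pi.single i (Pi.single j x) : ∀ i j, ShiftedHom (F i) (F j) d) i' j' = 0
  by_cases hi : i' = i
  · subst hi
    simp [h rfl]
  · simp [hi]

theorem eq_sum_single {d : ℤ} (x : ExtPiece F d) : x = ∑ i, ∑ j, single k F i j d (x i j) := by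
  have h1 : ∀ i, ∑ j, (Pi.single i (Pi.single j (x i j)) : ∀ i j, ShiftedHom (F i) (F j) d) =
      Pi.single i (x i) := by
    intro i
    have := map_sum (LinearMap.single k (fun i => ∀ j, ShiftedHom (F i) (F j) d) i)
      (fun j => Pi.single j (x i j)) Finset.univ
    simp only [LinearMap.coe_single] at this
    rw [← this, Finset.univ_sum_single (x i)]
  refine Eq.trans ?_ (Finset.sum_congr rfl fun i _ => (h1 i).symm)
  exact (Finset.univ_sum_single x).symm

/-- The element of the Ext-algebra given by an element of one of the `Ext` groups. -/
noncomputable def elem (i j : Fin n) (d : ℤ) : ShiftedHom (F i) (F j) d →ₗ[k] ExtAlgebra F :=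
  lof k ℤ (ExtPiece F) d ∘ₗ single k F i j d

/-- The component of an element of the Ext-algebra in one of the `Ext` groups. -/
noncomputable def entry (i j : Fin n) (d : ℤ) : ExtAlgebra F →ₗ[k] ShiftedHom (F i) (F j) d :=
  (LinearMap.proj (R := k) (φ := fun j => ShiftedHom (F i) (F j) d) j ∘ₗ
    LinearMap.proj (R := k) (φ := fun i => ∀ j, ShiftedHom (F i) (F j) d) i :
      ExtPiece F d →ₗ[k] ShiftedHom (F i) (F j) d) ∘ₗ component k ℤ (ExtPiece F) d

theorem elem_apply (i j : Fin n) (d : ℤ) (x : ShiftedHom (F i) (F j) d) :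
    elem k F i j d x = of (ExtPiece F) d (single k F i j d x) := rfl

theorem entry_lof (i j : Fin n) (d : ℤ) (x : ExtPiece F d) :
    entry k F i j d (lof k ℤ (ExtPiece F) d x) = x i j := by
  rw [entry, LinearMap.comp_apply, component.lof_self]
  rfl

theorem entry_lof_ne {i j : Fin n} {d d' : ℤ} (h : d ≠ d') (x : ExtPiece F d) :
    entry k F i j d' (lof k ℤ (ExtPiece F) d x) = 0 := by
  rw [entry, LinearMap.comp_apply, component.of, dif_neg h, map_zero]

theorem entry_elem (i j : Fin n) (d : ℤ) (x : ShiftedHom (F i) (F j) d) :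
    entry k F i j d (elem k F i j d x) = x :=
  (entry_lof k F i j d _).trans (single_same k F i j d x)

theorem entry_elem_ne {i j i' j' : Fin n} {d d' : ℤ} (x : ShiftedHom (F i) (F j) d)
    (h : i = i' → j = j' → d ≠ d') : entry k F i' j' d' (elem k F i j d x) = 0 := by
  by_cases hd : d = d'
  · subst hd
    exact (entry_lof k F i' j' d _).trans (single_ne k F x fun hi hj => h hi.symm hj.symm rfl)
  · exact entry_lof_ne k F hd _

theorem elem_mem (i j : Fin n) (d : ℤ) (x : ShiftedHom (F i) (F j) d) :
    elem k F i j d x ∈ piece k (ExtPiece F) d := ⟨_, rfl⟩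

theorem mem_of_elem_mem {W : Submodule k (ExtAlgebra F)} (h : ∀ i j d x, elem k F i j d x ∈ W)
    (α : ExtAlgebra F) : α ∈ W := by
  induction α using DirectSum.induction_on with
  | zero => exact W.zero_mem
  | add x y hx hy => exact W.add_mem hx hy
  | of d x =>
    have h2 : of (ExtPiece F) d x = ∑ i, ∑ j, elem k F i j d (x i j) := by
      refine (congrArg (lof k ℤ (ExtPiece F) d) (eq_sum_single k F x)).trans ?_
      rw [map_sum]
      exact Finset.sum_congr rfl fun i _ => map_sum (lof k ℤ (ExtPiece F) d) _ _
    rw [h2]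
    exact W.sum_mem fun i _ => W.sum_mem fun j _ => h i j d _

variable [∀ m : ℤ, (shiftFunctor T m).Additive]

theorem elem_mul {i j l : Fin n} {p q r : ℤ} (h : p + q = r) (x : ShiftedHom (F j) (F l) p)
    (y : ShiftedHom (F i) (F j) q) :
    elem k F j l p x * elem k F i j q y = elem k F i l r (y.comp x h) := by
  subst h
  rw [elem_apply, elem_apply, elem_apply, of_mul_of]
  congr 1
  funext i' l'
  change ∑ t, (single k F i j q y i' t).comp (single k F j l p x t l') rfl = _
  rw [Finset.sum_eq_single j]
  · by_cases hi : i' = i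
    · subst hi
      by_cases hl : l' = l
      · subst hl
        rw [single_same, single_same, single_same]
      · rw [single_ne k F x fun _ => hl, single_ne k F _ fun _ => hl, ShiftedHom.comp_zero]
    · rw [single_ne k F y fun h => absurd h hi, single_ne k F _ fun h => absurd h hi,
        ShiftedHom.zero_comp]
  · intro t _ ht
    rw [single_ne k F y fun _ => ht, ShiftedHom.zero_comp]
  · simp

theorem elem_mul_ne {i j j' l : Fin n} {p q : ℤ} (h : j ≠ j') (x : ShiftedHom (F j) (F l) p)
    (y : ShiftedHom (F i) (F j') q) : elem k F j l p x * elem k F i j' q y = 0 := by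
  rw [elem_apply, elem_apply, of_mul_of]
  refine (congrArg (of (ExtPiece F) (p + q)) ?_).trans (map_zero _)
  funext i' l'
  change ∑ t, (single k F i j' q y i' t).comp (single k F j l p x t l') rfl = 0
  refine Finset.sum_eq_zero fun t _ => ?_
  by_cases ht : t = j
  · subst ht
    rw [single_ne k F y fun _ => h, ShiftedHom.zero_comp]
  · rw [single_ne k F x fun h => absurd h ht, ShiftedHom.comp_zero]

/-- A product of elements of `Ext` groups vanishes if the target group is zero or the elements are
not composable. -/
theorem elem_mul_eq_zero {i j j' l : Fin n} {p q : ℤ}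
    (h : j = j' → Subsingleton (ShiftedHom (F i) (F l) (p + q))) (x : ShiftedHom (F j) (F l) p)
    (y : ShiftedHom (F i) (F j') q) : elem k F j l p x * elem k F i j' q y = 0 := by
  by_cases hj : j = j'
  · subst hj
    have := h rfl
    rw [elem_mul k F rfl, Subsingleton.elim (y.comp x rfl) 0, map_zero]
  · exact elem_mul_ne k F hj x y

/-- The identity of `F v` as an element of the Ext-algebra. -/
noncomputable def idem (v : Fin n) : ExtAlgebra F :=
  elem k F v v 0 (ShiftedHom.mk₀ 0 rfl (𝟙 (F v)))

theorem idem_mul (v : Fin n) {i j : Fin n} {d : ℤ} (y : ShiftedHom (F i) (F j) d) :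
    idem k F v * elem k F i j d y = if j = v then elem k F i j d y else 0 := by
  split_ifs with h
  · subst h
    rw [idem, elem_mul k F (zero_add d), ShiftedHom.comp_mk₀_id]
  · exact elem_mul_ne k F (Ne.symm h) _ _

theorem mul_idem (v : Fin n) {i j : Fin n} {d : ℤ} (y : ShiftedHom (F i) (F j) d) :
    elem k F i j d y * idem k F v = if i = v then elem k F i j d y else 0 := by
  split_ifs with h
  · subst h
    rw [idem, elem_mul k F (add_zero d), ShiftedHom.mk₀_id_comp]
  · exact elem_mul_ne k F h _ _

theorem one_eq_sum_idem : (1 : ExtAlgebra F) = ∑ v, idem k F v := by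
  have h1 : (one : ExtPiece F 0) = ∑ v, single k F v v 0 (ShiftedHom.mk₀ 0 rfl (𝟙 (F v))) := by
    rw [eq_sum_single k F one]
    refine Finset.sum_congr rfl fun i _ => ?_
    rw [Finset.sum_eq_single i]
    · simp [one]
    · intro j _ hj
      simp [one, Ne.symm hj]
    · simp
  exact (congrArg (lof k ℤ (ExtPiece F) 0) h1).trans (map_sum (lof k ℤ (ExtPiece F) 0) _ _)

end ExtPiece

/-! ### The zigzag basis of the Ext-algebra of an `A_n`-chain -/

section Chain

variable {k : Type u} [Field k] {T : Type w} [Category.{v} T] [Preadditive T] [Linear k T]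
  [HasShift T ℤ] [∀ m : ℤ, (shiftFunctor T m).Additive] [∀ m : ℤ, (shiftFunctor T m).Linear k]

/-- For a nonzero element of `Ext^m(X, Y)`, duality provides an element of `Ext^(N-m)(Y, X)` with
nonzero product. -/
theorem HasDuality.exists_comp_ne_zero {N : ℕ} {X Y : T} (h : HasDuality k N X Y) {m : ℤ}
    {f : ShiftedHom X Y m} (hf : f ≠ 0) :
    ∃ g : ShiftedHom Y X ((N : ℤ) - m), f.comp g (sub_add_cancel (N : ℤ) m) ≠ 0 := by
  obtain ⟨e, he⟩ := h
  by_contra hall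
  push Not at hall
  refine hf ((he m).bijective_left.1 ?_)
  rw [map_zero]
  refine LinearMap.ext fun g => ?_
  change e (f.comp g (sub_add_cancel (N : ℤ) m)) = 0
  rw [hall g, map_zero]

/-- If `Ext^*(X, Y)` and `Ext^*(Y, X)` have total dimension one and are dual to each other, then
their generators have complementary degrees, and both products of the generators are nonzero. -/
theorem exists_dual_generators {N : ℕ} {X Y : T}
    (hXY : Cardinal.sum (fun m : ℤ => Module.rank k (ShiftedHom X Y m)) = 1)
    (hYX : Cardinal.sum (fun m : ℤ => Module.rank k (ShiftedHom Y X m)) = 1)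
    (dXY : HasDuality k N X Y) (dYX : HasDuality k N Y X) :
    ∃ (d : ℤ) (f : ShiftedHom X Y d) (g : ShiftedHom Y X ((N : ℤ) - d)),
      (∀ y, ∃ c : k, y = c • f) ∧ (∀ y, ∃ c : k, y = c • g) ∧
      (∀ d', d' ≠ d → Subsingleton (ShiftedHom X Y d')) ∧
      (∀ d', d' ≠ (N : ℤ) - d → Subsingleton (ShiftedHom Y X d')) ∧
      f.comp g (sub_add_cancel (N : ℤ) d) ≠ 0 ∧ g.comp f (add_sub_cancel d (N : ℤ)) ≠ 0 := by
  obtain ⟨d, hd, hd'⟩ := exists_of_sum_rank_eq_one hXY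
  obtain ⟨d₂, hd₂, hd₂'⟩ := exists_of_sum_rank_eq_one hYX
  obtain ⟨f, hf, hfs⟩ := rank_eq_one_iff.1 hd
  obtain ⟨g, hg⟩ := dXY.exists_comp_ne_zero hf
  have hg0 : g ≠ 0 := by
    rintro rfl
    exact hg (by simp)
  have hdeg : (N : ℤ) - d = d₂ := by
    by_contra hne
    have := hd₂' _ hne
    exact hg0 (Subsingleton.elim _ _)
  subst hdeg
  refine ⟨d, f, g, exists_smul_eq_of_rank_eq_one hd hf, exists_smul_eq_of_rank_eq_one hd₂ hg0,
    hd', hd₂', hg, ?_⟩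
  obtain ⟨f', hf'⟩ := dYX.exists_comp_ne_zero hg0
  have key : ∀ (d' : ℤ) (hd' : d' = d) (f' : ShiftedHom X Y d') (h : d' + ((N : ℤ) - d) = N),
      g.comp f' h ≠ 0 → g.comp f (add_sub_cancel d (N : ℤ)) ≠ 0 := by
    rintro _ rfl f' h h1 h2
    obtain ⟨c, rfl⟩ := exists_smul_eq_of_rank_eq_one hd hf f'
    exact h1 (by rw [ShiftedHom.comp_smul, h2, smul_zero])
  exact key _ (sub_sub_cancel _ _) f' _ hf'

variable (k) in
/-- Generators of the `Ext` groups between the objects of an `A_n`-chain, where `n = m + 1`,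
together with the constants relating their products to the generators `soc v` of
`Ext^N(F v, F v)`. -/
structure ChainGenerators (N : ℕ) {m : ℕ} (F : Fin (m + 1) → T) where
  d : Fin m → ℤ
  genUp : ∀ i, ShiftedHom (F i.succ) (F i.castSucc) (d i)
  genDn : ∀ i, ShiftedHom (F i.castSucc) (F i.succ) ((N : ℤ) - d i)
  soc : ∀ v, ShiftedHom (F v) (F v) (N : ℤ)
  c_up_dn : Fin m → k
  c_dn_up : Fin m → k
  c_up_dn_ne : ∀ i, c_up_dn i ≠ 0
  c_dn_up_ne : ∀ i, c_dn_up i ≠ 0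
  dn_comp_up : ∀ i, (genDn i).comp (genUp i) (add_sub_cancel (d i) (N : ℤ)) =
    c_up_dn i • soc i.castSucc
  up_comp_dn : ∀ i, (genUp i).comp (genDn i) (sub_add_cancel (N : ℤ) (d i)) =
    c_dn_up i • soc i.succ
  id_ne : ∀ v, (ShiftedHom.mk₀ 0 rfl (𝟙 (F v)) : ShiftedHom (F v) (F v) (0 : ℤ)) ≠ 0
  soc_ne : ∀ v, soc v ≠ 0
  id_span : ∀ v (y : ShiftedHom (F v) (F v) (0 : ℤ)),
    ∃ c : k, y = c • ShiftedHom.mk₀ 0 rfl (𝟙 (F v))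
  soc_span : ∀ v y, ∃ c : k, y = c • soc v
  up_span : ∀ i y, ∃ c : k, y = c • genUp i
  dn_span : ∀ i y, ∃ c : k, y = c • genDn i
  diag_zero : ∀ v (d' : ℤ), d' ≠ 0 → d' ≠ N → Subsingleton (ShiftedHom (F v) (F v) d')
  up_zero : ∀ i d', d' ≠ d i → Subsingleton (ShiftedHom (F i.succ) (F i.castSucc) d')
  dn_zero : ∀ i d', d' ≠ (N : ℤ) - d i → Subsingleton (ShiftedHom (F i.castSucc) (F i.succ) d')
  far_zero : ∀ (i j : Fin (m + 1)) (d' : ℤ), 1 < |(i : ℤ) - (j : ℤ)| →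
    Subsingleton (ShiftedHom (F i) (F j) d')

theorem IsAChain.nonempty_chainGenerators {N m : ℕ} {F : Fin (m + 1) → T} (hF : IsAChain k N F)
    (hdual : ∀ i j, HasDuality k N (F i) (F j)) : Nonempty (ChainGenerators k N F) := by
  have h1 : ∀ i : Fin m, |((i.succ : Fin (m + 1)) : ℤ) - ((i.castSucc : Fin (m + 1)) : ℤ)| = 1 := by
    intro i
    simp
  choose d up dn up_span dn_span up_zero dn_zero hud hdu using fun i : Fin m =>
    exists_dual_generators (hF.adjacent i.succ i.castSucc (h1 i))
      (hF.adjacent i.castSucc i.succ (by rw [abs_sub_comm]; exact h1 i)) (hdual _ _) (hdual _ _)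
  have hN : ∀ v, Module.rank k (ShiftedHom (F v) (F v) (N : ℤ)) = 1 := fun v =>
    (hF.spherical v N).trans (if_pos (Or.inr rfl))
  have h0 : ∀ v, Module.rank k (ShiftedHom (F v) (F v) (0 : ℤ)) = 1 := fun v =>
    (hF.spherical v 0).trans (if_pos (Or.inl rfl))
  choose soc soc_ne hsoc using fun v => rank_eq_one_iff.1 (hN v)
  have soc_span : ∀ v y, ∃ c : k, y = c • soc v := fun v =>
    exists_smul_eq_of_rank_eq_one (hN v) (soc_ne v)
  have id_ne : ∀ v, (ShiftedHom.mk₀ 0 rfl (𝟙 (F v)) : ShiftedHom (F v) (F v) (0 : ℤ)) ≠ 0 := by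
    intro v h
    obtain ⟨x, hx, -⟩ := rank_eq_one_iff.1 (h0 v)
    have h2 := ShiftedHom.mk₀_id_comp (0 : ℤ) rfl x
    rw [h, ShiftedHom.zero_comp] at h2
    exact hx h2.symm
  choose c hc using fun i => soc_span _ ((dn i).comp (up i) (add_sub_cancel (d i) (N : ℤ)))
  choose c' hc' using fun i => soc_span _ ((up i).comp (dn i) (sub_add_cancel (N : ℤ) (d i)))
  exact ⟨{
    d := d
    genUp := up
    genDn := dn
    soc := soc
    c_up_dn := c
    c_dn_up := c'
    c_up_dn_ne := fun i h => hdu i (by rw [hc, h, zero_smul])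
    c_dn_up_ne := fun i h => hud i (by rw [hc', h, zero_smul])
    dn_comp_up := hc
    up_comp_dn := hc'
    id_ne := id_ne
    soc_ne := soc_ne
    id_span := fun v => exists_smul_eq_of_rank_eq_one (h0 v) (id_ne v)
    soc_span := soc_span
    up_span := up_span
    dn_span := dn_span
    diag_zero := fun v d' h h' => by
      rw [← rank_zero_iff (R := k), hF.spherical v d', if_neg (not_or.2 ⟨h, h'⟩)]
    up_zero := up_zero
    dn_zero := dn_zero
    far_zero := fun i j d' h => subsingleton_of_sum_rank_eq_zero (hF.distant i j h) d' }⟩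

end Chain

namespace ChainGenerators

open Letter

variable {k : Type u} [Field k] {T : Type w} [Category.{v} T] [Preadditive T] [Linear k T]
  [HasShift T ℤ] [∀ m : ℤ, (shiftFunctor T m).Additive]

variable {N m : ℕ} {F : Fin (m + 1) → T} (G : ChainGenerators k N F)

/-- The degrees of the generators. -/
def deg : Letter m → ℤ
  | e _ => 0
  | up i => G.d i
  | dn i => N - G.d i
  | s _ => N

/-- The generators, as a family indexed by letters. As the product of the Ext-algebra is composition
in the order of functions, the left vertex of a letter is the target and the right vertex is the
source. -/
noncomputable def gen : ∀ x : Letter m, ShiftedHom (F x.r) (F x.l) (G.deg x)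
  | e t => ShiftedHom.mk₀ 0 rfl (𝟙 (F t.succ))
  | up i => G.genUp i
  | dn i => G.genDn i
  | s v => G.soc v

theorem gen_ne_zero (x : Letter m) : G.gen x ≠ 0 := by
  cases x with
  | e t => exact G.id_ne _
  | s v => exact G.soc_ne v
  | up i =>
    intro h
    have h1 := G.dn_comp_up i
    rw [show G.genUp i = 0 from h, ShiftedHom.comp_zero] at h1
    exact smul_ne_zero (G.c_up_dn_ne i) (G.soc_ne _) h1.symm
  | dn i =>
    intro h
    have h1 := G.dn_comp_up i
    rw [show G.genDn i = 0 from h, ShiftedHom.zero_comp] at h1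
    exact smul_ne_zero (G.c_up_dn_ne i) (G.soc_ne _) h1.symm

/-- The basis elements of the Ext-algebra. -/
noncomputable def basis (x : Letter m) : ExtAlgebra F :=
  ExtPiece.elem k F x.r x.l (G.deg x) (G.gen x)

omit [∀ m : ℤ, (shiftFunctor T m).Additive] in
theorem basis_e (t : Fin m) : G.basis (e t) = ExtPiece.idem k F t.succ := rfl

theorem basis_mul (hN : 2 ≤ N) (x y : Letter m) :
    G.basis x * G.basis y = ∑ z, coeff G.c_up_dn G.c_dn_up x y z • G.basis z := by
  have hzero : ∀ x y : Letter m, (∀ z, coeff G.c_up_dn G.c_dn_up x y z = 0) →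
      (x.r = y.l → Subsingleton (ShiftedHom (F y.r) (F x.l) (G.deg x + G.deg y))) →
      G.basis x * G.basis y = ∑ z, coeff G.c_up_dn G.c_dn_up x y z • G.basis z := by
    intro x y h1 h2
    simp only [h1, zero_smul, Finset.sum_const_zero]
    exact ExtPiece.elem_mul_eq_zero k F h2 _ _
  have he : ∀ (P : Prop) [Decidable P] (x : Letter m), (if P then G.basis x else 0) =
      ∑ z, (if P ∧ z = x then (1 : k) else 0) • G.basis z := by
    intro P _ x
    by_cases hP : P <;> simp [hP, ite_smul]
  have hfar : ∀ (i j : Fin (m + 1)) (d' : ℤ), ((i : ℕ) + 1 < j ∨ (j : ℕ) + 1 < i) →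
      Subsingleton (ShiftedHom (F i) (F j) d') := by
    intro i j d' h
    refine G.far_zero i j d' (lt_abs.2 ?_)
    omega
  cases x with
  | e t =>
    rw [basis_e, basis, ExtPiece.idem_mul]
    exact he _ y
  | up i =>
    cases y with
    | e t =>
      rw [basis_e, basis, ExtPiece.mul_idem]
      exact he _ (up i)
    | up j =>
      refine hzero _ _ (fun z => rfl) fun h => hfar _ _ _ ?_
      have := congrArg Fin.val h
      simp [l, r] at this ⊢
      omega
    | dn j =>
      by_cases hij : i = j
      · subst hij
        have h1 : G.basis (up i) * G.basis (dn i) =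
            ExtPiece.elem k F i.castSucc i.castSucc N _ :=
          ExtPiece.elem_mul k F (add_sub_cancel (G.d i) (N : ℤ)) (G.genUp i) (G.genDn i)
        rw [h1, G.dn_comp_up, map_smul]
        simp only [coeff, true_and, ite_smul, zero_smul, Finset.sum_ite_eq', Finset.mem_univ,
          if_true]
        rfl
      · refine hzero _ _ (fun z => if_neg fun h => hij h.1) fun h => absurd ?_ hij
        exact Fin.succ_injective _ h
    | s v =>
      refine hzero _ _ (fun z => rfl) fun h => ?_
      obtain rfl : i.succ = v := h
      exact G.up_zero i _ (by simp only [deg]; omega)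
  | dn i =>
    cases y with
    | e t =>
      rw [basis_e, basis, ExtPiece.mul_idem]
      exact he _ (dn i)
    | dn j =>
      refine hzero _ _ (fun z => rfl) fun h => hfar _ _ _ ?_
      have := congrArg Fin.val h
      simp [l, r] at this ⊢
      omega
    | up j =>
      by_cases hij : i = j
      · subst hij
        have h1 : G.basis (dn i) * G.basis (up i) =
            ExtPiece.elem k F i.succ i.succ N _ :=
          ExtPiece.elem_mul k F (sub_add_cancel (N : ℤ) (G.d i)) (G.genDn i) (G.genUp i)
        rw [h1, G.up_comp_dn, map_smul]
        simp only [coeff, true_and, ite_smul, zero_smul, Finset.sum_ite_eq', Finset.mem_univ,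
          if_true]
        rfl
      · refine hzero _ _ (fun z => if_neg fun h => hij h.1) fun h => absurd ?_ hij
        exact Fin.castSucc_injective _ h
    | s v =>
      refine hzero _ _ (fun z => rfl) fun h => ?_
      obtain rfl : i.castSucc = v := h
      exact G.dn_zero i _ (by simp only [deg]; omega)
  | s v =>
    cases y with
    | e t =>
      rw [basis_e, basis, ExtPiece.mul_idem]
      exact he _ (s v)
    | up j =>
      refine hzero _ _ (fun z => rfl) fun h => ?_
      obtain rfl : v = j.castSucc := h
      exact G.up_zero j _ (by simp only [deg]; omega)
    | dn j =>
      refine hzero _ _ (fun z => rfl) fun h => ?_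
      obtain rfl : v = j.succ := h
      exact G.dn_zero j _ (by simp only [deg]; omega)
    | s v' =>
      refine hzero _ _ (fun z => rfl) fun h => ?_
      obtain rfl : v = v' := h
      exact G.diag_zero v _ (by simp only [deg]; omega) (by simp only [deg]; omega)

theorem basis_span (α : ExtAlgebra F) :
    ∃ (r : k) (μ : Letter m → k), α = r • 1 + ∑ x, μ x • G.basis x := by
  have key : α ∈ Submodule.span k (insert 1 (Set.range G.basis)) := by
    set W := Submodule.span k (insert 1 (Set.range G.basis))
    have hb : ∀ x, G.basis x ∈ W := fun x =>
      Submodule.subset_span (Set.mem_insert_of_mem _ ⟨x, rfl⟩)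
    have h1 : (1 : ExtAlgebra F) ∈ W := Submodule.subset_span (Set.mem_insert _ _)
    have hidem : ∀ v, ExtPiece.idem k F v ∈ W := by
      refine Fin.cases ?_ fun t => hb (e t)
      rw [ExtPiece.one_eq_sum_idem k, Fin.sum_univ_succ] at h1
      exact (Submodule.add_mem_iff_left _ (Submodule.sum_mem _ fun t _ => hb (e t))).1 h1
    refine ExtPiece.mem_of_elem_mem k F (fun i j d x => ?_) α
    have h0 : Subsingleton (ShiftedHom (F i) (F j) d) → ExtPiece.elem k F i j d x ∈ W := by
      intro h
      rw [Subsingleton.elim x 0, map_zero]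
      exact W.zero_mem
    rcases lt_trichotomy (i : ℕ) j with hij | hij | hij
    · by_cases h2 : (i : ℕ) + 1 = j
      · obtain ⟨t, rfl, rfl⟩ : ∃ t : Fin m, i = t.castSucc ∧ j = t.succ :=
          ⟨⟨i, by omega⟩, rfl, Fin.ext h2.symm⟩
        by_cases hd : d = N - G.d t
        · subst hd
          obtain ⟨c, rfl⟩ := G.dn_span t x
          rw [map_smul]
          exact W.smul_mem _ (hb (dn t))
        · exact h0 (G.dn_zero t d hd)
      · exact h0 (G.far_zero i j d (lt_abs.2 (by omega)))
    · obtain rfl : i = j := Fin.ext hij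
      by_cases hd : d = 0
      · subst hd
        obtain ⟨c, rfl⟩ := G.id_span i x
        rw [map_smul]
        exact W.smul_mem _ (hidem i)
      · by_cases hd' : d = N
        · subst hd'
          obtain ⟨c, rfl⟩ := G.soc_span i x
          rw [map_smul]
          exact W.smul_mem _ (hb (s i))
        · exact h0 (G.diag_zero i d hd hd')
    · by_cases h2 : (j : ℕ) + 1 = i
      · obtain ⟨t, rfl, rfl⟩ : ∃ t : Fin m, i = t.succ ∧ j = t.castSucc :=
          ⟨⟨j, by omega⟩, Fin.ext h2.symm, rfl⟩
        by_cases hd : d = G.d t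
        · subst hd
          obtain ⟨c, rfl⟩ := G.up_span t x
          rw [map_smul]
          exact W.smul_mem _ (hb (up t))
        · exact h0 (G.up_zero t d hd)
      · exact h0 (G.far_zero i j d (lt_abs.2 (by omega)))
  obtain ⟨r, z, hz, hα⟩ := Submodule.mem_span_insert.1 key
  obtain ⟨μ, rfl⟩ := (Submodule.mem_span_range_iff_exists_fun k).1 hz
  exact ⟨r, μ, hα⟩

theorem basis_ind (hN : 2 ≤ N) (r : k) (μ : Letter m → k)
    (h : r • (1 : ExtAlgebra F) + ∑ x, μ x • G.basis x = 0) : r = 0 ∧ μ = 0 := by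
  have hr : r = 0 := by
    have h1 := congrArg (ExtPiece.entry k F 0 0 0) h
    rw [map_add, map_smul, map_sum, map_zero, ExtPiece.one_eq_sum_idem k, map_sum,
      Finset.sum_eq_single 0, ExtPiece.idem, ExtPiece.entry_elem,
      Finset.sum_eq_zero, add_zero] at h1
    · exact (smul_eq_zero.1 h1).resolve_right (G.id_ne 0)
    · intro x _
      rw [map_smul, basis, ExtPiece.entry_elem_ne, smul_zero]
      intro h2 h3
      cases x with
      | e t => exact absurd h2 (Fin.succ_ne_zero t)
      | up i => exact absurd h2 (Fin.succ_ne_zero i)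
      | dn i => exact absurd h3 (Fin.succ_ne_zero i)
      | s v => simp only [deg]; omega
    · intro v _ hv
      exact ExtPiece.entry_elem_ne k F _ fun h2 => absurd h2 hv
    · simp
  refine ⟨hr, funext fun x => ?_⟩
  rw [hr, zero_smul, zero_add] at h
  have h1 := congrArg (ExtPiece.entry k F x.r x.l (G.deg x)) h
  rw [map_sum, map_zero, Finset.sum_eq_single x, map_smul, basis, ExtPiece.entry_elem] at h1
  · exact (smul_eq_zero.1 h1).resolve_right (G.gen_ne_zero x)
  · intro z _ hz
    rw [map_smul, basis, ExtPiece.entry_elem_ne, smul_zero]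
    intro h2 h3 h4
    refine hz ?_
    have h5 := congrArg Fin.val h2
    have h6 := congrArg Fin.val h3
    cases z <;> cases x <;> simp [Letter.l, Letter.r, deg] at h5 h6 h4 ⊢ <;> omega
  · simp

/-- The potential on the vertices which measures the deviation of the degrees from the symmetric
case `2 * d i = N`. -/
def potential (v : Fin (m + 1)) : ℤ := ∑ i : Fin m, if i.castSucc < v then 2 * G.d i - N else 0

omit [∀ m : ℤ, (shiftFunctor T m).Additive] in
theorem potential_succ (i : Fin m) :
    G.potential i.succ - G.potential i.castSucc = 2 * G.d i - N := by
  rw [potential, potential, ← Finset.sum_sub_distrib, Finset.sum_eq_single i]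
  · simp
  · intro j _ hj
    have h : j.castSucc < i.succ ↔ j.castSucc < i.castSucc := by
      have : (j : ℕ) ≠ i := fun h => hj (Fin.ext h)
      rw [Fin.lt_def, Fin.lt_def]
      simp
      omega
    simp only [h, sub_self]
  · simp

/-- The zigzag basis of the Ext-algebra of an `A_n`-chain. -/
noncomputable def zigzagBasis [∀ m : ℤ, (shiftFunctor T m).Linear k] (hN : 2 ≤ N) :
    ZigzagBasis (DirectSum.piece k (ExtPiece F)) N m where
  β := G.basis
  up_dn := G.c_up_dn
  dn_up := G.c_dn_up
  up_dn_ne := G.c_up_dn_ne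
  dn_up_ne := G.c_dn_up_ne
  mul := G.basis_mul hN
  span := G.basis_span
  ind := G.basis_ind hN
  deg := G.deg
  mem x := ExtPiece.elem_mem k F _ _ _ _
  p := G.potential
  deg_eq x := by
    cases x with
    | e t => simp [deg, wt, l, r]
    | s v => simp [deg, wt, l, r, mul_comm]
    | up i =>
      have := G.potential_succ i
      simp only [deg, wt, l, r, Nat.cast_one, mul_one]
      linarith
    | dn i =>
      have := G.potential_succ i
      simp only [deg, wt, l, r, Nat.cast_one, mul_one]
      linarith

end ChainGenerators

theorem mainTheorem4 (k : Type u) [Field k] {T : Type w} [Category.{v} T] [Preadditive T]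
    [Linear k T] [HasShift T ℤ] [∀ m : ℤ, (shiftFunctor T m).Additive]
    [∀ m : ℤ, (shiftFunctor T m).Linear k]
    (N : ℕ) (hN : 2 ≤ N) (n : ℕ) (F : Fin n → T)
    (hF : IsAChain k N F) (hdual : ∀ i j : Fin n, HasDuality k N (F i) (F j)) :
    IsIntrinsicallyFormal.{u, v, b} k (A := ExtAlgebra F) (DirectSum.piece k (ExtPiece F)) := by
  cases n with
  | zero =>
    have hpiece : ∀ m, Subsingleton (ExtPiece F m) := fun m =>
      inferInstanceAs (Subsingleton (∀ i j : Fin 0, ShiftedHom (F i) (F j) m))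
    have : Subsingleton (ExtAlgebra F) := inferInstance
    exact isIntrinsicallyFormal_of_subsingleton _
  | succ m =>
    obtain ⟨G⟩ := hF.nonempty_chainGenerators hdual
    exact (G.zigzagBasis hN).isIntrinsicallyFormal hN
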